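/- Let $G\rightrightarrows M$ be a Lie groupoid (Hausdorff, finite-dimensional, without boundary) with compact unit space $M$, range $r$, source $s$, units $\upsilon:M\to G$, inversion $\iota$, multiplication $m$ on composable pairs $G^{(2)}=\{s(\gamma_1)=r(\gamma_2)\}$, and Lie algebroid $AG=\ker ds|_M$. Let $\Gamma=T^*G\rightrightarrows A^*G$ be the cotangent (symplectic) groupoid: $A^*G$ is embedded in $T^*G$ as the conormal bundle of $M$, $$r_\Gamma(\gamma,\xi)=\big(r(\gamma),\,X\mapsto \xi(dR_\gamma X)\big),\qquad s_\Gamma(\gamma,\xi)=\big(s(\gamma),\,X\mapsto -\xi(d(L_\gamma\circ\iota) X)\big),$$ and $(\gamma_1,\xi_1)(\gamma_2,\xi_2)=(\gamma_1\gamma_2,\xi)$, defined when $s_\Gamma(\gamma_1,\xi_1)=r_\Gamma(\gamma_2,\xi_2)$, with $\xi(dm(t_1,t_2))=\xi_1(t_1)+\xi_2(t_2)$ for $(t_1,t_2)$ tangent to $G^{(2)}$. Write $\ker r_\Gamma$, $\ker s_\Gamma$ for the sets where the covector component of $r_\Gamma$, $s_\Gamma$ vanishes. Let $p_0\in C^\infty(A^*G\setminus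 0)$ be real-valued and positively homogeneous of degree $1$ in the fibers (for instance the homogeneous principal symbol, when it is real, of a first-order elliptic pseudodifferential $G$-operator), and let $p=p_0\circ r_\Gamma$ on $T^*G\setminus\ker r_\Gamma$. Let $\omega=d\gamma\wedge d\xi$ be the canonical symplectic form and $H_p$ the Hamiltonian vector field, $\omega(H_p,\cdot)=dp$. Then $H_p$ has a flow $\chi_t$ on $T^*G\setminus\ker r_\Gamma$ defined for all $t\in\mathbb R$, and with $\Lambda_t=\chi_t(A^*G\setminus 0)$: 1. for every $t\in\mathbb R$, $\Lambda_t$ is an invertible $G$-relation, that is, a Lagrangian submanifold of $T^*G\setminus 0$, stable under $(\gamma,\xi)\mapsto(\gamma,a\xi)$ for $a>0$, disjoint from $\ker r_\Gamma\cup\ker s_\Gamma$, and such that each of $s_\Gamma|_{\Lambda_t}$ and $r_\Gamma|_{\Lambda_t}$ is a diffeomorphism onto its image, which is an open subset of $A^*G$; 2. for all $t_1,t_2\in\mathbb R$, $\Lambda_{t_1}\cdot\Lambda_{t_2}=\Lambda_{t_1+t_2}$, where $\Lambda\cdot\Lambda'$ is the set of all products in $\Gamma$ of composable pairs from $\Lambda\times\Lambda'$.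 -/

import Mathlib

open Set Filter Topology Bundle Manifold
open scoped Manifold ContDiff

noncomputable section

/-! ### Lie groupoids -/

/-- A Lie groupoid `G ⇉ M`. The value of `mul γ₁ γ₂` is meaningful only for composable pairs,
that is, when `src γ₁ = rng γ₂`. -/
structure LieGroupoid (E F G M : Type*)
    [NormedAddCommGroup E] [NormedSpace ℝ E] [NormedAddCommGroup F] [NormedSpace ℝ F]
    [TopologicalSpace G] [ChartedSpace E G] [TopologicalSpace M] [ChartedSpace F M] where
  /-- the source map `s` -/
  src : G → M
  /-- the range map `r` -/
  rng : G → M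
  /-- the unit section `υ` -/
  unit : M → G
  /-- the inversion `ι` -/
  inv : G → G
  /-- the multiplication `m` -/
  mul : G → G → G
  isSubmersion_src : IsSubmersion 𝓘(ℝ, E) 𝓘(ℝ, F) ∞ src
  isSubmersion_rng : IsSubmersion 𝓘(ℝ, E) 𝓘(ℝ, F) ∞ rng
  contMDiff_unit : ContMDiff 𝓘(ℝ, F) 𝓘(ℝ, E) ∞ unit
  contMDiff_inv : ContMDiff 𝓘(ℝ, E) 𝓘(ℝ, E) ∞ inv
  contMDiffOn_mul : ContMDiffOn (𝓘(ℝ, E).prod 𝓘(ℝ, E)) 𝓘(ℝ, E) ∞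
    (fun γ : G × G ↦ mul γ.1 γ.2) {γ : G × G | src γ.1 = rng γ.2}
  src_unit : ∀ x, src (unit x) = x
  rng_unit : ∀ x, rng (unit x) = x
  rng_mul : ∀ γ₁ γ₂, src γ₁ = rng γ₂ → rng (mul γ₁ γ₂) = rng γ₁
  src_mul : ∀ γ₁ γ₂, src γ₁ = rng γ₂ → src (mul γ₁ γ₂) = src γ₂
  unit_mul : ∀ γ, mul (unit (rng γ)) γ = γ
  mul_unit : ∀ γ, mul γ (unit (src γ)) = γ
  rng_inv : ∀ γ, rng (inv γ) = src γ
  src_inv : ∀ γ, src (inv γ) = rng γ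
  mul_inv : ∀ γ, mul γ (inv γ) = unit (rng γ)
  inv_mul : ∀ γ, mul (inv γ) γ = unit (src γ)
  mul_assoc : ∀ γ₁ γ₂ γ₃, src γ₁ = rng γ₂ → src γ₂ = rng γ₃ →
    mul (mul γ₁ γ₂) γ₃ = mul γ₁ (mul γ₂ γ₃)

/-! ### Submanifolds, one-forms -/

section Manifold

variable {V H X : Type*} [NormedAddCommGroup V] [NormedSpace ℝ V] [TopologicalSpace H]
  [TopologicalSpace X] [ChartedSpace H X]

/-- `S` is an embedded `C^∞` submanifold of dimension `k` of the (boundaryless) manifold `X`: around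
each of its points there is a chart of the maximal atlas in which `S` is a `k`-dimensional linear
subspace. -/
def IsEmbeddedSubmanifold (I : ModelWithCorners ℝ V H) (k : ℕ) (S : Set X) : Prop :=
  ∀ x ∈ S, ∃ e ∈ IsManifold.maximalAtlas I ∞ X, x ∈ e.source ∧
    ∃ W : Submodule ℝ V, Module.finrank ℝ W = k ∧ ∀ y ∈ e.source, y ∈ S ↔ e.extend I y ∈ W

/-- The tangent vectors at `x` to a submanifold `S`: velocities at time `0` of curves in `S`
through `x`. -/
def tangentVectors (I : ModelWithCorners ℝ V H) (S : Set X) (x : X) : Set (TangentSpace I x) :=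
  {v | ∃ c : ℝ → X, c 0 = x ∧ (∀ᶠ t in 𝓝 0, c t ∈ S) ∧
    HasMFDerivAt 𝓘(ℝ, ℝ) I c 0 ((1 : ℝ →L[ℝ] ℝ).smulRight (show TangentSpace I (c 0) from v))}

/-- The expression in the chart at `x₀` of a one-form `θ`. -/
def oneFormInChart (I : ModelWithCorners ℝ V H) (θ : ∀ x : X, TangentSpace I x →L[ℝ] ℝ) (x₀ : X)
    (y : V) : V →L[ℝ] ℝ :=
  (θ ((extChartAt I x₀).symm y)).comp (mfderiv 𝓘(ℝ, V) I (extChartAt I x₀).symm y)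

/-- The exterior derivative `dθ` of a one-form `θ` on a boundaryless manifold, at the point `x`,
computed in the chart at `x` (through which `TangentSpace I x` is identified with `V`). -/
def extDerivOneForm (I : ModelWithCorners ℝ V H) (θ : ∀ x : X, TangentSpace I x →L[ℝ] ℝ) (x : X)
    (u v : TangentSpace I x) : ℝ :=
  (fderiv ℝ (oneFormInChart I θ x) (extChartAt I x x) u : V →L[ℝ] ℝ) v -
    (fderiv ℝ (oneFormInChart I θ x) (extChartAt I x x) v : V →L[ℝ] ℝ) u

end Manifold

/-! ### The cotangent bundle and its symplectic structure -/

section Cotangent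

variable (E G : Type*) [NormedAddCommGroup E] [NormedSpace ℝ E]
  [TopologicalSpace G] [ChartedSpace E G]

/-- The cotangent bundle `T*G`; its elements are pairs `⟨γ, ξ⟩` with `ξ` a covector at `γ`. -/
abbrev CotangentBundle : Type _ :=
  TotalSpace (E →L[ℝ] ℝ) (fun γ : G ↦ TangentSpace 𝓘(ℝ, E) γ →L[ℝ] ℝ)

/-- The model with corners of the manifold `T*G`. -/
abbrev cotangentModel :
    ModelWithCorners ℝ (E × (E →L[ℝ] ℝ)) (ModelProd E (E →L[ℝ] ℝ)) :=
  𝓘(ℝ, E).prod 𝓘(ℝ, E →L[ℝ] ℝ)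

variable {E G}

/-- The dilation `a.(γ, ξ) = (γ, a ξ)`. -/
def dilation (a : ℝ) (δ : CotangentBundle E G) : CotangentBundle E G := ⟨δ.1, a • δ.2⟩

variable [IsManifold 𝓘(ℝ, E) ∞ G]

/-- The canonical one-form `α = ξ dγ` of `T*G`. -/
def canonicalOneForm (δ : CotangentBundle E G) :
    TangentSpace (cotangentModel E) δ →L[ℝ] ℝ :=
  δ.2.comp (mfderiv (cotangentModel E) 𝓘(ℝ, E) (fun η : CotangentBundle E G ↦ η.1) δ)

/-- The canonical symplectic form `ω = -dα = dγ ∧ dξ` of `T*G`. -/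
def symplecticForm (δ : CotangentBundle E G) (u v : TangentSpace (cotangentModel E) δ) : ℝ :=
  -extDerivOneForm (cotangentModel E) canonicalOneForm δ u v

/-- `v` is the value at `δ` of the Hamiltonian vector field `H_p`: `ω(H_p, ·) = dp`. -/
def IsHamiltonianVector (p : CotangentBundle E G → ℝ) (δ : CotangentBundle E G)
    (v : TangentSpace (cotangentModel E) δ) : Prop :=
  ∀ w : TangentSpace (cotangentModel E) δ,
    symplecticForm δ v w = mfderiv (cotangentModel E) 𝓘(ℝ, ℝ) p δ w

/-- `χ` is a complete flow on `U` of the Hamiltonian vector field `H_p`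
(the values of `χ t` outside `U` are irrelevant). -/
def IsHamiltonianFlow (p : CotangentBundle E G → ℝ) (U : Set (CotangentBundle E G))
    (χ : ℝ → CotangentBundle E G → CotangentBundle E G) : Prop :=
  ∀ δ ∈ U, χ 0 δ = δ ∧ ∀ t : ℝ, χ t δ ∈ U ∧
    ∃ v : TangentSpace (cotangentModel E) (χ t δ), IsHamiltonianVector p (χ t δ) v ∧
      HasMFDerivAt 𝓘(ℝ, ℝ) (cotangentModel E) (fun τ ↦ χ τ δ) t ((1 : ℝ →L[ℝ] ℝ).smulRight v)

/-- `S` is a homogeneous Lagrangian submanifold of `T*G ∖ 0`: it is a submanifold of half the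
dimension of `T*G`, on which `ω` vanishes, and it is stable under positive dilations. -/
structure IsHomogeneousLagrangian (S : Set (CotangentBundle E G)) : Prop where
  ne_zero : ∀ δ ∈ S, δ.2 ≠ 0
  dilation_mem : ∀ a : ℝ, 0 < a → ∀ δ ∈ S, dilation a δ ∈ S
  submanifold : IsEmbeddedSubmanifold (cotangentModel E) (Module.finrank ℝ E) S
  isotropic : ∀ δ ∈ S, ∀ u ∈ tangentVectors (cotangentModel E) S δ,
    ∀ v ∈ tangentVectors (cotangentModel E) S δ, symplecticForm δ u v = 0

end Cotangent

/-! ### The cotangent groupoid `Γ = T*G ⇉ A*G` -/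

namespace LieGroupoid

variable {E F G M : Type*}
  [NormedAddCommGroup E] [NormedSpace ℝ E] [NormedAddCommGroup F] [NormedSpace ℝ F]
  [TopologicalSpace G] [ChartedSpace E G] [TopologicalSpace M] [ChartedSpace F M]
  (𝒢 : LieGroupoid E F G M)

/-- The set `G⁽²⁾` of composable pairs. -/
def composable : Set (G × G) := {γ | 𝒢.src γ.1 = 𝒢.rng γ.2}

/-- The differential of the multiplication `m : G⁽²⁾ → G` at a composable pair. It is meaningful on
vectors tangent to `G⁽²⁾`, that is, on pairs `(t₁, t₂)` with `ds(t₁) = dr(t₂)`. -/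
def dmul (γ₁ γ₂ : G) : E × E →L[ℝ] E :=
  mfderivWithin (𝓘(ℝ, E).prod 𝓘(ℝ, E)) 𝓘(ℝ, E) (fun γ : G × G ↦ 𝒢.mul γ.1 γ.2) 𝒢.composable
    (γ₁, γ₂)

/-- The differential at `υ(r(γ))` of right multiplication by `γ`, meaningful on the tangent space
`ker ds` of the `s`-fiber: `dR_γ(X) = dm(X, 0)`. -/
def dRightMul (γ : G) : E →L[ℝ] E :=
  (𝒢.dmul (𝒢.unit (𝒢.rng γ)) γ).comp (ContinuousLinearMap.inl ℝ E E)

/-- The differential at `υ(s(γ))` of left multiplication by `γ`, meaningful on the tangent space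
`ker dr` of the `r`-fiber: `dL_γ(X) = dm(0, X)`. -/
def dLeftMul (γ : G) : E →L[ℝ] E :=
  (𝒢.dmul γ (𝒢.unit (𝒢.src γ))).comp (ContinuousLinearMap.inr ℝ E E)

/-- The differential of the inversion at the unit `υ(x)`. -/
def dinv (x : M) : E →L[ℝ] E := mfderiv 𝓘(ℝ, E) 𝓘(ℝ, E) 𝒢.inv (𝒢.unit x)

/-- The differential of `υ ∘ s` at `υ(x)`: the projection of the tangent space of `G` at `υ(x)`
onto the tangent space of the units, along `ker ds`. -/
def dUnitSrc (x : M) : E →L[ℝ] E :=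
  mfderiv 𝓘(ℝ, E) 𝓘(ℝ, E) (fun γ ↦ 𝒢.unit (𝒢.src γ)) (𝒢.unit x)

/-- The projection of the tangent space of `G` at `υ(x)` onto `A_xG = ker ds` along the tangent
space of the units. -/
def algebroidProj (x : M) : E →L[ℝ] E :=
  ContinuousLinearMap.id ℝ E - 𝒢.dUnitSrc x

/-- The dual `A*G` of the Lie algebroid `AG = ker ds|_M`, as the unit space of `T*G`: a linear form
on `A_xG` is identified with its extension to the tangent space of `G` at `υ(x)` that vanishes on
the tangent space of the units. -/
def dualAlgebroid : Set (CotangentBundle E G) :=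
  {δ | ∃ x : M, δ.1 = 𝒢.unit x ∧
    ∀ w : F, (δ.2 : E →L[ℝ] ℝ) ((mfderiv 𝓘(ℝ, F) 𝓘(ℝ, E) 𝒢.unit x : F →L[ℝ] E) w) = 0}

/-- `Λ₀ = A*G ∖ 0`. -/
def dualAlgebroidNonzero : Set (CotangentBundle E G) := {δ ∈ 𝒢.dualAlgebroid | δ.2 ≠ 0}

/-- The range map of the cotangent groupoid: `r_Γ(γ, ξ)` is the form `X ↦ ξ(dR_γ X)` on
`A_{r(γ)}G`. -/
def cotRng (δ : CotangentBundle E G) : CotangentBundle E G :=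
  ⟨𝒢.unit (𝒢.rng δ.1),
    (δ.2 : E →L[ℝ] ℝ).comp ((𝒢.dRightMul δ.1).comp (𝒢.algebroidProj (𝒢.rng δ.1)))⟩

/-- The source map of the cotangent groupoid: `s_Γ(γ, ξ)` is the form `X ↦ -ξ(d(L_γ ∘ ι) X)` on
`A_{s(γ)}G`. -/
def cotSrc (δ : CotangentBundle E G) : CotangentBundle E G :=
  ⟨𝒢.unit (𝒢.src δ.1),
    -(δ.2 : E →L[ℝ] ℝ).comp ((𝒢.dLeftMul δ.1).comp
      ((𝒢.dinv (𝒢.src δ.1)).comp (𝒢.algebroidProj (𝒢.src δ.1))))⟩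

/-- `ker r_Γ`. -/
def kerCotRng : Set (CotangentBundle E G) := {δ | (𝒢.cotRng δ).2 = 0}

/-- `ker s_Γ`. -/
def kerCotSrc : Set (CotangentBundle E G) := {δ | (𝒢.cotSrc δ).2 = 0}

/-- `δ` is the product `δ₁ δ₂` in the cotangent groupoid: `s_Γ(δ₁) = r_Γ(δ₂)` and
`δ = (γ₁γ₂, ξ)` with `ξ(dm(t₁, t₂)) = ξ₁(t₁) + ξ₂(t₂)` for all `(t₁, t₂)` tangent to `G⁽²⁾`. -/
def IsCotMul (δ₁ δ₂ δ : CotangentBundle E G) : Prop :=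
  𝒢.cotSrc δ₁ = 𝒢.cotRng δ₂ ∧ δ.1 = 𝒢.mul δ₁.1 δ₂.1 ∧
    ∀ t₁ t₂ : E,
      (mfderiv 𝓘(ℝ, E) 𝓘(ℝ, F) 𝒢.src δ₁.1 : E →L[ℝ] F) t₁ =
        (mfderiv 𝓘(ℝ, E) 𝓘(ℝ, F) 𝒢.rng δ₂.1 : E →L[ℝ] F) t₂ →
      (δ.2 : E →L[ℝ] ℝ) (𝒢.dmul δ₁.1 δ₂.1 (t₁, t₂)) =
        (δ₁.2 : E →L[ℝ] ℝ) t₁ + (δ₂.2 : E →L[ℝ] ℝ) t₂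

/-- The product `Λ₁.Λ₂` of two subsets of the cotangent groupoid. -/
def cotMulSet (S₁ S₂ : Set (CotangentBundle E G)) : Set (CotangentBundle E G) :=
  {δ | ∃ δ₁ ∈ S₁, ∃ δ₂ ∈ S₂, 𝒢.IsCotMul δ₁ δ₂ δ}

variable [IsManifold 𝓘(ℝ, E) ∞ G]

/-- A `G`-relation: a homogeneous Lagrangian submanifold of `T*G ∖ 0` that avoids the kernels of
`r_Γ` and `s_Γ`. -/
structure IsGRelation (S : Set (CotangentBundle E G)) : Prop where
  lagrangian : IsHomogeneousLagrangian S
  notMem_kerCotRng : ∀ δ ∈ S, δ ∉ 𝒢.kerCotRng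
  notMem_kerCotSrc : ∀ δ ∈ S, δ ∉ 𝒢.kerCotSrc

/-- The restriction of `f : T*G → A*G` to `S` is a diffeomorphism onto its image, the latter being
open in `A*G`. -/
structure IsDiffeoOntoImage (f : CotangentBundle E G → CotangentBundle E G)
    (S : Set (CotangentBundle E G)) : Prop where
  contMDiffOn : ContMDiffOn (cotangentModel E) (cotangentModel E) ∞ f S
  exists_inverse : ∃ g : CotangentBundle E G → CotangentBundle E G,
    ContMDiffOn (cotangentModel E) (cotangentModel E) ∞ g (f '' S) ∧ ∀ δ ∈ S, g (f δ) = δ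
  isOpen_image : ∃ O : Set (CotangentBundle E G), IsOpen O ∧ f '' S = O ∩ 𝒢.dualAlgebroid

/-- An invertible `G`-relation. -/
structure IsInvertibleGRelation (S : Set (CotangentBundle E G)) : Prop where
  isGRelation : 𝒢.IsGRelation S
  diffeo_cotSrc : 𝒢.IsDiffeoOntoImage 𝒢.cotSrc S
  diffeo_cotRng : 𝒢.IsDiffeoOntoImage 𝒢.cotRng S

/-- `p₀` is a symbol homogeneous of degree one: a real-valued `C^∞` function on `A*G ∖ 0` with
`p₀(x, a ξ) = a p₀(x, ξ)` for `a > 0` (the values of `p₀` elsewhere are irrelevant). -/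
structure IsHomogeneousSymbol (p₀ : CotangentBundle E G → ℝ) : Prop where
  contMDiffOn : ContMDiffOn (cotangentModel E) 𝓘(ℝ, ℝ) ∞ p₀ 𝒢.dualAlgebroidNonzero
  homogeneous : ∀ a : ℝ, 0 < a → ∀ δ ∈ 𝒢.dualAlgebroidNonzero, p₀ (dilation a δ) = a * p₀ δ

end LieGroupoid

end

/-! The function `p = p₀ ∘ r_Γ` is right-invariant and homogeneous of degree one, and the theorem
follows from these two facts. Let `α` be the canonical one-form, so that `ω = -dα`. Right
translation by a local bisection `σ` lifts to `T*G`. Shifted by the differential of `f ∘ s`, the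
lift changes `α` only by an exact form and preserves `r_Γ` (`canForm_cotTransl`,
`cotRng_cotTransl`); hence it preserves `ω` and `p` and permutes the Hamiltonian curves. For
suitable `σ` and `f` it carries `r_Γ(δ)` to `δ` (`exists_cotTransl`).

Completeness: `r_Γ(γ, ξ)` sees `ξ` only on `ker ds`, so `ds(H_p) = 0` and the source of the base
point is constant along Hamiltonian curves. A curve through `r_Γ(δ)` therefore stays in the domain
of the translation and becomes a curve through `δ` with the same time of existence. It remains to
bound that time from below on `A*G ∖ 0`. Dilations permute the curves, so unit covectors suffice,
and these are handled by the compactness of spheres and of `M` (`exists_isHamFlow`). A uniform time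
of existence gives a complete flow.

Source and product: Euler's relation `α(H_p) = p` and Cartan's formula give `χ_t^* α = α`
(`canForm_comp_md`). Translation invariance shows that the base point of `χ_t(δ)` is that of
`χ_t(r_Γ(δ))` times that of `δ` (`flow_proj`). Differentiating this along a family in the fiber of
`r_Γ` over `η` and comparing `α` before and after the flow gives `s_Γ(χ_t(η)) = η` for `η` in `A*G ∖
0` (`flow_form_dmul`, `cotSrc_flow`). With the same ingredients, `χ_t(δ) = χ_t(r_Γ(δ)) · δ`
(`isCotMul_flow`). For a composable pair `χ_{t₁}(η₁)`, `χ_{t₂}(η₂)` one has `η₁ = r_Γ(χ_{t₂}(η₂))`,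
so that the product is `χ_{t₁}(χ_{t₂}(η₂)) = χ_{t₁+t₂}(η₂)`.

Geometry of `Λ_t`: the map `χ_t ∘ s_Γ` is a smooth retraction of the complement of `ker s_Γ` onto
`Λ_t`, which makes `Λ_t` a submanifold; its dimension is that of `A*G`. Since `s_Γ^* α = 0` and
`χ_t` preserves `α`, the retraction pulls `α` back to zero, so `ω` vanishes on `Λ_t`. The inverse of
`s_Γ` on `Λ_t` is `χ_t`, and that of `r_Γ` is `χ_t ∘ r_Γ ∘ χ_{-t}`.

The smoothness of the flow is derived from the implicit function theorem in a Banach space of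
continuous curves. -/

noncomputable section

/-! ### Smooth dependence of the solutions of an ODE on the initial conditions -/

section SmoothFlow

universe u

set_option synthInstance.maxHeartbeats 200000

variable {K : Type*} [TopologicalSpace K] [CompactSpace K]
  {V W : Type u} [NormedAddCommGroup V] [NormedSpace ℝ V] [NormedAddCommGroup W] [NormedSpace ℝ W]

/-- The superposition operator `u ↦ f ∘ u` on continuous functions. -/
def superposition (K : Type*) [TopologicalSpace K] (f : C(V, W)) (u : C(K, V)) : C(K, W) :=
  f.comp u

/-- Pointwise application of a continuous family of linear maps, as a bounded bilinear map. -/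
def pointwiseApply (K : Type*) [TopologicalSpace K] [CompactSpace K] (V W : Type*)
    [NormedAddCommGroup V] [NormedSpace ℝ V] [NormedAddCommGroup W] [NormedSpace ℝ W] :
    C(K, V →L[ℝ] W) →L[ℝ] C(K, V) →L[ℝ] C(K, W) :=
  LinearMap.mkContinuous₂
    (LinearMap.mk₂ ℝ (fun (A : C(K, V →L[ℝ] W)) (h : C(K, V)) ↦
        (⟨fun t ↦ A t (h t), A.continuous.clm_apply h.continuous⟩ : C(K, W)))
      (fun _ _ _ ↦ by ext; simp) (fun _ _ _ ↦ by ext; simp) (fun _ _ _ ↦ by ext; simp)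
      (fun _ _ _ ↦ by ext; simp)) 1 (fun A h ↦ by
        rw [one_mul, ContinuousMap.norm_le _ (by positivity)]
        intro t
        exact (A t).le_of_opNorm_le_of_le (A.norm_coe_le_norm t) (h.norm_coe_le_norm t))

@[simp] lemma pointwiseApply_apply (A : C(K, V →L[ℝ] W)) (h : C(K, V)) (t : K) :
    pointwiseApply K V W A h t = A t (h t) := rfl

/-- Strict differentiability at `u t₀` controls the remainder at all base points `u t` with `t` near
`t₀`; compactness of `K` makes the bound uniform in `t`. Half of `ε` pays for the strict derivative,
half for replacing `f' (u t₀)` by `f' (u t)`. -/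
lemma hasFDerivAt_superposition (f : C(V, W)) (hf : ContDiff ℝ 1 f) (f' : C(V, V →L[ℝ] W))
    (hf' : ∀ x, f' x = fderiv ℝ f x) (u : C(K, V)) :
    HasFDerivAt (superposition K f) (pointwiseApply K V W (superposition K f' u)) u := by
  rw [hasFDerivAt_iff_isLittleO_nhds_zero, Asymptotics.isLittleO_iff]
  intro ε hε
  have key : ∀ᶠ v : V in 𝓝 0, ∀ t ∈ (univ : Set K),
      ‖f (u t + v) - f (u t) - f' (u t) v‖ ≤ ε * ‖v‖ := by
    apply isCompact_univ.eventually_forall_of_forall_eventually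
    intro t₀ _
    have h1 := (hf.contDiffAt (x := u t₀)).hasStrictFDerivAt one_ne_zero
    have h2 := (hasStrictFDerivAt_iff_isLittleO.1 h1).def (half_pos hε)
    have hc1 : Tendsto (fun z : V × K ↦ (u z.2 + z.1, u z.2)) (𝓝 (0, t₀)) (𝓝 (u t₀, u t₀)) := by
      have : Continuous (fun z : V × K ↦ (u z.2 + z.1, u z.2)) := by fun_prop
      simpa using this.tendsto (0, t₀)
    have hc2 : Tendsto (fun z : V × K ↦ f' (u z.2)) (𝓝 (0, t₀)) (𝓝 (f' (u t₀))) := by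
      have : Continuous (fun z : V × K ↦ f' (u z.2)) := by fun_prop
      exact this.tendsto (0, t₀)
    have h3 := hc2.eventually (Metric.ball_mem_nhds _ (half_pos hε))
    filter_upwards [hc1.eventually h2, h3] with z hz1 hz2
    rw [dist_eq_norm] at hz2
    simp only [add_sub_cancel_left, ← hf'] at hz1
    calc ‖f (u z.2 + z.1) - f (u z.2) - f' (u z.2) z.1‖
        = ‖(f (u z.2 + z.1) - f (u z.2) - f' (u t₀) z.1) - (f' (u z.2) - f' (u t₀)) z.1‖ := by
          congr 1; simp only [sub_apply]; abel
      _ ≤ ε / 2 * ‖z.1‖ + ε / 2 * ‖z.1‖ :=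
          (norm_sub_le _ _).trans (add_le_add hz1
            (ContinuousLinearMap.le_of_opNorm_le _ hz2.le _))
      _ = ε * ‖z.1‖ := by ring
  obtain ⟨r, hr, hball⟩ := Metric.eventually_nhds_iff_ball.1 key
  filter_upwards [Metric.ball_mem_nhds (0 : C(K, V)) hr] with h hh
  rw [ContinuousMap.norm_le _ (by positivity)]
  intro t
  have hht : ‖h t‖ ≤ ‖h‖ := h.norm_coe_le_norm t
  exact (hball (h t) (by simpa using hht.trans_lt (by simpa using hh)) t (mem_univ t)).trans
    (mul_le_mul_of_nonneg_left hht hε.le)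

/-- The derivative is again a superposition operator, that of `f'`, followed by a bounded linear
map. The target is quantified inside the induction because `f'` takes values in `V →L[ℝ] W`; the
common universe of `V` and `W` keeps that space in range. -/
lemma contDiff_nat_superposition (n : ℕ) : ∀ (W : Type u) [NormedAddCommGroup W] [NormedSpace ℝ W]
    (f : C(V, W)), ContDiff ℝ n f → ContDiff ℝ n (superposition K f) := by
  induction n with
  | zero =>
    intro W _ _ f _
    exact contDiff_zero.2 (ContinuousMap.continuous_postcomp f)
  | succ n ih =>
    intro W _ _ f hf
    push_cast at hf ⊢
    have hf1 : ContDiff ℝ 1 f := hf.of_le (by simp)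
    let f' : C(V, V →L[ℝ] W) := ⟨fderiv ℝ f, hf1.continuous_fderiv one_ne_zero⟩
    have hf' : ContDiff ℝ n f' := (contDiff_succ_iff_fderiv.1 hf).2.2
    refine contDiff_succ_iff_hasFDerivAt.2 ⟨_, ?_, fun u ↦
      hasFDerivAt_superposition f hf1 f' (fun _ ↦ rfl) u⟩
    exact (pointwiseApply K V W).contDiff.comp (ih _ f' hf')

lemma contDiff_superposition (f : C(V, W)) (hf : ContDiff ℝ ∞ f) :
    ContDiff ℝ ∞ (superposition K f) :=
  contDiff_infty.2 fun n ↦ contDiff_nat_superposition n W f (contDiff_infty.1 hf n)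

/-- The primitive vanishing at `0` of a continuous function on `[-1, 1]`. -/
def primitive (V : Type*) [NormedAddCommGroup V] [NormedSpace ℝ V] :
    C(Icc (-1 : ℝ) 1, V) →L[ℝ] C(Icc (-1 : ℝ) 1, V) :=
  LinearMap.mkContinuous
    { toFun u := ⟨fun t ↦ ∫ τ in (0 : ℝ)..t, IccExtend (by norm_num) u τ, by
        have : Continuous fun t : ℝ ↦ ∫ τ in (0 : ℝ)..t, IccExtend (by norm_num) u τ :=
          intervalIntegral.continuous_primitive
            (fun a b ↦ (u.continuous.Icc_extend' (h := by norm_num)).intervalIntegrable a b) 0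
        exact this.comp continuous_subtype_val⟩
      map_add' u v := by
        ext t
        exact intervalIntegral.integral_add
          ((u.continuous.Icc_extend' (h := by norm_num)).intervalIntegrable _ _)
          ((v.continuous.Icc_extend' (h := by norm_num)).intervalIntegrable _ _)
      map_smul' c u := by
        ext t
        exact intervalIntegral.integral_smul c _ } 1 (by
    intro u
    rw [one_mul, ContinuousMap.norm_le _ (norm_nonneg _)]
    intro t
    refine (intervalIntegral.norm_integral_le_of_norm_le_const (C := ‖u‖)
      fun τ _ ↦ u.norm_coe_le_norm _).trans ?_
    have : |(t : ℝ) - 0| ≤ 1 := by rw [sub_zero]; exact abs_le.2 t.2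
    exact mul_le_of_le_one_right (norm_nonneg _) this)

/-- Constant functions, as a continuous linear map. -/
def ContinuousMap.constCLM (V : Type*) [NormedAddCommGroup V] [NormedSpace ℝ V] :
    V →L[ℝ] C(Icc (-1 : ℝ) 1, V) where
  toFun x := ContinuousMap.const _ x
  map_add' _ _ := rfl
  map_smul' _ _ := rfl
  cont := ContinuousMap.continuous_const'

/-- The integral equation `u = x + s ∫ f(u)`, as the vanishing of `u - x - s ∫ f(u)`. -/
def integralEquation (f : C(V, V)) (z : (V × ℝ) × C(Icc (-1 : ℝ) 1, V)) : C(Icc (-1 : ℝ) 1, V) :=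
  z.2 - ContinuousMap.const _ z.1.1 - z.1.2 • primitive V (superposition _ f z.2)

lemma contDiff_integralEquation (f : C(V, V)) (hf : ContDiff ℝ ∞ f) :
    ContDiff ℝ ∞ (integralEquation f) := by
  have h1 : ContDiff ℝ ∞ (fun z : (V × ℝ) × C(Icc (-1 : ℝ) 1, V) ↦
      primitive V (superposition _ f z.2)) :=
    (primitive V).contDiff.comp ((contDiff_superposition f hf).comp contDiff_snd)
  have h2 : ContDiff ℝ ∞ (fun z : (V × ℝ) × C(Icc (-1 : ℝ) 1, V) ↦
      (ContinuousMap.const (Icc (-1 : ℝ) 1) z.1.1 : C(Icc (-1 : ℝ) 1, V))) :=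
    (ContinuousMap.constCLM V).contDiff.comp (contDiff_fst.comp contDiff_fst)
  exact (contDiff_snd.sub h2).sub ((contDiff_snd.comp contDiff_fst).smul h1)

lemma integralEquation_eq_zero_iff (f : C(V, V)) (x : V) (s : ℝ) (u : C(Icc (-1 : ℝ) 1, V)) :
    integralEquation f ((x, s), u) = 0 ↔ ∀ t ∈ Icc (-1 : ℝ) 1,
      IccExtend (by norm_num) u t =
        x + s • ∫ τ in (0 : ℝ)..t, f (IccExtend (by norm_num) u τ) := by
  have : ∀ t : Icc (-1 : ℝ) 1, integralEquation f ((x, s), u) t =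
      u t - x - s • ∫ τ in (0 : ℝ)..t, f (IccExtend (by norm_num) u τ) := fun t ↦ rfl
  rw [ContinuousMap.ext_iff]
  constructor
  · intro h t ht
    have := (this ⟨t, ht⟩).symm.trans (h ⟨t, ht⟩)
    rw [IccExtend_of_mem _ _ ht]
    rw [ContinuousMap.zero_apply, sub_sub, sub_eq_zero] at this
    exact this
  · intro h t
    rw [this t, ContinuousMap.zero_apply, sub_sub, sub_eq_zero, ← h t t.2, IccExtend_val]

/-- A smooth vector field on a Banach space has a smooth local flow. -/
lemma exists_smooth_localFlow_of_contDiff [CompleteSpace V] (f : C(V, V)) (hf : ContDiff ℝ ∞ f) (x₀ : V) :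
    ∃ Φ : V × ℝ → V, ContDiffAt ℝ ∞ Φ (x₀, 0) ∧ ∃ ε > 0, ∀ x ∈ Metric.ball x₀ ε,
      Φ (x, 0) = x ∧ ∀ t ∈ Ioo (-ε) ε, HasDerivAt (fun τ ↦ Φ (x, τ)) (f (Φ (x, t))) t := by
  -- Time is turned into a parameter: a solution `u` with parameters `(x, s)` is the trajectory from
  -- `x` run at speed `s`, so `u t` is its position at time `s t`. At `s = 0` the solution is
  -- constant and the derivative of the equation in `u` is the identity, so the implicit function
  -- theorem yields a solution depending smoothly on `(x, s)`.
  set c₀ : C(Icc (-1 : ℝ) 1, V) := ContinuousMap.const _ x₀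
  have hF := contDiff_integralEquation f hf
  have hF0 : integralEquation f ((x₀, 0), c₀) = 0 := by
    simp [integralEquation, c₀]
  have hcd : ContDiffAt ℝ ∞ (integralEquation f) ((x₀, 0), c₀) := hF.contDiffAt
  have hd : fderiv ℝ (integralEquation f) ((x₀, 0), c₀) ∘L .inr ℝ (V × ℝ) _ =
      ContinuousLinearMap.id ℝ _ := by
    have h1 : HasFDerivAt (fun u ↦ integralEquation f ((x₀, 0), u))
        (fderiv ℝ (integralEquation f) ((x₀, 0), c₀) ∘L .inr ℝ (V × ℝ) _) c₀ :=
      (hcd.differentiableAt (by simp)).hasFDerivAt.comp c₀ (hasFDerivAt_prodMk_right _ _)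
    have h2 : HasFDerivAt (fun u ↦ integralEquation f ((x₀, 0), u))
        (ContinuousLinearMap.id ℝ _) c₀ := by
      have : (fun u ↦ integralEquation f ((x₀, 0), u)) = fun u ↦ u - c₀ := by
        ext1 u; simp [integralEquation, c₀]
      rw [this]
      exact (hasFDerivAt_id c₀).sub_const c₀
    exact h1.unique h2
  have hinv : (fderiv ℝ (integralEquation f) ((x₀, 0), c₀) ∘L .inr ℝ (V × ℝ) _).IsInvertible := by
    rw [hd]; exact ⟨ContinuousLinearEquiv.refl ℝ _, rfl⟩
  set ψ := hcd.implicitFunction (by simp) hinv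
  have hψ : ContDiffAt ℝ ∞ ψ (x₀, 0) := hcd.contDiffAt_implicitFunction (by simp) hinv
  have hψ0 : ψ (x₀, 0) = c₀ := hcd.implicitFunction_apply_self (by simp) hinv
  have hev := hcd.eventually_apply_eq_iff_implicitFunction (by simp) hinv
  have hev2 := hcd.eventually_apply_implicitFunction (by simp) hinv
  rw [hF0] at hev hev2
  obtain ⟨r, hr, hball⟩ := Metric.eventually_nhds_iff_ball.1 hev
  obtain ⟨δ, hδ, hball2⟩ := Metric.eventually_nhds_iff_ball.1
    (hev2.and (hψ.continuousAt.eventually (Metric.ball_mem_nhds _ hr)))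
  rw [hψ0] at hball2
  have one_mem : (1 : ℝ) ∈ Icc (-1 : ℝ) 1 := by norm_num
  -- The flow at time `s` is the value at rescaled time `1` of the solution with parameter `s`.
  let ev : C(Icc (-1 : ℝ) 1, V) →L[ℝ] V := ContinuousMap.evalCLM ℝ ⟨1, one_mem⟩
  set m := min r δ
  have hm : 0 < m := lt_min hr hδ
  have mem1 : ∀ x ∈ Metric.ball x₀ m, ∀ s, |s| < m → (x, s) ∈ Metric.ball (x₀, (0 : ℝ)) δ := by
    intro x hx s hs
    rw [Metric.mem_ball, Prod.dist_eq, max_lt_iff]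
    exact ⟨lt_of_lt_of_le hx (min_le_right _ _), by
      simpa using lt_of_lt_of_le hs (min_le_right _ _)⟩
  have mem2 : ∀ x ∈ Metric.ball x₀ m, ∀ s, |s| < m → ∀ u ∈ Metric.ball c₀ r,
      ((x, s), u) ∈ Metric.ball ((x₀, (0 : ℝ)), c₀) r := by
    intro x hx s hs u hu
    rw [Metric.mem_ball, Prod.dist_eq, Prod.dist_eq, max_lt_iff, max_lt_iff]
    exact ⟨⟨lt_of_lt_of_le hx (min_le_left _ _), by
      simpa using lt_of_lt_of_le hs (min_le_left _ _)⟩, hu⟩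
  set s₀ : ℝ := m / 2
  have hs₀ : 0 < s₀ := half_pos hm
  have hs₀m : |s₀| < m := by rw [abs_of_pos hs₀]; exact half_lt_self hm
  -- The solutions for different parameters belong to one trajectory: `ψ (x, t)` is `ψ (x, s₀)`
  -- slowed down by the factor `t / s₀`. Thus `t ↦ ψ (x, t) 1` satisfies an integral equation in `t`
  -- and can be differentiated.
  have key : ∀ x ∈ Metric.ball x₀ m, ∀ t ∈ Icc (-s₀) s₀,
      ev (ψ (x, t)) = x + s₀ • ∫ τ in (0 : ℝ)..(t / s₀),
        f (IccExtend (by norm_num) (ψ (x, s₀)) τ) ∧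
      ev (ψ (x, t)) = IccExtend (by norm_num) (ψ (x, s₀)) (t / s₀) := by
    intro x hx t ht
    have htm : |t| < m := (abs_le.2 ht).trans_lt (half_lt_self hm)
    set u := ψ (x, s₀)
    have hu := hball2 _ (mem1 x hx s₀ hs₀m)
    have hu1 := (integralEquation_eq_zero_iff f x s₀ u).1 hu.1
    have hts : |t / s₀| ≤ 1 := by
      rw [abs_div, abs_of_pos hs₀, div_le_one hs₀]; exact abs_le.2 ht
    have hmem : ∀ σ ∈ Icc (-1 : ℝ) 1, t / s₀ * σ ∈ Icc (-1 : ℝ) 1 := by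
      intro σ hσ
      rw [mem_Icc, ← abs_le] at hσ ⊢
      rw [abs_mul]
      exact mul_le_one₀ hts (abs_nonneg _) hσ
    let v : C(Icc (-1 : ℝ) 1, V) := ⟨fun σ ↦ u ⟨t / s₀ * σ, hmem σ σ.2⟩, by fun_prop⟩
    have hvu : ∀ σ ∈ Icc (-1 : ℝ) 1, IccExtend (by norm_num) v σ =
        IccExtend (by norm_num) u (t / s₀ * σ) := by
      intro σ hσ
      rw [IccExtend_of_mem _ _ hσ, IccExtend_of_mem _ _ (hmem σ hσ)]
      rfl
    have hv : integralEquation f ((x, t), v) = 0 := by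
      rw [integralEquation_eq_zero_iff]
      intro σ hσ
      rw [hvu σ hσ, hu1 _ (hmem σ hσ)]
      congr 1
      have h1 : ∫ τ in (0 : ℝ)..σ, f (IccExtend (by norm_num) v τ) =
          ∫ τ in (0 : ℝ)..σ, f (IccExtend (by norm_num) u (t / s₀ * τ)) := by
        apply intervalIntegral.integral_congr
        intro τ hτ
        have : τ ∈ Icc (-1 : ℝ) 1 := by
          have := (convex_Icc (-1 : ℝ) 1).ordConnected.uIcc_subset (x := 0) (by norm_num) hσ
          exact this hτ
        simp only [hvu τ this]
      have h2 := intervalIntegral.smul_integral_comp_mul_left (a := 0) (b := σ)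
        (fun τ ↦ f (IccExtend (by norm_num) u τ)) (t / s₀)
      rw [mul_zero] at h2
      rw [h1, ← h2, smul_smul, mul_div_cancel₀ _ hs₀.ne']
    -- Local uniqueness applies only near `c₀`; all values of `v` are values of `u`, so `v` is no
    -- farther from `c₀` than `u`.
    have hvball : v ∈ Metric.ball c₀ r := by
      rw [Metric.mem_ball]
      refine lt_of_le_of_lt ?_ hu.2
      rw [ContinuousMap.dist_le dist_nonneg]
      intro σ
      exact ContinuousMap.dist_apply_le_dist (f := u) (g := c₀) ⟨t / s₀ * σ, hmem σ σ.2⟩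
    have hψv : ψ (x, t) = v := (hball _ (mem2 x hx t htm v hvball)).1 hv
    have hev : ev (ψ (x, t)) = IccExtend (by norm_num) u (t / s₀) := by
      rw [hψv, IccExtend_of_mem _ _ (by simpa using hmem 1 one_mem)]
      change u _ = u _
      congr 2
      simp
    refine ⟨?_, hev⟩
    rw [hev, hu1 _ (by simpa using hmem 1 one_mem)]
  refine ⟨fun z ↦ ev (ψ z), ev.contDiff.contDiffAt.comp _ hψ, s₀, hs₀, fun x hx ↦ ?_⟩
  have hxm : x ∈ Metric.ball x₀ m := Metric.ball_subset_ball (half_lt_self hm).le hx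
  refine ⟨?_, fun t ht ↦ ?_⟩
  · refine (key x hxm 0 ⟨by linarith, hs₀.le⟩).1.trans ?_
    simp
  · have hc : Continuous fun τ ↦ f (IccExtend (by norm_num) (ψ (x, s₀)) τ) :=
      f.continuous.comp (ψ (x, s₀)).continuous.Icc_extend'
    have h1 := (hc.integral_hasStrictDerivAt 0 (t / s₀)).hasDerivAt
    have h2 : HasDerivAt (fun τ : ℝ ↦ τ / s₀) (1 / s₀) t := (hasDerivAt_id t).div_const s₀
    have h3 := ((h1.scomp t h2).const_smul s₀).const_add x
    rw [smul_smul, mul_one_div_cancel hs₀.ne', one_smul,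
      ← (key x hxm t (Ioo_subset_Icc_self ht)).2] at h3
    refine h3.congr_of_eventuallyEq ?_
    filter_upwards [Ioo_mem_nhds ht.1 ht.2] with τ hτ
    exact (key x hxm τ (Ioo_subset_Icc_self hτ)).1

/-- A vector field that is smooth on an open set of a finite-dimensional space has smooth local
flows. -/
theorem exists_smooth_localFlow [FiniteDimensional ℝ V] {f : V → V} {O : Set V} (hO : IsOpen O)
    (hf : ContDiffOn ℝ ∞ f O) {x₀ : V} (hx₀ : x₀ ∈ O) :
    ∃ Φ : V × ℝ → V, ContDiffAt ℝ ∞ Φ (x₀, 0) ∧ ∃ ε > 0, ∀ x ∈ Metric.ball x₀ ε,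
      Φ (x, 0) = x ∧ ∀ t ∈ Ioo (-ε) ε, Φ (x, t) ∈ O ∧
        HasDerivAt (fun τ ↦ Φ (x, τ)) (f (Φ (x, t))) t := by
  obtain ⟨R, hR, hRO⟩ := Metric.isOpen_iff.1 hO x₀ hx₀
  -- The cutoff makes the field smooth on the whole space. It is `1` on the ball of radius `R / 3`,
  -- where the trajectories remain for short times and hence solve the original equation.
  let b : ContDiffBump x₀ := ⟨R / 3, R / 2, by positivity, by linarith⟩
  have hg : ContDiff ℝ ∞ (fun x ↦ b x • f x) := by
    rw [contDiff_iff_contDiffAt]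
    intro x
    by_cases hx : x ∈ Metric.ball x₀ R
    · exact b.contDiffAt.smul (hf.contDiffAt (hO.mem_nhds (hRO hx)))
    · have hx' : x ∉ tsupport b := by
        rw [b.tsupport_eq]
        intro h
        exact hx (lt_of_le_of_lt h (by change R / 2 < R; linarith))
      have : (fun x ↦ b x • f x) =ᶠ[𝓝 x] fun _ ↦ 0 := by
        filter_upwards [notMem_tsupport_iff_eventuallyEq.1 hx'] with y hy
        rw [hy]; simp
      exact contDiffAt_const.congr_of_eventuallyEq this
  obtain ⟨Φ, hΦ, ε, hε, h⟩ := exists_smooth_localFlow_of_contDiff ⟨_, hg.continuous⟩ hg x₀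
  have hΦ0 : Φ (x₀, 0) = x₀ := (h x₀ (Metric.mem_ball_self hε)).1
  have hnear : ∀ᶠ z in 𝓝 (x₀, (0 : ℝ)), Φ z ∈ Metric.ball x₀ (R / 3) := by
    apply hΦ.continuousAt.eventually
    rw [hΦ0]
    exact Metric.ball_mem_nhds _ (by positivity)
  obtain ⟨δ, hδ, hball⟩ := Metric.eventually_nhds_iff_ball.1 hnear
  refine ⟨Φ, hΦ, min ε δ, lt_min hε hδ, fun x hx ↦ ?_⟩
  obtain ⟨h0, h1⟩ := h x (Metric.ball_subset_ball (min_le_left _ _) hx)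
  refine ⟨h0, fun t ht ↦ ?_⟩
  have hmem : Φ (x, t) ∈ Metric.ball x₀ (R / 3) := by
    apply hball
    rw [Metric.mem_ball, Prod.dist_eq, max_lt_iff]
    refine ⟨lt_of_lt_of_le hx (min_le_right _ _), ?_⟩
    rw [dist_zero_right, Real.norm_eq_abs]
    exact lt_of_lt_of_le (abs_lt.2 ht) (min_le_right _ _)
  refine ⟨hRO (Metric.ball_subset_ball (by linarith) hmem), ?_⟩
  have := h1 t ⟨lt_of_le_of_lt (neg_le_neg (min_le_left _ _)) ht.1,
    lt_of_lt_of_le ht.2 (min_le_left _ _)⟩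
  have hb : b (Φ (x, t)) = 1 := b.one_of_mem_closedBall (Metric.ball_subset_closedBall hmem)
  simpa [hb] using this

end SmoothFlow

/-! ### Derivatives of maps between manifolds, read in the model vector spaces -/

section Derivatives

variable {V H X : Type*} [NormedAddCommGroup V] [NormedSpace ℝ V] [TopologicalSpace H]
  [TopologicalSpace X] [ChartedSpace H X] {I : ModelWithCorners ℝ V H}
  {V' H' Y : Type*} [NormedAddCommGroup V'] [NormedSpace ℝ V'] [TopologicalSpace H']
  [TopologicalSpace Y] [ChartedSpace H' Y] {J : ModelWithCorners ℝ V' H'}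
  {V'' H'' Z : Type*} [NormedAddCommGroup V''] [NormedSpace ℝ V''] [TopologicalSpace H'']
  [TopologicalSpace Z] [ChartedSpace H'' Z] {K : ModelWithCorners ℝ V'' H''}

/-- `HasMFDerivAt`, for a derivative that is a linear map between the model vector spaces. -/
def HasMD (I : ModelWithCorners ℝ V H) (J : ModelWithCorners ℝ V' H') (f : X → Y) (x : X)
    (f' : V →L[ℝ] V') : Prop :=
  HasMFDerivAt I J f x f'

/-- `mfderiv`, as a linear map between the model vector spaces. -/
def md (I : ModelWithCorners ℝ V H) (J : ModelWithCorners ℝ V' H') (f : X → Y) (x : X) :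
    V →L[ℝ] V' :=
  mfderiv I J f x

lemma MDifferentiableAt.hasMD {f : X → Y} {x : X} (h : MDifferentiableAt I J f x) :
    HasMD I J f x (md I J f x) :=
  h.hasMFDerivAt

lemma ContMDiffAt.hasMD {n : WithTop ℕ∞} {f : X → Y} {x : X} (h : ContMDiffAt I J n f x)
    (hn : n ≠ 0) : HasMD I J f x (md I J f x) :=
  (h.mdifferentiableAt hn).hasMFDerivAt

namespace HasMD

lemma md_eq {f : X → Y} {x : X} {f' : V →L[ℝ] V'} (h : HasMD I J f x f') : md I J f x = f' :=
  HasMFDerivAt.mfderiv h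

lemma mdifferentiableAt {f : X → Y} {x : X} {f' : V →L[ℝ] V'} (h : HasMD I J f x f') :
    MDifferentiableAt I J f x :=
  HasMFDerivAt.mdifferentiableAt h

lemma continuousAt {f : X → Y} {x : X} {f' : V →L[ℝ] V'} (h : HasMD I J f x f') :
    ContinuousAt f x :=
  HasMFDerivAt.continuousAt h

lemma unique {f : X → Y} {x : X} {f₁ f₂ : V →L[ℝ] V'} (h₁ : HasMD I J f x f₁)
    (h₂ : HasMD I J f x f₂) : f₁ = f₂ :=
  hasMFDerivAt_unique h₁ h₂

lemma comp {f : X → Y} {g : Y → Z} {x : X} {f' : V →L[ℝ] V'} {g' : V' →L[ℝ] V''}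
    (hg : HasMD J K g (f x) g') (hf : HasMD I J f x f') : HasMD I K (g ∘ f) x (g'.comp f') :=
  HasMFDerivAt.comp x hg hf

lemma comp_of_eq {f : X → Y} {g : Y → Z} {x : X} {y : Y} {f' : V →L[ℝ] V'} {g' : V' →L[ℝ] V''}
    (hg : HasMD J K g y g') (hf : HasMD I J f x f') (h : f x = y) :
    HasMD I K (g ∘ f) x (g'.comp f') := by
  subst h; exact hg.comp hf

lemma congr {f g : X → Y} {x : X} {f' : V →L[ℝ] V'} (h : HasMD I J f x f')
    (hfg : g =ᶠ[𝓝 x] f) : HasMD I J g x f' :=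
  HasMFDerivAt.congr_of_eventuallyEq h hfg

lemma congr_deriv {f : X → Y} {x : X} {f' f'' : V →L[ℝ] V'} (h : HasMD I J f x f')
    (hf : f' = f'') : HasMD I J f x f'' :=
  hf ▸ h

lemma prodMk {f : X → Y} {g : X → Z} {x : X} {f' : V →L[ℝ] V'} {g' : V →L[ℝ] V''}
    (hf : HasMD I J f x f') (hg : HasMD I K g x g') :
    HasMD I (J.prod K) (fun z ↦ (f z, g z)) x (f'.prod g') :=
  HasMFDerivAt.prodMk hf hg

end HasMD

lemma hasMD_id (x : X) : HasMD I I id x (ContinuousLinearMap.id ℝ V) := hasMFDerivAt_id x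

lemma hasMD_const (c : Y) (x : X) : HasMD I J (fun _ ↦ c) x 0 := hasMFDerivAt_const c x

lemma hasMD_iff_hasFDerivAt {f : V → V'} {x : V} {f' : V →L[ℝ] V'} :
    HasMD 𝓘(ℝ, V) 𝓘(ℝ, V') f x f' ↔ HasFDerivAt f f' x :=
  hasMFDerivAt_iff_hasFDerivAt

lemma ContMDiffAt.eventually_contMDiffAt {n : WithTop ℕ∞} [IsManifold I n X] [IsManifold J n Y]
    {f : X → Y} {x : X} (h : ContMDiffAt I J n f x) (hn : n ≠ ∞) :
    ∀ᶠ z in 𝓝 x, ContMDiffAt I J n f z :=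
  (contMDiffAt_iff_contMDiffAt_nhds hn).1 h

lemma ContMDiffAt.eventually_mdifferentiableAt [IsManifold I ∞ X] [IsManifold J ∞ Y]
    {n : WithTop ℕ∞} {f : X → Y} {x : X} (h : ContMDiffAt I J n f x) (hn : 1 ≤ n) :
    ∀ᶠ z in 𝓝 x, MDifferentiableAt I J f z := by
  have : IsManifold I 1 X := IsManifold.of_le (n := ∞) (by simp)
  have : IsManifold J 1 Y := IsManifold.of_le (n := ∞) (by simp)
  exact ((h.of_le hn).eventually_contMDiffAt (by simp)).mono
    fun z hz ↦ hz.mdifferentiableAt (by simp)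

end Derivatives

/-! ### Exterior derivative of one-forms and pullbacks -/

section OneForms

variable {V H X : Type*} [NormedAddCommGroup V] [NormedSpace ℝ V] [TopologicalSpace H]
  [TopologicalSpace X] [ChartedSpace H X] {I : ModelWithCorners ℝ V H}
  {V' H' Y : Type*} [NormedAddCommGroup V'] [NormedSpace ℝ V'] [TopologicalSpace H']
  [TopologicalSpace Y] [ChartedSpace H' Y] {J : ModelWithCorners ℝ V' H'}

/-- `oneFormInChart`, for a one-form with values in the dual of the model vector space. -/
def formInChart (I : ModelWithCorners ℝ V H) (θ : X → V →L[ℝ] ℝ) (x₀ : X) (y : V) : V →L[ℝ] ℝ :=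
  (θ ((extChartAt I x₀).symm y)).comp (md 𝓘(ℝ, V) I (extChartAt I x₀).symm y)

/-- `extDerivOneForm`, for a one-form with values in the dual of the model vector space. -/
def extD (I : ModelWithCorners ℝ V H) (θ : X → V →L[ℝ] ℝ) (x : X) (u v : V) : ℝ :=
  fderiv ℝ (formInChart I θ x) (extChartAt I x x) u v -
    fderiv ℝ (formInChart I θ x) (extChartAt I x x) v u

lemma hasMD_extChartAt_symm [I.Boundaryless] [IsManifold I ∞ X] (x₀ : X) {y : V}
    (hy : y ∈ (extChartAt I x₀).target) :
    HasMD 𝓘(ℝ, V) I (extChartAt I x₀).symm y (md 𝓘(ℝ, V) I (extChartAt I x₀).symm y) := by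
  have : IsManifold I 1 X := IsManifold.of_le (n := ∞) (by simp)
  have h := (contMDiffOn_extChartAt_symm (I := I) (n := 1) x₀).contMDiffAt
    ((isOpen_extChartAt_target x₀).mem_nhds hy)
  exact h.hasMD (by simp)

lemma ContMDiffAt.contDiffAt_writtenInExtChartAt [I.Boundaryless] {n : WithTop ℕ∞} {f : X → Y}
    {x : X} (hf : ContMDiffAt I J n f x) :
    ContDiffAt ℝ n (writtenInExtChartAt I J x f) (extChartAt I x x) := by
  have := (contMDiffAt_iff.1 hf).2
  rwa [I.range_eq_univ, contDiffWithinAt_univ] at this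

lemma md_eq_fderiv_writtenInExtChartAt [I.Boundaryless] {f : X → Y} {x : X}
    (hf : MDifferentiableAt I J f x) :
    md I J f x = fderiv ℝ (writtenInExtChartAt I J x f) (extChartAt I x x) := by
  have := hf.mfderiv
  rw [I.range_eq_univ, fderivWithin_univ] at this
  exact this

lemma eventually_extChartAt_symm {x : X} {P : X → Prop} (h : ∀ᶠ z in 𝓝 x, P z) :
    ∀ᶠ y in 𝓝 (extChartAt I x x), P ((extChartAt I x).symm y) := by
  have := continuousAt_extChartAt_symm (I := I) x
  rw [ContinuousAt, extChartAt_to_inv] at this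
  exact this.eventually h

variable [I.Boundaryless] [IsManifold I ∞ X] [J.Boundaryless] [IsManifold J ∞ Y]

lemma formInChart_pullback {f : X → Y} {x : X} (hf : ContMDiffAt I J 1 f x)
    {θ : Y → V' →L[ℝ] ℝ} {η : X → V →L[ℝ] ℝ} (hη : ∀ᶠ z in 𝓝 x, η z = (θ (f z)).comp (md I J f z)) :
    ∀ᶠ y in 𝓝 (extChartAt I x x), formInChart I η x y =
      (formInChart J θ (f x) (writtenInExtChartAt I J x f y)).comp
        (fderiv ℝ (writtenInExtChartAt I J x f) y) := by
  have hsrc : ∀ᶠ z in 𝓝 x, f z ∈ (extChartAt J (f x)).source :=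
    hf.continuousAt.eventually (extChartAt_source_mem_nhds (f x))
  have hF : ∀ᶠ y in 𝓝 (extChartAt I x x),
      DifferentiableAt ℝ (writtenInExtChartAt I J x f) y :=
    (hf.contDiffAt_writtenInExtChartAt.eventually (by simp)).mono
      fun y hy ↦ hy.differentiableAt (by simp)
  filter_upwards [(isOpen_extChartAt_target (I := I) x).mem_nhds (mem_extChartAt_target x),
    eventually_extChartAt_symm (I := I) hη,
    eventually_extChartAt_symm (I := I) (hf.eventually_mdifferentiableAt le_rfl), hF,
    eventually_extChartAt_symm (I := I) hsrc,
    (eventually_extChartAt_symm (I := I) hsrc).eventually_nhds] with y hyt hyη hyd hyF hys hyse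
  have htarget : writtenInExtChartAt I J x f y ∈ (extChartAt J (f x)).target :=
    (extChartAt J (f x)).map_source hys
  have hpt : (extChartAt J (f x)).symm (writtenInExtChartAt I J x f y) =
      f ((extChartAt I x).symm y) := (extChartAt J (f x)).left_inv hys
  have h1 := hyd.hasMD.comp (hasMD_extChartAt_symm x hyt)
  have h2 := (hasMD_extChartAt_symm (f x) htarget).comp
    (hasMD_iff_hasFDerivAt.2 hyF.hasFDerivAt)
  have heq : (extChartAt J (f x)).symm ∘ writtenInExtChartAt I J x f =ᶠ[𝓝 y]
      f ∘ (extChartAt I x).symm := by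
    filter_upwards [hyse] with y' hy'
    exact (extChartAt J (f x)).left_inv hy'
  have h3 := h1.unique (h2.congr heq.symm)
  rw [formInChart, hyη, formInChart, hpt, ContinuousLinearMap.comp_assoc, h3,
    ContinuousLinearMap.comp_assoc]

/-- In charts the pullback is `y ↦ θ(F y) ∘ DF(y)`. Its derivative contains `θ(D²F(u, v))`, which is
symmetric in `u`, `v` and disappears in the antisymmetrization. -/
lemma extD_pullback {f : X → Y} {x : X} (hf : ContMDiffAt I J 2 f x)
    {θ : Y → V' →L[ℝ] ℝ} {η : X → V →L[ℝ] ℝ}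
    (hθ : DifferentiableAt ℝ (formInChart J θ (f x)) (extChartAt J (f x) (f x)))
    (hη : ∀ᶠ z in 𝓝 x, η z = (θ (f z)).comp (md I J f z)) (u v : V) :
    extD I η x u v = extD J θ (f x) (md I J f x u) (md I J f x v) := by
  have hev := formInChart_pullback (hf.of_le one_le_two) hη
  rw [md_eq_fderiv_writtenInExtChartAt (hf.mdifferentiableAt (by simp))]
  set F := writtenInExtChartAt I J x f
  set y₀ := extChartAt I x x
  have hF2 : ContDiffAt ℝ 2 F y₀ := hf.contDiffAt_writtenInExtChartAt
  have hFy : F y₀ = extChartAt J (f x) (f x) := by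
    simp [F, y₀, writtenInExtChartAt]
  rw [← hFy] at hθ
  have hDF : DifferentiableAt ℝ (fderiv ℝ F) y₀ :=
    (hF2.fderiv_right (m := 1) (by norm_num)).differentiableAt (by simp)
  have hA : HasFDerivAt (fun y ↦ formInChart J θ (f x) (F y))
      ((fderiv ℝ (formInChart J θ (f x)) (F y₀)).comp (fderiv ℝ F y₀)) y₀ :=
    hθ.hasFDerivAt.comp y₀ (hF2.differentiableAt (by simp)).hasFDerivAt
  have hder := (hA.clm_comp hDF.hasFDerivAt).congr_of_eventuallyEq hev
  have hsymm : fderiv ℝ (fderiv ℝ F) y₀ u v = fderiv ℝ (fderiv ℝ F) y₀ v u :=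
    hF2.isSymmSndFDerivAt (by simp) u v
  unfold extD
  rw [hder.fderiv, ← hFy]
  simp only [add_apply, ContinuousLinearMap.comp_apply,
    ContinuousLinearMap.compL_apply, ContinuousLinearMap.flip_apply, hsymm]
  ring

omit [I.Boundaryless] [IsManifold I ∞ X] in
lemma extD_congr {η η' : X → V →L[ℝ] ℝ} {x : X} (h : ∀ᶠ z in 𝓝 x, η z = η' z) :
    extD I η x = extD I η' x := by
  have : fderiv ℝ (formInChart I η x) (extChartAt I x x) =
      fderiv ℝ (formInChart I η' x) (extChartAt I x x) := by
    apply Filter.EventuallyEq.fderiv_eq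
    filter_upwards [eventually_extChartAt_symm (I := I) h] with y hy
    rw [formInChart, hy, formInChart]
  unfold extD
  rw [this]

omit [I.Boundaryless] [IsManifold I ∞ X] in
lemma extD_add {η η' : X → V →L[ℝ] ℝ} {x : X}
    (h : DifferentiableAt ℝ (formInChart I η x) (extChartAt I x x))
    (h' : DifferentiableAt ℝ (formInChart I η' x) (extChartAt I x x)) (u v : V) :
    extD I (fun z ↦ η z + η' z) x u v = extD I η x u v + extD I η' x u v := by
  have : formInChart I (fun z ↦ η z + η' z) x =
      fun y ↦ formInChart I η x y + formInChart I η' x y := by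
    ext y w; simp [formInChart]
  unfold extD
  rw [this, fderiv_fun_add h h']
  simp only [add_apply]
  ring

omit [I.Boundaryless] [IsManifold I ∞ X] in
lemma extD_smul (a : ℝ) {η : X → V →L[ℝ] ℝ} {x : X}
    (h : DifferentiableAt ℝ (formInChart I η x) (extChartAt I x x)) (u v : V) :
    extD I (fun z ↦ a • η z) x u v = a * extD I η x u v := by
  have : formInChart I (fun z ↦ a • η z) x = fun y ↦ a • formInChart I η x y := by
    ext y w; simp [formInChart]
  unfold extD
  rw [this, fderiv_fun_const_smul h]
  simp only [smul_apply, smul_eq_mul]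
  ring

omit [NormedSpace ℝ V'] in
lemma formInChart_self (θ : V → V →L[ℝ] ℝ) (x₀ : V) : formInChart 𝓘(ℝ, V) θ x₀ = θ := by
  ext1 y
  have h : md 𝓘(ℝ, V) 𝓘(ℝ, V) (extChartAt 𝓘(ℝ, V) x₀).symm y = ContinuousLinearMap.id ℝ V := by
    rw [extChartAt_model_space_eq_id]
    exact (hasMD_id y).md_eq
  rw [formInChart, h, extChartAt_model_space_eq_id]
  rfl

lemma extD_self (θ : V → V →L[ℝ] ℝ) (x u v : V) :
    extD 𝓘(ℝ, V) θ x u v = fderiv ℝ θ x u v - fderiv ℝ θ x v u := by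
  rw [extD, formInChart_self, extChartAt_model_space_eq_id]
  rfl

/-- `d(dφ) = 0`. -/
lemma extD_md {φ : X → ℝ} {x : X} (hφ : ContMDiffAt I 𝓘(ℝ, ℝ) 2 φ x) (u v : V) :
    extD I (md I 𝓘(ℝ, ℝ) φ) x u v = 0 := by
  -- `dφ` is the pullback by `φ` of the constant one-form on `ℝ`.
  rw [extD_pullback (θ := fun y : ℝ ↦ ContinuousLinearMap.id ℝ ℝ) hφ (by
    rw [formInChart_self]; exact differentiableAt_const _) (Eventually.of_forall fun z ↦ by
      ext w; rfl), extD_self]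
  simp

lemma differentiableAt_formInChart_md {φ : X → ℝ} {x : X} (hφ : ContMDiffAt I 𝓘(ℝ, ℝ) 2 φ x) :
    DifferentiableAt ℝ (formInChart I (md I 𝓘(ℝ, ℝ) φ) x) (extChartAt I x x) := by
  have hev := formInChart_pullback (θ := fun y : ℝ ↦ ContinuousLinearMap.id ℝ ℝ)
    (η := md I 𝓘(ℝ, ℝ) φ) (hφ.of_le one_le_two) (Eventually.of_forall fun z ↦ by ext w; rfl)
  have h2 := hφ.contDiffAt_writtenInExtChartAt
  have hd : DifferentiableAt ℝ (fderiv ℝ (writtenInExtChartAt I 𝓘(ℝ, ℝ) x φ))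
      (extChartAt I x x) := (h2.fderiv_right (m := 1) (by norm_num)).differentiableAt (by simp)
  refine hd.congr_of_eventuallyEq ?_
  filter_upwards [hev] with y hy
  rw [hy, formInChart_self]
  rfl

end OneForms

/-! ### Coordinates on the cotangent bundle -/

section CotangentCoordinates

variable {E G : Type*} [NormedAddCommGroup E] [NormedSpace ℝ E]
  [TopologicalSpace G] [ChartedSpace E G]

/-- The covector component of a point of the cotangent bundle, as a linear form on the model
vector space. -/
def CotangentBundle.form (δ : CotangentBundle E G) : E →L[ℝ] ℝ := δ.2

/-- The point of the cotangent bundle with given base point and covector. -/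
def cotMk (γ : G) (ξ : E →L[ℝ] ℝ) : CotangentBundle E G := ⟨γ, ξ⟩

@[simp] lemma cotMk_proj (γ : G) (ξ : E →L[ℝ] ℝ) : (cotMk γ ξ).1 = γ := rfl

@[simp] lemma cotMk_form (γ : G) (ξ : E →L[ℝ] ℝ) : (cotMk γ ξ).form = ξ := rfl

lemma cotMk_self (δ : CotangentBundle E G) : cotMk δ.1 δ.form = δ := rfl

lemma CotangentBundle.ext_form {δ δ' : CotangentBundle E G} (h : δ.1 = δ'.1)
    (h' : δ.form = δ'.form) : δ = δ' := by
  rw [← cotMk_self δ, ← cotMk_self δ', h, h']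

/-- The covector component in the chart of `G` at `γ₀`. -/
def cotCoord (γ₀ : G) (δ : CotangentBundle E G) : E →L[ℝ] ℝ :=
  δ.form.comp (md 𝓘(ℝ, E) 𝓘(ℝ, E) (extChartAt 𝓘(ℝ, E) γ₀).symm (extChartAt 𝓘(ℝ, E) γ₀ δ.1))

variable [IsManifold 𝓘(ℝ, E) ∞ G]

/-- Identifies the trivialization of the bundle of homomorphisms with the pullback of covectors by
the inverse chart of `G`; the explicit coordinates of `T*G` below rest on this. -/
lemma trivializationAt_cotangent (γ₀ : G) {δ : CotangentBundle E G}
    (hδ : δ.1 ∈ (chartAt E γ₀).source) :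
    (trivializationAt (E →L[ℝ] ℝ) (fun γ : G ↦ TangentSpace 𝓘(ℝ, E) γ →L[ℝ] ℝ) γ₀ δ).2 =
      cotCoord γ₀ δ := by
  have h := TangentBundle.symmL_trivializationAt (I := 𝓘(ℝ, E)) hδ
  rw [hom_trivializationAt_apply]
  ext v
  have h2 : Trivialization.continuousLinearMapAt ℝ (trivializationAt ℝ (Trivial G ℝ) γ₀) δ.1 =
      ContinuousLinearMap.id ℝ ℝ := Trivial.continuousLinearMapAt_trivialization ℝ G ℝ δ.1
  have h3 : md 𝓘(ℝ, E) 𝓘(ℝ, E) (extChartAt 𝓘(ℝ, E) γ₀).symm (extChartAt 𝓘(ℝ, E) γ₀ δ.1) =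
      (trivializationAt E (TangentSpace 𝓘(ℝ, E)) γ₀).symmL ℝ δ.1 := by
    rw [h, md]
    simp only [modelWithCornersSelf_coe, range_id, mfderivWithin_univ]
    rfl
  have h4 := congrArg (fun A : ℝ →L[ℝ] ℝ ↦ A (δ.form
    (((trivializationAt E (TangentSpace 𝓘(ℝ, E)) γ₀).symmL ℝ δ.1 : E →L[ℝ] E) v))) h2
  refine h4.trans ?_
  rw [cotCoord, h3]
  rfl

lemma contMDiffAt_cotangent_iff {EN HN N : Type*} [NormedAddCommGroup EN] [NormedSpace ℝ EN]
    [TopologicalSpace HN] {IN : ModelWithCorners ℝ EN HN} [TopologicalSpace N] [ChartedSpace HN N]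
    {n : WithTop ℕ∞} {f : N → CotangentBundle E G} {x₀ : N} :
    ContMDiffAt IN (cotangentModel E) n f x₀ ↔ ContMDiffAt IN 𝓘(ℝ, E) n (fun x ↦ (f x).1) x₀ ∧
      ContMDiffAt IN 𝓘(ℝ, E →L[ℝ] ℝ) n (fun x ↦ cotCoord (f x₀).1 (f x)) x₀ := by
  rw [contMDiffAt_totalSpace]
  refine and_congr_right fun h ↦ ?_
  have : ∀ᶠ x in 𝓝 x₀, (f x).1 ∈ (chartAt E (f x₀).1).source :=
    h.continuousAt.eventually (chart_source_mem_nhds E (f x₀).1)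
  apply Filter.EventuallyEq.contMDiffAt_iff
  filter_upwards [this] with x hx
  exact trivializationAt_cotangent _ hx

lemma extChartAt_cotangent (δ₀ : CotangentBundle E G) {δ : CotangentBundle E G}
    (hδ : δ.1 ∈ (chartAt E δ₀.1).source) :
    extChartAt (cotangentModel E) δ₀ δ =
      (extChartAt 𝓘(ℝ, E) δ₀.1 δ.1, cotCoord δ₀.1 δ) := by
  rw [FiberBundle.extChartAt, ← trivializationAt_cotangent δ₀.1 hδ]
  rfl

lemma mem_extChartAt_cotangent_source (δ₀ δ : CotangentBundle E G) :
    δ ∈ (extChartAt (cotangentModel E) δ₀).source ↔ δ.1 ∈ (chartAt E δ₀.1).source := by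
  rw [extChartAt_source, FiberBundle.chartedSpace_chartAt]
  simp only [mfld_simps]
  constructor
  · exact fun h ↦ h.1.1
  · exact fun h ↦ ⟨⟨h, mem_univ _⟩, h⟩

lemma mem_extChartAt_cotangent_target (δ₀ : CotangentBundle E G) (y : E × (E →L[ℝ] ℝ)) :
    y ∈ (extChartAt (cotangentModel E) δ₀).target ↔
      y.1 ∈ (extChartAt 𝓘(ℝ, E) δ₀.1).target := by
  rw [FiberBundle.extChartAt_target, hom_trivializationAt_baseSet]
  simp only [mem_prod, mem_univ, and_true, mem_inter_iff, mem_preimage,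
    TangentBundle.trivializationAt_baseSet]
  constructor
  · exact fun h ↦ h.1
  · intro h
    refine ⟨h, ?_⟩
    have := (extChartAt 𝓘(ℝ, E) δ₀.1).map_target h
    rw [extChartAt_source] at this
    simpa using this

lemma extChartAt_cotangent_symm (δ₀ : CotangentBundle E G) {y : E × (E →L[ℝ] ℝ)}
    (hy : y ∈ (extChartAt (cotangentModel E) δ₀).target) :
    ((extChartAt (cotangentModel E) δ₀).symm y).1 = (extChartAt 𝓘(ℝ, E) δ₀.1).symm y.1 ∧
    ((extChartAt (cotangentModel E) δ₀).symm y).form.comp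
      (md 𝓘(ℝ, E) 𝓘(ℝ, E) (extChartAt 𝓘(ℝ, E) δ₀.1).symm y.1) = y.2 := by
  have hs := (mem_extChartAt_cotangent_source δ₀ _).1
    ((extChartAt (cotangentModel E) δ₀).map_target hy)
  have h := (extChartAt (cotangentModel E) δ₀).right_inv hy
  rw [extChartAt_cotangent δ₀ hs] at h
  have h1 : extChartAt 𝓘(ℝ, E) δ₀.1 ((extChartAt (cotangentModel E) δ₀).symm y).1 = y.1 :=
    congrArg Prod.fst h
  have h2 : cotCoord δ₀.1 ((extChartAt (cotangentModel E) δ₀).symm y) = y.2 :=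
    congrArg Prod.snd h
  refine ⟨?_, ?_⟩
  · rw [← h1, (extChartAt 𝓘(ℝ, E) δ₀.1).left_inv (by rwa [extChartAt_source])]
  · rw [cotCoord, h1] at h2
    exact h2

lemma contMDiff_cotangent_proj {n : WithTop ℕ∞} :
    ContMDiff (cotangentModel E) 𝓘(ℝ, E) n (fun δ : CotangentBundle E G ↦ δ.1) :=
  contMDiff_proj _

/-- The tangent space at `γ` is identified with the model space through the preferred chart at `γ`,
so that chart has the identity as its derivative at its center. -/
lemma md_extChartAt_symm_self (γ : G) :
    md 𝓘(ℝ, E) 𝓘(ℝ, E) (extChartAt 𝓘(ℝ, E) γ).symm (extChartAt 𝓘(ℝ, E) γ γ) =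
      ContinuousLinearMap.id ℝ E := by
  have h := mfderivWithin_range_extChartAt_symm (I := 𝓘(ℝ, E)) (x := γ)
  simp only [modelWithCornersSelf_coe, range_id, mfderivWithin_univ] at h
  exact h

lemma md_extChartAt_symm_comp (γ₀ : G) {γ : G} (hγ : γ ∈ (chartAt E γ₀).source) :
    (md 𝓘(ℝ, E) 𝓘(ℝ, E) (extChartAt 𝓘(ℝ, E) γ₀).symm (extChartAt 𝓘(ℝ, E) γ₀ γ)).comp
      (md 𝓘(ℝ, E) 𝓘(ℝ, E) (extChartAt 𝓘(ℝ, E) γ₀) γ) = ContinuousLinearMap.id ℝ E := by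
  have hsrc : γ ∈ (extChartAt 𝓘(ℝ, E) γ₀).source := by rwa [extChartAt_source]
  have : IsManifold 𝓘(ℝ, E) 1 G := IsManifold.of_le (n := ∞) (by simp)
  have h1 := (mdifferentiableAt_extChartAt (I := 𝓘(ℝ, E)) hγ).hasMD
  have h2 := hasMD_extChartAt_symm (I := 𝓘(ℝ, E)) γ₀ ((extChartAt 𝓘(ℝ, E) γ₀).map_source hsrc)
  have h3 := h2.comp h1
  refine h3.unique ((hasMD_id γ).congr ?_)
  filter_upwards [(chartAt E γ₀).open_source.mem_nhds hγ] with z hz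
  exact (extChartAt 𝓘(ℝ, E) γ₀).left_inv (by rwa [extChartAt_source])

lemma cotCoord_self (γ : G) (ξ : E →L[ℝ] ℝ) : cotCoord γ (cotMk γ ξ) = ξ := by
  rw [cotCoord, cotMk_proj, md_extChartAt_symm_self]
  rfl

lemma hasMD_cotMk (γ : G) (ξ : E →L[ℝ] ℝ) :
    HasMD 𝓘(ℝ, E →L[ℝ] ℝ) (cotangentModel E) (cotMk γ) ξ (.inr ℝ E (E →L[ℝ] ℝ)) := by
  have hs : ContMDiffAt 𝓘(ℝ, E →L[ℝ] ℝ) (cotangentModel E) 1 (cotMk γ) ξ := by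
    rw [contMDiffAt_cotangent_iff]
    refine ⟨contMDiffAt_const, ?_⟩
    simp only [cotMk_proj, cotCoord_self]
    exact contMDiffAt_id
  have h := hs.hasMD one_ne_zero
  refine h.congr_deriv ?_
  rw [md_eq_fderiv_writtenInExtChartAt (hs.mdifferentiableAt one_ne_zero)]
  have : writtenInExtChartAt 𝓘(ℝ, E →L[ℝ] ℝ) (cotangentModel E) ξ (cotMk γ) =
      fun ζ ↦ (extChartAt 𝓘(ℝ, E) γ γ, ζ) := by
    ext1 ζ
    rw [writtenInExtChartAt, extChartAt_model_space_eq_id]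
    have := extChartAt_cotangent (cotMk γ ξ) (δ := cotMk γ ζ) (mem_chart_source E γ)
    rw [cotMk_proj, cotMk_proj, cotCoord_self] at this
    exact this
  rw [this]
  exact (hasFDerivAt_prodMk_right _ _).fderiv

lemma hasMD_cotangent_proj (δ : CotangentBundle E G) :
    HasMD (cotangentModel E) 𝓘(ℝ, E) (fun δ : CotangentBundle E G ↦ δ.1) δ
      (.fst ℝ E (E →L[ℝ] ℝ)) := by
  have hs : ContMDiffAt (cotangentModel E) 𝓘(ℝ, E) 1 (fun δ : CotangentBundle E G ↦ δ.1) δ :=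
    contMDiff_cotangent_proj.contMDiffAt
  refine (hs.hasMD one_ne_zero).congr_deriv ?_
  rw [md_eq_fderiv_writtenInExtChartAt (hs.mdifferentiableAt one_ne_zero)]
  have : writtenInExtChartAt (cotangentModel E) 𝓘(ℝ, E) δ (fun δ : CotangentBundle E G ↦ δ.1)
      =ᶠ[𝓝 (extChartAt (cotangentModel E) δ δ)] Prod.fst := by
    filter_upwards [(isOpen_extChartAt_target (I := cotangentModel E) δ).mem_nhds
      (mem_extChartAt_target δ)] with y hy
    rw [writtenInExtChartAt, Function.comp_apply, Function.comp_apply,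
      (extChartAt_cotangent_symm δ hy).1]
    exact (extChartAt 𝓘(ℝ, E) δ.1).right_inv ((mem_extChartAt_cotangent_target δ y).1 hy)
  rw [this.fderiv_eq]
  exact (hasFDerivAt_fst).fderiv

/-- Used for the uniqueness of integral curves on whole intervals and for the closedness of `A*G`.
Points over the same `γ` are separated inside one chart, the others by their base points. -/
instance CotangentBundle.t2Space [T2Space G] : T2Space (CotangentBundle E G) := by
  refine ⟨fun δ δ' hne ↦ ?_⟩
  by_cases h : δ.1 = δ'.1
  · have h1 : δ ∈ (extChartAt (cotangentModel E) δ).source := mem_extChartAt_source δ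
    have h2 : δ' ∈ (extChartAt (cotangentModel E) δ).source := by
      rw [mem_extChartAt_cotangent_source, ← h]
      exact mem_chart_source E δ.1
    have hne' : extChartAt (cotangentModel E) δ δ ≠ extChartAt (cotangentModel E) δ δ' :=
      fun h ↦ hne ((extChartAt (cotangentModel E) δ).injOn h1 h2 h)
    obtain ⟨u, v, hu, hv, hxu, hxv, huv⟩ := t2_separation hne'
    refine ⟨_, _, (continuousOn_extChartAt δ).isOpen_inter_preimage (isOpen_extChartAt_source δ) hu,
      (continuousOn_extChartAt δ).isOpen_inter_preimage (isOpen_extChartAt_source δ) hv,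
      ⟨h1, hxu⟩, ⟨h2, hxv⟩, ?_⟩
    exact (huv.preimage _).mono inter_subset_right inter_subset_right
  · obtain ⟨u, v, hu, hv, hxu, hxv, huv⟩ := t2_separation h
    have hc : Continuous (fun δ : CotangentBundle E G ↦ δ.1) :=
      (contMDiff_cotangent_proj (n := 0)).continuous
    exact ⟨_, _, hu.preimage hc, hv.preimage hc, hxu, hxv, huv.preimage _⟩

end CotangentCoordinates

/-! ### Smooth families of covectors -/

section CovectorFamilies

variable {E G : Type*} [NormedAddCommGroup E] [NormedSpace ℝ E]
  [TopologicalSpace G] [ChartedSpace E G] [IsManifold 𝓘(ℝ, E) ∞ G]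
  {E' G' : Type*} [NormedAddCommGroup E'] [NormedSpace ℝ E']
  [TopologicalSpace G'] [ChartedSpace E' G'] [IsManifold 𝓘(ℝ, E') ∞ G']
  {EN HN N : Type*} [NormedAddCommGroup EN] [NormedSpace ℝ EN]
  [TopologicalSpace HN] {IN : ModelWithCorners ℝ EN HN} [TopologicalSpace N] [ChartedSpace HN N]
  [IsManifold IN ∞ N]
  {n m : WithTop ℕ∞}

/-- Pullback of covectors by a smooth family of maps. -/
lemma ContMDiffAt.covector_comp {δ : N → CotangentBundle E G} {g : N → G'} {h : N → G' → G} {x₀ : N}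
    (hδ : ContMDiffAt IN (cotangentModel E) m δ x₀) (hg : ContMDiffAt IN 𝓘(ℝ, E') m g x₀)
    (hh : ContMDiffAt (IN.prod 𝓘(ℝ, E')) 𝓘(ℝ, E) n (Function.uncurry h) (x₀, g x₀))
    (hmn : m + 1 ≤ n) (heq : ∀ᶠ x in 𝓝 x₀, h x (g x) = (δ x).1) :
    ContMDiffAt IN (cotangentModel E') m
      (fun x ↦ cotMk (g x) ((δ x).form.comp (md 𝓘(ℝ, E') 𝓘(ℝ, E) (h x) (g x)))) x₀ := by
  have : IsManifold 𝓘(ℝ, E) 1 G := IsManifold.of_le (n := ∞) (by simp)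
  have : IsManifold 𝓘(ℝ, E') 1 G' := IsManifold.of_le (n := ∞) (by simp)
  have : IsManifold IN 1 N := IsManifold.of_le (n := ∞) (by simp)
  rw [contMDiffAt_cotangent_iff] at hδ ⊢
  refine ⟨hg, ?_⟩
  have hmd := ContMDiffAt.mfderiv h g hh hg hmn
  refine (hδ.2.clm_comp hmd).congr_of_eventuallyEq ?_
  have h0 : h x₀ (g x₀) = (δ x₀).1 := heq.self_of_nhds
  filter_upwards [heq, hg.continuousAt.eventually (chart_source_mem_nhds E' (g x₀)),
    hδ.1.continuousAt.eventually (chart_source_mem_nhds E (δ x₀).1)] with x hx hxg hxδ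
  have hxh : h x (g x) ∈ (chartAt E (h x₀ (g x₀))).source := by rw [h0, hx]; exact hxδ
  rw [inTangentCoordinates_eq_mfderiv_comp hxg hxh]
  simp only [modelWithCornersSelf_coe, range_id, mfderivWithin_univ]
  -- The derivative of the family is known to be smooth when read in charts on both sides. The chart
  -- of `G` brought in by this reading cancels the inverse chart in the coordinates of `δ x`.
  have key := md_extChartAt_symm_comp (δ x₀).1 hxδ
  have e1 : md 𝓘(ℝ, E) 𝓘(ℝ, E) (extChartAt 𝓘(ℝ, E) (h x₀ (g x₀))) (h x (g x)) =
    md 𝓘(ℝ, E) 𝓘(ℝ, E) (extChartAt 𝓘(ℝ, E) (δ x₀).1) (δ x).1 := by rw [h0, hx]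
  change ((δ x).form.comp (md 𝓘(ℝ, E') 𝓘(ℝ, E) (h x) (g x))).comp
      (md 𝓘(ℝ, E') 𝓘(ℝ, E') (extChartAt 𝓘(ℝ, E') (g x₀)).symm (extChartAt 𝓘(ℝ, E') (g x₀) (g x))) =
    (((δ x).form.comp (md 𝓘(ℝ, E) 𝓘(ℝ, E) (extChartAt 𝓘(ℝ, E) (δ x₀).1).symm
      (extChartAt 𝓘(ℝ, E) (δ x₀).1 (δ x).1))).comp
      ((md 𝓘(ℝ, E) 𝓘(ℝ, E) (extChartAt 𝓘(ℝ, E) (h x₀ (g x₀))) (h x (g x))).comp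
        ((md 𝓘(ℝ, E') 𝓘(ℝ, E) (h x) (g x)).comp (md 𝓘(ℝ, E') 𝓘(ℝ, E')
          (extChartAt 𝓘(ℝ, E') (g x₀)).symm (extChartAt 𝓘(ℝ, E') (g x₀) (g x))))))
  rw [e1]
  ext v
  have := congrArg (fun A : E →L[ℝ] E ↦ (δ x).form (A (md 𝓘(ℝ, E') 𝓘(ℝ, E) (h x) (g x)
    (md 𝓘(ℝ, E') 𝓘(ℝ, E') (extChartAt 𝓘(ℝ, E') (g x₀)).symm
      (extChartAt 𝓘(ℝ, E') (g x₀) (g x)) v)))) key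
  exact this.symm

omit [IsManifold IN ∞ N] in
lemma ContMDiffAt.covector_add {g : N → G} {ξ ζ : N → E →L[ℝ] ℝ} {x₀ : N}
    (hξ : ContMDiffAt IN (cotangentModel E) m (fun x ↦ cotMk (g x) (ξ x)) x₀)
    (hζ : ContMDiffAt IN (cotangentModel E) m (fun x ↦ cotMk (g x) (ζ x)) x₀) :
    ContMDiffAt IN (cotangentModel E) m (fun x ↦ cotMk (g x) (ξ x + ζ x)) x₀ := by
  rw [contMDiffAt_cotangent_iff] at hξ hζ ⊢
  refine ⟨hξ.1, (hξ.2.add hζ.2).congr_of_eventuallyEq (Eventually.of_forall fun x ↦ ?_)⟩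
  simp [cotCoord, ContinuousLinearMap.add_comp]

omit [IsManifold IN ∞ N] in
lemma ContMDiffAt.covector_smul (a : ℝ) {g : N → G} {ξ : N → E →L[ℝ] ℝ} {x₀ : N}
    (hξ : ContMDiffAt IN (cotangentModel E) m (fun x ↦ cotMk (g x) (ξ x)) x₀) :
    ContMDiffAt IN (cotangentModel E) m (fun x ↦ cotMk (g x) (a • ξ x)) x₀ := by
  rw [contMDiffAt_cotangent_iff] at hξ ⊢
  have h : ContMDiffAt IN 𝓘(ℝ, ℝ) m (fun _ : N ↦ a) x₀ := contMDiffAt_const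
  refine ⟨hξ.1, (h.smul hξ.2).congr_of_eventuallyEq (Eventually.of_forall fun x ↦ ?_)⟩
  simp [cotCoord, ContinuousLinearMap.smul_comp]

/-- The differential of a smooth function is a smooth family of covectors. -/
lemma ContMDiffAt.covector_md {φ : G → ℝ} {γ₀ : G} (hφ : ContMDiffAt 𝓘(ℝ, E) 𝓘(ℝ, ℝ) n φ γ₀)
    (hmn : m + 1 ≤ n) :
    ContMDiffAt 𝓘(ℝ, E) (cotangentModel E) m
      (fun γ ↦ cotMk γ (md 𝓘(ℝ, E) 𝓘(ℝ, ℝ) φ γ)) γ₀ := by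
  have hm : m ≤ n := le_trans le_self_add hmn
  -- `dφ` is the pullback by `φ` of the covector `id` at `φ γ`, which reduces the claim to
  -- `ContMDiffAt.covector_comp`.
  have hδ : ContMDiffAt 𝓘(ℝ, E) (cotangentModel ℝ) m
      (fun γ : G ↦ (cotMk (φ γ) (ContinuousLinearMap.id ℝ ℝ) : CotangentBundle ℝ ℝ)) γ₀ := by
    rw [contMDiffAt_cotangent_iff]
    refine ⟨hφ.of_le hm, (contMDiffAt_const (c := ContinuousLinearMap.id ℝ ℝ)).congr_of_eventuallyEq
      (Eventually.of_forall fun x ↦ ?_)⟩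
    have : md 𝓘(ℝ, ℝ) 𝓘(ℝ, ℝ) (id : ℝ → ℝ) (φ x) = ContinuousLinearMap.id ℝ ℝ :=
      (hasMD_id _).md_eq
    simp only [cotCoord, extChartAt_model_space_eq_id, cotMk_form, cotMk_proj,
      ContinuousLinearMap.id_comp]
    exact this
  exact hδ.covector_comp (h := fun _ γ ↦ φ γ) (g := id) contMDiffAt_id
    (hφ.comp (γ₀, id γ₀) contMDiffAt_snd) hmn (Eventually.of_forall fun x ↦ rfl)

end CovectorFamilies

/-! ### The standard symplectic form of `E × E*` -/

section Symp

set_option synthInstance.maxHeartbeats 200000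

variable {E : Type*} [NormedAddCommGroup E] [NormedSpace ℝ E]

/-- The standard symplectic form of `E × E*`. -/
def symp (u v : E × (E →L[ℝ] ℝ)) : ℝ := v.2 u.1 - u.2 v.1

/-- The standard symplectic form of `E × E*`, as a map to the dual. -/
def sympFlat (E : Type*) [NormedAddCommGroup E] [NormedSpace ℝ E] :
    E × (E →L[ℝ] ℝ) →ₗ[ℝ] (E × (E →L[ℝ] ℝ) →L[ℝ] ℝ) where
  toFun u := (ContinuousLinearMap.apply ℝ ℝ u.1).comp (.snd ℝ E (E →L[ℝ] ℝ)) -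
    u.2.comp (.fst ℝ E (E →L[ℝ] ℝ))
  map_add' u v := by
    refine ContinuousLinearMap.ext fun w ↦ ?_
    change w.2 (u.1 + v.1) - (u.2 + v.2) w.1 = (w.2 u.1 - u.2 w.1) + (w.2 v.1 - v.2 w.1)
    rw [map_add, add_apply]
    ring
  map_smul' a u := by
    refine ContinuousLinearMap.ext fun w ↦ ?_
    change w.2 (a • u.1) - (a • u.2) w.1 = a • (w.2 u.1 - u.2 w.1)
    rw [map_smul, smul_apply, smul_sub]

lemma sympFlat_apply (u v : E × (E →L[ℝ] ℝ)) : sympFlat E u v = symp u v := rfl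

lemma eq_zero_of_symp_eq_zero {u : E × (E →L[ℝ] ℝ)} (h : ∀ v, symp u v = 0) : u = 0 := by
  have h1 : u.1 = 0 := by
    by_contra hne
    obtain ⟨ζ, hζ⟩ := SeparatingDual.exists_ne_zero (R := ℝ) hne
    exact hζ (by simpa [symp] using h (0, ζ))
  have h2 : u.2 = 0 := by
    ext x
    simpa [symp] using h (x, 0)
  exact Prod.ext h1 h2

lemma sympFlat_injective : Function.Injective (sympFlat E) := by
  rw [injective_iff_map_eq_zero]
  intro u hu
  exact eq_zero_of_symp_eq_zero fun v ↦ by rw [← sympFlat_apply, hu]; rfl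

lemma finrank_dual [FiniteDimensional ℝ E] :
    Module.finrank ℝ (E →L[ℝ] ℝ) = Module.finrank ℝ E := by
  rw [← LinearEquiv.finrank_eq (LinearMap.toContinuousLinearMap (E := E) (F' := ℝ) (𝕜 := ℝ))]
  exact Subspace.dual_finrank_eq

variable [FiniteDimensional ℝ E]

/-- The isomorphism of `E × E*` with its dual defined by the symplectic form. -/
def sympEquiv (E : Type*) [NormedAddCommGroup E] [NormedSpace ℝ E] [FiniteDimensional ℝ E] :
    (E × (E →L[ℝ] ℝ)) ≃ₗ[ℝ] (E × (E →L[ℝ] ℝ) →L[ℝ] ℝ) :=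
  LinearEquiv.ofInjectiveOfFinrankEq (sympFlat E) sympFlat_injective finrank_dual.symm

/-- The inverse of the isomorphism of `E × E*` with its dual defined by the symplectic form. -/
def sympSharp (E : Type*) [NormedAddCommGroup E] [NormedSpace ℝ E] [FiniteDimensional ℝ E] :
    (E × (E →L[ℝ] ℝ) →L[ℝ] ℝ) →L[ℝ] E × (E →L[ℝ] ℝ) :=
  LinearMap.toContinuousLinearMap (𝕜 := ℝ) (E := E × (E →L[ℝ] ℝ) →L[ℝ] ℝ)
    (F' := E × (E →L[ℝ] ℝ)) (sympEquiv E).symm.toLinearMap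

lemma symp_sympSharp (L : E × (E →L[ℝ] ℝ) →L[ℝ] ℝ) (v : E × (E →L[ℝ] ℝ)) :
    symp (sympSharp E L) v = L v := by
  have h : sympFlat E (sympSharp E L) = L := (sympEquiv E).apply_symm_apply L
  rw [← sympFlat_apply, h]

lemma eq_sympSharp_iff (L : E × (E →L[ℝ] ℝ) →L[ℝ] ℝ) (u : E × (E →L[ℝ] ℝ)) :
    u = sympSharp E L ↔ ∀ v, symp u v = L v := by
  refine ⟨fun h v ↦ h ▸ symp_sympSharp L v, fun h ↦ sympFlat_injective
    (ContinuousLinearMap.ext fun v ↦ ?_)⟩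
  rw [sympFlat_apply, sympFlat_apply, h, symp_sympSharp]

/-- Nondegeneracy forces injectivity, and the dimension is finite. -/
lemma conformal_symp_bijective {A : E × (E →L[ℝ] ℝ) →L[ℝ] E × (E →L[ℝ] ℝ)} {a : ℝ} (ha : a ≠ 0)
    (hA : ∀ u v, symp (A u) (A v) = a * symp u v) : Function.Bijective A := by
  have : Function.Injective A := by
    rw [injective_iff_map_eq_zero]
    intro u hu
    refine eq_zero_of_symp_eq_zero fun v ↦ ?_
    have := hA u v
    rw [hu] at this
    simpa [symp, ha] using this.symm
  exact ⟨this, LinearMap.injective_iff_surjective (f := A.toLinearMap).1 this⟩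

/-- Naturality of the Hamiltonian vector: if the form and the differential of the function are
scaled by the same factor, the factor cancels. This covers translations (`a = 1`) as well as
dilations. -/
lemma map_sympSharp {A : E × (E →L[ℝ] ℝ) →L[ℝ] E × (E →L[ℝ] ℝ)} {a : ℝ} (ha : a ≠ 0)
    (hA : ∀ u v, symp (A u) (A v) = a * symp u v) {L L' : E × (E →L[ℝ] ℝ) →L[ℝ] ℝ}
    (hL : L.comp A = a • L') : A (sympSharp E L') = sympSharp E L := by
  rw [eq_sympSharp_iff]
  intro v
  obtain ⟨w, rfl⟩ := (conformal_symp_bijective ha hA).2 v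
  rw [hA, symp_sympSharp]
  exact (congrArg (fun B : E × (E →L[ℝ] ℝ) →L[ℝ] ℝ ↦ B w) hL).symm

end Symp

/-! ### The symplectic form of a cotangent bundle and Hamiltonian vectors -/

section Hamiltonian

set_option synthInstance.maxHeartbeats 200000

variable {E G : Type*} [NormedAddCommGroup E] [NormedSpace ℝ E]
  [TopologicalSpace G] [ChartedSpace E G]

/-- The canonical one-form, read in the model vector space. -/
def canForm (δ : CotangentBundle E G) : E × (E →L[ℝ] ℝ) →L[ℝ] ℝ :=
  δ.form.comp (.fst ℝ E (E →L[ℝ] ℝ))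

lemma canForm_apply (δ : CotangentBundle E G) (w : E × (E →L[ℝ] ℝ)) :
    canForm δ w = δ.form w.1 := rfl

variable [IsManifold 𝓘(ℝ, E) ∞ G]

lemma canonicalOneForm_eq_canForm :
    (canonicalOneForm : ∀ _ : CotangentBundle E G, _) = canForm := by
  funext δ
  exact congrArg (fun A ↦ δ.form.comp A) (hasMD_cotangent_proj δ).md_eq

/-- The charts of `T*G` induced by charts of `G` are Darboux charts: there `α` is the tautological
form, linear in the point, with constant derivative. Hence `ω`, read in the model space, is the same
form `symp` at every point. -/
lemma formInChart_canForm (δ₀ : CotangentBundle E G) {y : E × (E →L[ℝ] ℝ)}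
    (hy : y ∈ (extChartAt (cotangentModel E) δ₀).target) :
    formInChart (cotangentModel E) canForm δ₀ y = y.2.comp (.fst ℝ E (E →L[ℝ] ℝ)) := by
  have h := extChartAt_cotangent_symm δ₀ hy
  have h1 := (hasMD_cotangent_proj _).comp (hasMD_extChartAt_symm (I := cotangentModel E) δ₀ hy)
  have h2 := (hasMD_extChartAt_symm (I := 𝓘(ℝ, E)) δ₀.1
    ((mem_extChartAt_cotangent_target δ₀ y).1 hy)).comp
      (hasMD_iff_hasFDerivAt.2 (hasFDerivAt_fst (𝕜 := ℝ) (p := y)))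
  have h3 := h1.unique (h2.congr (by
    filter_upwards [(isOpen_extChartAt_target (I := cotangentModel E) δ₀).mem_nhds hy] with z hz
    exact (extChartAt_cotangent_symm δ₀ hz).1))
  rw [formInChart, canForm, ContinuousLinearMap.comp_assoc, h3, ← ContinuousLinearMap.comp_assoc,
    h.2]

lemma hasFDerivAt_formInChart_canForm (δ₀ : CotangentBundle E G) {y : E × (E →L[ℝ] ℝ)}
    (hy : y ∈ (extChartAt (cotangentModel E) δ₀).target) :
    HasFDerivAt (formInChart (cotangentModel E) canForm δ₀)
      (((ContinuousLinearMap.compL ℝ (E × (E →L[ℝ] ℝ)) E ℝ).flip (.fst ℝ E (E →L[ℝ] ℝ))).comp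
        (.snd ℝ E (E →L[ℝ] ℝ))) y := by
  refine (ContinuousLinearMap.hasFDerivAt _).congr_of_eventuallyEq ?_
  filter_upwards [(isOpen_extChartAt_target (I := cotangentModel E) δ₀).mem_nhds hy] with z hz
  rw [formInChart_canForm δ₀ hz]
  rfl

lemma extD_canForm (δ : CotangentBundle E G) (u v : E × (E →L[ℝ] ℝ)) :
    extD (cotangentModel E) canForm δ u v = -symp u v := by
  rw [extD, (hasFDerivAt_formInChart_canForm δ (mem_extChartAt_target δ)).fderiv]
  simp [symp]

lemma symplecticForm_eq_symp (δ : CotangentBundle E G) (u v : E × (E →L[ℝ] ℝ)) :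
    symplecticForm δ u v = symp u v := by
  have h : extDerivOneForm (cotangentModel E) canonicalOneForm δ u v =
      extD (cotangentModel E) canForm δ u v := by
    rw [canonicalOneForm_eq_canForm]; rfl
  have h2 : symplecticForm δ u v = -extDerivOneForm (cotangentModel E) canonicalOneForm δ u v := rfl
  rw [h2, h, extD_canForm, neg_neg]

/-- Pullback of the symplectic form, when the pullback of the canonical one-form is known. -/
lemma symp_md_md {V H X : Type*} [NormedAddCommGroup V] [NormedSpace ℝ V] [TopologicalSpace H]
    [TopologicalSpace X] [ChartedSpace H X] {I : ModelWithCorners ℝ V H} [I.Boundaryless]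
    [IsManifold I ∞ X] {f : X → CotangentBundle E G} {x : X}
    (hf : ContMDiffAt I (cotangentModel E) 2 f x) {η : X → V →L[ℝ] ℝ}
    (hη : ∀ᶠ z in 𝓝 x, η z = (canForm (f z)).comp (md I (cotangentModel E) f z)) (u v : V) :
    symp (md I (cotangentModel E) f x u) (md I (cotangentModel E) f x v) = -extD I η x u v := by
  rw [extD_pullback hf (hasFDerivAt_formInChart_canForm _
    (mem_extChartAt_target (f x))).differentiableAt hη, extD_canForm, neg_neg]

variable [FiniteDimensional ℝ E]

/-- The value at `δ` of the Hamiltonian vector field of `p`. -/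
def hamVec (p : CotangentBundle E G → ℝ) (δ : CotangentBundle E G) : E × (E →L[ℝ] ℝ) :=
  sympSharp E (md (cotangentModel E) 𝓘(ℝ, ℝ) p δ)

lemma symp_hamVec (p : CotangentBundle E G → ℝ) (δ : CotangentBundle E G) (w : E × (E →L[ℝ] ℝ)) :
    symp (hamVec p δ) w = md (cotangentModel E) 𝓘(ℝ, ℝ) p δ w :=
  symp_sympSharp _ _

lemma isHamiltonianVector_iff (p : CotangentBundle E G → ℝ) (δ : CotangentBundle E G)
    (v : E × (E →L[ℝ] ℝ)) : IsHamiltonianVector p δ v ↔ v = hamVec p δ := by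
  rw [hamVec, eq_sympSharp_iff]
  refine forall_congr' fun w ↦ ?_
  rw [← symplecticForm_eq_symp δ v w]
  rfl

/-- Hamiltonian vectors are transported by maps that preserve the canonical one-form up to a
constant factor and an exact form. -/
lemma md_hamVec {p : CotangentBundle E G → ℝ} {Ψ : CotangentBundle E G → CotangentBundle E G}
    {φ : CotangentBundle E G → ℝ} {δ : CotangentBundle E G} {a : ℝ} (ha : a ≠ 0)
    (hΨ : ContMDiffAt (cotangentModel E) (cotangentModel E) 2 Ψ δ)
    (hφ : ContMDiffAt (cotangentModel E) 𝓘(ℝ, ℝ) 2 φ δ)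
    (hα : ∀ᶠ z in 𝓝 δ, (canForm (Ψ z)).comp (md (cotangentModel E) (cotangentModel E) Ψ z) =
      a • canForm z + md (cotangentModel E) 𝓘(ℝ, ℝ) φ z)
    (hp : MDifferentiableAt (cotangentModel E) 𝓘(ℝ, ℝ) p (Ψ δ))
    (hp' : MDifferentiableAt (cotangentModel E) 𝓘(ℝ, ℝ) p δ)
    (hpΨ : ∀ᶠ z in 𝓝 δ, p (Ψ z) = a * p z) :
    md (cotangentModel E) (cotangentModel E) Ψ δ (hamVec p δ) = hamVec p (Ψ δ) := by
  have hcan := (hasFDerivAt_formInChart_canForm δ (mem_extChartAt_target δ)).differentiableAt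
  refine map_sympSharp ha (fun u v ↦ ?_) ?_
  -- The exact term drops out since `d(dφ) = 0`; what remains of the pullback of `ω` is `a ω`.
  · rw [symp_md_md hΨ (η := fun z ↦ a • canForm z + md (cotangentModel E) 𝓘(ℝ, ℝ) φ z)
      (hα.mono fun z hz ↦ hz.symm), extD_add (η := fun z ↦ a • canForm z) ?_
      (differentiableAt_formInChart_md hφ), extD_smul a hcan, extD_canForm, extD_md hφ]
    · ring
    · exact hcan.const_smul a
  · have h1 := hp.hasMD.comp (hΨ.hasMD two_ne_zero)
    have h2 : HasMD (cotangentModel E) 𝓘(ℝ, ℝ) (fun z ↦ a * p z) δ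
        (a • md (cotangentModel E) 𝓘(ℝ, ℝ) p δ) := by
      have := (hasMD_iff_hasFDerivAt.2 ((a • ContinuousLinearMap.id ℝ ℝ).hasFDerivAt
        (x := p δ))).comp hp'.hasMD
      exact this.congr_deriv (ContinuousLinearMap.ext fun w ↦ rfl)
    exact h1.unique (h2.congr hpΨ)

/-- The Hamiltonian vector field in a chart. -/
def chartField (p : CotangentBundle E G → ℝ) (δ₀ : CotangentBundle E G) (y : E × (E →L[ℝ] ℝ)) :
    E × (E →L[ℝ] ℝ) :=
  sympSharp E (fderiv ℝ (p ∘ (extChartAt (cotangentModel E) δ₀).symm) y)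

/-- The inverse chart is symplectic, so this is `map_sympSharp` with factor `1`. -/
lemma md_extChartAt_symm_chartField {p : CotangentBundle E G → ℝ} (δ₀ : CotangentBundle E G)
    {y : E × (E →L[ℝ] ℝ)} (hy : y ∈ (extChartAt (cotangentModel E) δ₀).target)
    (hp : MDifferentiableAt (cotangentModel E) 𝓘(ℝ, ℝ) p
      ((extChartAt (cotangentModel E) δ₀).symm y)) :
    md 𝓘(ℝ, E × (E →L[ℝ] ℝ)) (cotangentModel E) (extChartAt (cotangentModel E) δ₀).symm y
      (chartField p δ₀ y) = hamVec p ((extChartAt (cotangentModel E) δ₀).symm y) := by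
  have hΘ : ContMDiffAt 𝓘(ℝ, E × (E →L[ℝ] ℝ)) (cotangentModel E) 2
      (extChartAt (cotangentModel E) δ₀).symm y := by
    have := (contMDiffOn_extChartAt_symm (I := cotangentModel E) (n := ∞) δ₀).contMDiffAt
      ((isOpen_extChartAt_target δ₀).mem_nhds hy)
    exact this.of_le (show (2 : ℕ∞) ≤ (∞ : WithTop ℕ∞) from mod_cast le_top)
  have hd := hasFDerivAt_formInChart_canForm δ₀ hy
  refine map_sympSharp one_ne_zero (fun u v ↦ ?_) ?_
  · rw [symp_md_md hΘ (η := formInChart (cotangentModel E) canForm δ₀)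
      (Eventually.of_forall fun z ↦ rfl), extD_self, hd.fderiv]
    simp [symp]
  · rw [one_smul]
    refine (hp.hasMD.comp (hΘ.hasMD two_ne_zero)).unique (hasMD_iff_hasFDerivAt.2 ?_)
    exact (hasMD_iff_hasFDerivAt.1
      (hp.hasMD.comp (hΘ.hasMD two_ne_zero))).differentiableAt.hasFDerivAt

lemma contDiffOn_chartField {p : CotangentBundle E G → ℝ} {U : Set (CotangentBundle E G)}
    (hU : IsOpen U) (hp : ContMDiffOn (cotangentModel E) 𝓘(ℝ, ℝ) ∞ p U)
    (δ₀ : CotangentBundle E G) :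
    ContDiffOn ℝ ∞ (chartField p δ₀) ((extChartAt (cotangentModel E) δ₀).target ∩
      (extChartAt (cotangentModel E) δ₀).symm ⁻¹' U) := by
  have hopen : IsOpen ((extChartAt (cotangentModel E) δ₀).target ∩
      (extChartAt (cotangentModel E) δ₀).symm ⁻¹' U) :=
    (continuousOn_extChartAt_symm δ₀).isOpen_inter_preimage (isOpen_extChartAt_target δ₀) hU
  have h : ContDiffOn ℝ ∞ (p ∘ (extChartAt (cotangentModel E) δ₀).symm)
      ((extChartAt (cotangentModel E) δ₀).target ∩
        (extChartAt (cotangentModel E) δ₀).symm ⁻¹' U) := by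
    rw [← contMDiffOn_iff_contDiffOn]
    exact hp.comp ((contMDiffOn_extChartAt_symm δ₀).mono inter_subset_left) inter_subset_right
  exact (sympSharp E).contDiff.comp_contDiffOn (h.fderiv_of_isOpen hopen (m := ∞) le_rfl)

end Hamiltonian

/-! ### Integral curves of Hamiltonian vector fields -/

section HamiltonianCurves

set_option synthInstance.maxHeartbeats 200000

variable {E G : Type*} [NormedAddCommGroup E] [NormedSpace ℝ E] [FiniteDimensional ℝ E]
  [TopologicalSpace G] [ChartedSpace E G] [IsManifold 𝓘(ℝ, E) ∞ G]

/-- The velocity of `c` at `t` is the Hamiltonian vector of `p`. -/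
def IsHamAt (p : CotangentBundle E G → ℝ) (c : ℝ → CotangentBundle E G) (t : ℝ) : Prop :=
  HasMD 𝓘(ℝ, ℝ) (cotangentModel E) c t ((1 : ℝ →L[ℝ] ℝ).smulRight (hamVec p (c t)))

/-- On the set `s` of times, `c` is an integral curve in `U` of the Hamiltonian vector field. -/
def IsHamOn (p : CotangentBundle E G → ℝ) (U : Set (CotangentBundle E G))
    (c : ℝ → CotangentBundle E G) (s : Set ℝ) : Prop :=
  ∀ t ∈ s, c t ∈ U ∧ IsHamAt p c t

lemma hasMD_smulRight_iff {V : Type*} [NormedAddCommGroup V] [NormedSpace ℝ V] {y : ℝ → V}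
    {t : ℝ} {v : V} :
    HasMD 𝓘(ℝ, ℝ) 𝓘(ℝ, V) y t ((1 : ℝ →L[ℝ] ℝ).smulRight v) ↔ HasDerivAt y v t := by
  rw [hasMD_iff_hasFDerivAt, hasDerivAt_iff_hasFDerivAt]
  have : (1 : ℝ →L[ℝ] ℝ).smulRight v = ContinuousLinearMap.toSpanSingleton ℝ v := by
    ext; simp
  rw [this]

lemma HasMD.comp_smulRight {V H X V' H' Y : Type*} [NormedAddCommGroup V] [NormedSpace ℝ V]
    [TopologicalSpace H] [TopologicalSpace X] [ChartedSpace H X] {I : ModelWithCorners ℝ V H}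
    [NormedAddCommGroup V'] [NormedSpace ℝ V'] [TopologicalSpace H'] [TopologicalSpace Y]
    [ChartedSpace H' Y] {J : ModelWithCorners ℝ V' H'} {f : X → Y} {c : ℝ → X} {t : ℝ} {v : V}
    {A : V →L[ℝ] V'} (hf : HasMD I J f (c t) A)
    (hc : HasMD 𝓘(ℝ, ℝ) I c t ((1 : ℝ →L[ℝ] ℝ).smulRight v)) :
    HasMD 𝓘(ℝ, ℝ) J (fun τ ↦ f (c τ)) t ((1 : ℝ →L[ℝ] ℝ).smulRight (A v)) := by
  refine (hf.comp hc).congr_deriv ?_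
  ext; simp

namespace IsHamAt

variable {p : CotangentBundle E G → ℝ} {c c' : ℝ → CotangentBundle E G} {t : ℝ}

lemma congr (h : IsHamAt p c t) (hc : c' =ᶠ[𝓝 t] c) : IsHamAt p c' t := by
  have := HasMD.congr h hc
  rwa [← hc.self_of_nhds] at this

lemma continuousAt (h : IsHamAt p c t) : ContinuousAt c t := HasMD.continuousAt h

lemma comp_add {a : ℝ} (h : IsHamAt p c (t + a)) : IsHamAt p (fun τ ↦ c (τ + a)) t := by
  have h1 : HasMD 𝓘(ℝ, ℝ) 𝓘(ℝ, ℝ) (fun τ ↦ τ + a) t (.id ℝ ℝ) :=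
    hasMD_iff_hasFDerivAt.2 ((hasFDerivAt_id t).add_const a)
  exact HasMD.comp (f := fun τ ↦ τ + a) h h1

end IsHamAt

namespace IsHamOn

variable {p : CotangentBundle E G → ℝ} {U : Set (CotangentBundle E G)}
  {c c' : ℝ → CotangentBundle E G} {s s' : Set ℝ}

lemma mono (h : IsHamOn p U c s) (hs : s' ⊆ s) : IsHamOn p U c s' := fun t ht ↦ h t (hs ht)

lemma comp_add (h : IsHamOn p U c s) (a : ℝ) :
    IsHamOn p U (fun τ ↦ c (τ + a)) {t | t + a ∈ s} :=
  fun _ ht ↦ ⟨(h _ ht).1, (h _ ht).2.comp_add⟩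

end IsHamOn

lemma IsHamAt.hasDerivAt_extChartAt {p : CotangentBundle E G → ℝ} {c : ℝ → CotangentBundle E G}
    {t : ℝ} (h : IsHamAt p c t) {δ₀ : CotangentBundle E G}
    (hc : c t ∈ (extChartAt (cotangentModel E) δ₀).source)
    (hp : MDifferentiableAt (cotangentModel E) 𝓘(ℝ, ℝ) p (c t)) :
    HasDerivAt (fun τ ↦ extChartAt (cotangentModel E) δ₀ (c τ))
      (chartField p δ₀ (extChartAt (cotangentModel E) δ₀ (c t))) t := by
  have : IsManifold (cotangentModel E) 1 (CotangentBundle E G) :=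
    IsManifold.of_le (n := ∞) (by simp)
  have hinv := (extChartAt (cotangentModel E) δ₀).left_inv hc
  have ht := (extChartAt (cotangentModel E) δ₀).map_source hc
  have h1 := (mdifferentiableAt_extChartAt (I := cotangentModel E) (x := δ₀) (y := c t)
    (by rwa [extChartAt_source] at hc)).hasMD
  have h2 := md_extChartAt_symm_chartField δ₀ ht (p := p) (by rwa [hinv])
  rw [hinv] at h2
  rw [← hasMD_smulRight_iff]
  refine (h1.comp_smulRight h).congr_deriv ?_
  congr 1
  have h3 := (h1.comp_of_eq (hasMD_extChartAt_symm (I := cotangentModel E) δ₀ ht) hinv).unique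
    ((hasMD_id _).congr (by
      filter_upwards [(isOpen_extChartAt_target (I := cotangentModel E) δ₀).mem_nhds ht] with y hy
      exact (extChartAt (cotangentModel E) δ₀).right_inv hy))
  rw [← h2]
  exact congrArg (fun A : E × (E →L[ℝ] ℝ) →L[ℝ] E × (E →L[ℝ] ℝ) ↦
    A (chartField p δ₀ (extChartAt (cotangentModel E) δ₀ (c t)))) h3

lemma isHamAt_extChartAt_symm {p : CotangentBundle E G → ℝ} {δ₀ : CotangentBundle E G}
    {y : ℝ → E × (E →L[ℝ] ℝ)} {t : ℝ} (h : HasDerivAt y (chartField p δ₀ (y t)) t)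
    (hy : y t ∈ (extChartAt (cotangentModel E) δ₀).target)
    (hp : MDifferentiableAt (cotangentModel E) 𝓘(ℝ, ℝ) p
      ((extChartAt (cotangentModel E) δ₀).symm (y t))) :
    IsHamAt p (fun τ ↦ (extChartAt (cotangentModel E) δ₀).symm (y τ)) t := by
  have := (hasMD_extChartAt_symm (I := cotangentModel E) δ₀ hy).comp_smulRight
    (hasMD_smulRight_iff.2 h)
  rwa [md_extChartAt_symm_chartField δ₀ hy hp] at this

variable {p : CotangentBundle E G → ℝ} {U : Set (CotangentBundle E G)}

/-- In a chart the field is `C^1`, hence locally Lipschitz, and uniqueness for ordinary differential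
equations applies. -/
lemma eventually_eq_of_isHamAt (hU : IsOpen U) (hp : ContMDiffOn (cotangentModel E) 𝓘(ℝ, ℝ) ∞ p U)
    {c c' : ℝ → CotangentBundle E G} {t : ℝ} (h : ∀ᶠ τ in 𝓝 t, IsHamAt p c τ)
    (h' : ∀ᶠ τ in 𝓝 t, IsHamAt p c' τ) (hc : c t ∈ U) (heq : c t = c' t) : c =ᶠ[𝓝 t] c' := by
  set φ := extChartAt (cotangentModel E) (c t)
  have hopen : IsOpen (φ.target ∩ φ.symm ⁻¹' U) :=
    (continuousOn_extChartAt_symm _).isOpen_inter_preimage (isOpen_extChartAt_target _) hU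
  have hmem : φ (c t) ∈ φ.target ∩ φ.symm ⁻¹' U :=
    ⟨mem_extChartAt_target _, by rw [mem_preimage, extChartAt_to_inv]; exact hc⟩
  have hX := (contDiffOn_chartField hU hp (c t)).contDiffAt (hopen.mem_nhds hmem)
  obtain ⟨K, s, hs, hK⟩ := (hX.of_le (n := ∞) (m := 1) (by simp)).exists_lipschitzOnWith
  have key : ∀ d : ℝ → CotangentBundle E G, d t = c t → (∀ᶠ τ in 𝓝 t, IsHamAt p d τ) →
      ∀ᶠ τ in 𝓝 t, (HasDerivAt (fun τ ↦ φ (d τ)) (chartField p (c t) (φ (d τ))) τ ∧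
        φ (d τ) ∈ s) ∧ d τ ∈ φ.source := by
    intro d hd hdh
    have hcont : ContinuousAt d t := hdh.self_of_nhds.continuousAt
    rw [ContinuousAt, hd] at hcont
    have hs' := (continuousAt_extChartAt (I := cotangentModel E) (c t)).eventually hs
    filter_upwards [hdh, hcont.eventually (extChartAt_source_mem_nhds (I := cotangentModel E) (c t)),
      hcont.eventually (hU.mem_nhds hc), hcont.eventually hs'] with τ h1 h2 h3 h4
    exact ⟨⟨h1.hasDerivAt_extChartAt h2
      ((hp.contMDiffAt (hU.mem_nhds h3)).mdifferentiableAt (by simp)), h4⟩, h2⟩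
  have h1 := key c rfl h
  have h2 := key c' heq.symm h'
  have := ODE_solution_unique_of_eventually (v := fun _ ↦ chartField p (c t)) (s := fun _ ↦ s)
    (Eventually.of_forall fun _ ↦ hK) (h1.mono fun _ h ↦ h.1) (h2.mono fun _ h ↦ h.1)
    (by rw [heq])
  filter_upwards [this, h1, h2] with τ h3 h4 h5
  exact φ.injOn h4.2 h5.2 h3

/-- The set of times near which the curves coincide is open by local uniqueness, and closed in `s`
because `T*G` is Hausdorff. -/
lemma IsHamOn.eqOn [T2Space G] (hU : IsOpen U)
    (hp : ContMDiffOn (cotangentModel E) 𝓘(ℝ, ℝ) ∞ p U)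
    {c c' : ℝ → CotangentBundle E G} {s : Set ℝ} (hs : IsOpen s) (hs' : IsPreconnected s)
    (h : IsHamOn p U c s) (h' : ∀ t ∈ s, IsHamAt p c' t) {t₀ : ℝ} (ht₀ : t₀ ∈ s)
    (heq : c t₀ = c' t₀) : EqOn c c' s := by
  have hloc : ∀ t ∈ s, c t = c' t → c =ᶠ[𝓝 t] c' := fun t ht hct ↦
    eventually_eq_of_isHamAt hU hp ((hs.eventually_mem ht).mono fun τ hτ ↦ (h τ hτ).2)
      ((hs.eventually_mem ht).mono fun τ hτ ↦ h' τ hτ) (h t ht).1 hct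
  have hopen : IsOpen {t | c =ᶠ[𝓝 t] c'} := isOpen_setOfPred_eventually_nhds
  have := hs'.subset_of_closure_inter_subset hopen ⟨t₀, ht₀, hloc t₀ ht₀ heq⟩ ?_
  · exact fun t ht ↦ (this ht).self_of_nhds
  · rintro t ⟨htc, hts⟩
    refine hloc t hts ?_
    have hfreq : ∃ᶠ τ in 𝓝 t, c τ = c' τ :=
      (mem_closure_iff_frequently.1 htc).mono fun τ hτ ↦ hτ.self_of_nhds
    exact tendsto_nhds_unique_of_frequently_eq (h t hts).2.continuousAt (h' t hts).continuousAt
      hfreq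

/-- By uniqueness both curves agree near `t₀`, so the pasted curve is differentiable there. -/
lemma IsHamOn.glue (hU : IsOpen U) (hp : ContMDiffOn (cotangentModel E) 𝓘(ℝ, ℝ) ∞ p U)
    {c c' : ℝ → CotangentBundle E G} {a b a' b' t₀ : ℝ} (h : IsHamOn p U c (Ioo a b))
    (h' : IsHamOn p U c' (Ioo a' b')) (ht₀ : t₀ ∈ Ioo a b) (ht₀' : t₀ ∈ Ioo a' b')
    (heq : c t₀ = c' t₀) :
    IsHamOn p U (fun t ↦ if t ≤ t₀ then c t else c' t) (Ioo a b') := by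
  have hev : c =ᶠ[𝓝 t₀] c' := eventually_eq_of_isHamAt hU hp
    ((isOpen_Ioo.eventually_mem ht₀).mono fun τ hτ ↦ (h τ hτ).2)
    ((isOpen_Ioo.eventually_mem ht₀').mono fun τ hτ ↦ (h' τ hτ).2) (h _ ht₀).1 heq
  have key : ∀ d : ℝ → CotangentBundle E G, ∀ t : ℝ,
      (fun t ↦ if t ≤ t₀ then c t else c' t) =ᶠ[𝓝 t] d → d t ∈ U → IsHamAt p d t →
      (if t ≤ t₀ then c t else c' t) ∈ U ∧ IsHamAt p (fun t ↦ if t ≤ t₀ then c t else c' t) t :=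
    fun d t hd hdU hdH ↦ ⟨by rw [← hd.self_of_nhds] at hdU; exact hdU, hdH.congr hd⟩
  intro t ht
  rcases lt_trichotomy t t₀ with hlt | rfl | hlt
  · have hm : t ∈ Ioo a b := ⟨ht.1, hlt.trans ht₀.2⟩
    refine key c t ?_ (h t hm).1 (h t hm).2
    filter_upwards [Iio_mem_nhds hlt] with τ hτ
    exact if_pos (le_of_lt hτ)
  · refine key c t ?_ (h t ht₀).1 (h t ht₀).2
    filter_upwards [hev] with τ hτ
    split_ifs
    · rfl
    · exact hτ.symm
  · have hm : t ∈ Ioo a' b' := ⟨ht₀'.1.trans hlt, ht.2⟩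
    refine key c' t ?_ (h' t hm).1 (h' t hm).2
    filter_upwards [Ioi_mem_nhds hlt] with τ hτ
    exact if_neg (not_le.2 hτ)

/-- Curves defined on `(-T, T)` from every point extend to `(-3T/2, 3T/2)`: restart at the points
reached at times `T/2` and `-T/2`. Iterating multiplies the time of existence by powers of `3/2`. -/
lemma exists_isHamOn_of_uniform [T2Space G] (hU : IsOpen U)
    (hp : ContMDiffOn (cotangentModel E) 𝓘(ℝ, ℝ) ∞ p U) {ε : ℝ} (hε : 0 < ε)
    (h : ∀ δ ∈ U, ∃ c : ℝ → CotangentBundle E G, c 0 = δ ∧ IsHamOn p U c (Ioo (-ε) ε)) :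
    ∀ δ ∈ U, ∃ c : ℝ → CotangentBundle E G, c 0 = δ ∧ IsHamOn p U c univ := by
  have step : ∀ T : ℝ, 0 < T →
      (∀ δ ∈ U, ∃ c : ℝ → CotangentBundle E G, c 0 = δ ∧ IsHamOn p U c (Ioo (-T) T)) →
      ∀ δ ∈ U, ∃ c : ℝ → CotangentBundle E G, c 0 = δ ∧
        IsHamOn p U c (Ioo (-(3 / 2 * T)) (3 / 2 * T)) := by
    intro T hT hcur δ hδ
    obtain ⟨c, hc0, hc⟩ := hcur δ hδ
    obtain ⟨c₁, hc₁0, hc₁⟩ := hcur (c (T / 2)) (hc _ ⟨by linarith, by linarith⟩).1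
    obtain ⟨c₂, hc₂0, hc₂⟩ := hcur (c (-(T / 2))) (hc _ ⟨by linarith, by linarith⟩).1
    have h1 := hc.glue hU hp (t₀ := T / 2) (a' := -(T / 2)) (b' := 3 / 2 * T)
      ((hc₁.comp_add (-(T / 2))).mono fun t ht ↦ ⟨by linarith [ht.1], by linarith [ht.2]⟩)
      ⟨by linarith, by linarith⟩ ⟨by linarith, by linarith⟩ (by simp [hc₁0])
    have h2 := IsHamOn.glue hU hp (t₀ := -(T / 2)) (a := -(3 / 2 * T)) (b := T / 2)
      ((hc₂.comp_add (T / 2)).mono fun t ht ↦ ⟨by linarith [ht.1], by linarith [ht.2]⟩) h1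
      ⟨by linarith, by linarith⟩ ⟨by linarith, by linarith⟩ (by
        have : -(T / 2) ≤ T / 2 := by linarith
        simp [hc₂0, this])
    refine ⟨_, ?_, h2⟩
    have e1 : ¬ ((0 : ℝ) ≤ -(T / 2)) := by linarith
    have e2 : (0 : ℝ) ≤ T / 2 := by linarith
    simp [e1, e2, hc0]
  have hn : ∀ n : ℕ, ∀ δ ∈ U, ∃ c : ℝ → CotangentBundle E G, c 0 = δ ∧
      IsHamOn p U c (Ioo (-((3 / 2) ^ n * ε)) ((3 / 2) ^ n * ε)) := by
    intro n
    induction n with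
    | zero => simpa using h
    | succ n ih =>
      have := step _ (by positivity) ih
      rwa [← mul_assoc, ← pow_succ'] at this
  intro δ hδ
  choose c hc0 hc using fun n ↦ hn n δ hδ
  have hN : ∀ t : ℝ, ∃ n : ℕ, t ∈ Ioo (-((3 / 2) ^ n * ε)) ((3 / 2) ^ n * ε) := by
    intro t
    obtain ⟨n, hn⟩ := pow_unbounded_of_one_lt (|t| / ε) (by norm_num : (1 : ℝ) < 3 / 2)
    exact ⟨n, abs_lt.1 ((div_lt_iff₀ hε).1 hn)⟩
  choose N hN using hN
  -- The extensions agree on common intervals by uniqueness, so a time `t` may be served by any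
  -- extension defined at `t`.
  have hagree : ∀ n m : ℕ, ∀ t, t ∈ Ioo (-((3 / 2 : ℝ) ^ n * ε)) ((3 / 2) ^ n * ε) →
      t ∈ Ioo (-((3 / 2 : ℝ) ^ m * ε)) ((3 / 2) ^ m * ε) → c n t = c m t := by
    intro n m t hn hm
    have := IsHamOn.eqOn hU hp (isOpen_Ioo.inter isOpen_Ioo)
      ((ordConnected_Ioo.inter ordConnected_Ioo).isPreconnected)
      ((hc n).mono inter_subset_left) (fun τ hτ ↦ (hc m τ hτ.2).2) (t₀ := 0) (c' := c m)
      ⟨⟨by simp; positivity, by positivity⟩, ⟨by simp; positivity, by positivity⟩⟩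
      (by rw [hc0, hc0])
    exact this ⟨hn, hm⟩
  refine ⟨fun t ↦ c (N t) t, hc0 _, fun t _ ↦ ⟨(hc _ t (hN t)).1, (hc _ t (hN t)).2.congr ?_⟩⟩
  filter_upwards [isOpen_Ioo.eventually_mem (hN t)] with τ hτ
  exact hagree _ _ _ (hN τ) hτ

lemma exists_local_hamFlow (hU : IsOpen U) (hp : ContMDiffOn (cotangentModel E) 𝓘(ℝ, ℝ) ∞ p U)
    {δ₀ : CotangentBundle E G} (hδ₀ : δ₀ ∈ U) :
    ∃ Φ : CotangentBundle E G × ℝ → CotangentBundle E G,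
      ContMDiffAt ((cotangentModel E).prod 𝓘(ℝ, ℝ)) (cotangentModel E) ∞ Φ (δ₀, 0) ∧
      ∃ ε > 0, ∀ᶠ δ in 𝓝 δ₀, Φ (δ, 0) = δ ∧ IsHamOn p U (fun τ ↦ Φ (δ, τ)) (Ioo (-ε) ε) := by
  set φ := extChartAt (cotangentModel E) δ₀ with hφ
  have hopen : IsOpen (φ.target ∩ φ.symm ⁻¹' U) :=
    (continuousOn_extChartAt_symm _).isOpen_inter_preimage (isOpen_extChartAt_target _) hU
  have hmem : φ δ₀ ∈ φ.target ∩ φ.symm ⁻¹' U :=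
    ⟨mem_extChartAt_target _, by rw [mem_preimage, extChartAt_to_inv]; exact hδ₀⟩
  obtain ⟨F, hF, ε, hε, h⟩ := exists_smooth_localFlow hopen (contDiffOn_chartField hU hp δ₀) hmem
  have hF0 : F (φ δ₀, 0) = φ δ₀ := (h _ (Metric.mem_ball_self hε)).1
  refine ⟨fun z ↦ φ.symm (F (φ z.1, z.2)), ?_, ε, hε, ?_⟩
  · have h1 : ContMDiffAt 𝓘(ℝ, E × (E →L[ℝ] ℝ)) (cotangentModel E) ∞ φ.symm
        (F (φ δ₀, 0)) := by
      rw [hF0]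
      exact (contMDiffOn_extChartAt_symm (I := cotangentModel E) δ₀).contMDiffAt
        ((isOpen_extChartAt_target δ₀).mem_nhds hmem.1)
    have h2 : ContMDiffAt ((cotangentModel E).prod 𝓘(ℝ, ℝ)) 𝓘(ℝ, (E × (E →L[ℝ] ℝ)) × ℝ) ∞
        (fun z : CotangentBundle E G × ℝ ↦ (φ z.1, z.2)) (δ₀, 0) :=
      (contMDiffAt_extChartAt.comp (δ₀, (0 : ℝ)) contMDiffAt_fst).prodMk_space contMDiffAt_snd
    have h3 : ContMDiffAt ((cotangentModel E).prod 𝓘(ℝ, ℝ)) 𝓘(ℝ, E × (E →L[ℝ] ℝ)) ∞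
        (fun z : CotangentBundle E G × ℝ ↦ F (φ z.1, z.2)) (δ₀, 0) :=
      ContMDiffAt.comp (g := F) (δ₀, (0 : ℝ)) hF.contMDiffAt h2
    exact ContMDiffAt.comp (g := φ.symm) (δ₀, (0 : ℝ)) h1 h3
  · filter_upwards [extChartAt_source_mem_nhds (I := cotangentModel E) δ₀,
      (continuousAt_extChartAt (I := cotangentModel E) δ₀).eventually
        (Metric.ball_mem_nhds _ hε)] with δ hδs hδb
    obtain ⟨h0, h1⟩ := h _ hδb
    refine ⟨?_, fun t ht ↦ ?_⟩
    · rw [h0]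
      exact φ.left_inv hδs
    · obtain ⟨h2, h3⟩ := h1 t ht
      exact ⟨h2.2, isHamAt_extChartAt_symm (y := fun τ ↦ F (φ δ, τ)) h3 h2.1
        ((hp.contMDiffAt (hU.mem_nhds h2.2)).mdifferentiableAt (by simp))⟩

end HamiltonianCurves

/-! ### Complete Hamiltonian flows -/

section PullbackDifferentiable

variable {V H X : Type*} [NormedAddCommGroup V] [NormedSpace ℝ V] [TopologicalSpace H]
  [TopologicalSpace X] [ChartedSpace H X] {I : ModelWithCorners ℝ V H}
  {V' H' Y : Type*} [NormedAddCommGroup V'] [NormedSpace ℝ V'] [TopologicalSpace H']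
  [TopologicalSpace Y] [ChartedSpace H' Y] {J : ModelWithCorners ℝ V' H'}
  [I.Boundaryless] [IsManifold I ∞ X] [J.Boundaryless] [IsManifold J ∞ Y]

/-- Needed to differentiate in time the pullback of `α` under the flow. -/
lemma differentiableAt_formInChart_pullback {f : X → Y} {x : X} (hf : ContMDiffAt I J 2 f x)
    {θ : Y → V' →L[ℝ] ℝ} {η : X → V →L[ℝ] ℝ}
    (hθ : DifferentiableAt ℝ (formInChart J θ (f x)) (extChartAt J (f x) (f x)))
    (hη : ∀ᶠ z in 𝓝 x, η z = (θ (f z)).comp (md I J f z)) :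
    DifferentiableAt ℝ (formInChart I η x) (extChartAt I x x) := by
  have hF := hf.contDiffAt_writtenInExtChartAt
  have h1 := (hF.fderiv_right (m := 1) (by norm_num)).differentiableAt (by simp)
  have h2 := hF.differentiableAt (by simp)
  have h3 : writtenInExtChartAt I J x f (extChartAt I x x) = extChartAt J (f x) (f x) := by
    simp [writtenInExtChartAt]
  rw [← h3] at hθ
  exact (DifferentiableAt.clm_comp (DifferentiableAt.comp _ hθ h2) h1).congr_of_eventuallyEq
    (formInChart_pullback (hf.of_le one_le_two) hη)

lemma md_extChartAt_symm_self' (x : X) :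
    md 𝓘(ℝ, V) I (extChartAt I x).symm (extChartAt I x x) = ContinuousLinearMap.id ℝ V := by
  have h := mfderivWithin_range_extChartAt_symm (I := I) (x := x)
  simp only [I.range_eq_univ, mfderivWithin_univ] at h
  exact h

end PullbackDifferentiable

/-! ### The group law and smoothness of a complete flow, and the invariance of the canonical
one-form. -/

section HamiltonianFlows

set_option synthInstance.maxHeartbeats 200000

variable {E G : Type*} [NormedAddCommGroup E] [NormedSpace ℝ E] [FiniteDimensional ℝ E]
  [TopologicalSpace G] [ChartedSpace E G] [IsManifold 𝓘(ℝ, E) ∞ G]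
  {p : CotangentBundle E G → ℝ} {U : Set (CotangentBundle E G)}
  {χ : ℝ → CotangentBundle E G → CotangentBundle E G}

/-- `χ` is a complete flow on `U` of the Hamiltonian vector field of `p`. -/
def IsHamFlow (p : CotangentBundle E G → ℝ) (U : Set (CotangentBundle E G))
    (χ : ℝ → CotangentBundle E G → CotangentBundle E G) : Prop :=
  ∀ δ ∈ U, χ 0 δ = δ ∧ IsHamOn p U (fun τ ↦ χ τ δ) univ

lemma isHamiltonianFlow_iff : IsHamiltonianFlow p U χ ↔ IsHamFlow p U χ := by
  refine forall₂_congr fun δ _ ↦ and_congr_right fun _ ↦ ⟨fun h t _ ↦ ?_, fun h t ↦ ?_⟩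
  · obtain ⟨h1, v, hv, h2⟩ := h t
    rw [(isHamiltonianVector_iff p (χ t δ) v).1 hv] at h2
    exact ⟨h1, h2⟩
  · exact ⟨(h t trivial).1, hamVec p (χ t δ), (isHamiltonianVector_iff _ _ _).2 rfl,
      (h t trivial).2⟩

lemma exists_isHamFlow
    (h : ∀ δ ∈ U, ∃ c : ℝ → CotangentBundle E G, c 0 = δ ∧ IsHamOn p U c univ) :
    ∃ χ, IsHamFlow p U χ := by
  choose! c hc using h
  exact ⟨fun t δ ↦ c δ t, hc⟩

lemma IsHamAt.comp_map {Ψ : CotangentBundle E G → CotangentBundle E G}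
    {c : ℝ → CotangentBundle E G} {t : ℝ} (h : IsHamAt p c t)
    (hΨ : MDifferentiableAt (cotangentModel E) (cotangentModel E) Ψ (c t))
    (hv : md (cotangentModel E) (cotangentModel E) Ψ (c t) (hamVec p (c t)) = hamVec p (Ψ (c t))) :
    IsHamAt p (fun τ ↦ Ψ (c τ)) t := by
  have := hΨ.hasMD.comp_smulRight h
  rwa [hv] at this

namespace IsHamFlow

lemma zero (hχ : IsHamFlow p U χ) {δ : CotangentBundle E G} (hδ : δ ∈ U) : χ 0 δ = δ :=
  (hχ δ hδ).1

lemma mem (hχ : IsHamFlow p U χ) {δ : CotangentBundle E G} (hδ : δ ∈ U) (t : ℝ) : χ t δ ∈ U :=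
  ((hχ δ hδ).2 t trivial).1

lemma isHamAt (hχ : IsHamFlow p U χ) {δ : CotangentBundle E G} (hδ : δ ∈ U) (t : ℝ) :
    IsHamAt p (fun τ ↦ χ τ δ) t :=
  ((hχ δ hδ).2 t trivial).2

variable [T2Space G] (hU : IsOpen U) (hp : ContMDiffOn (cotangentModel E) 𝓘(ℝ, ℝ) ∞ p U)

include hU hp

lemma eq_of_isHamAt (hχ : IsHamFlow p U χ) {c : ℝ → CotangentBundle E G} (hc0 : c 0 ∈ U)
    (hc : ∀ t, IsHamAt p c t) (t : ℝ) : c t = χ t (c 0) :=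
  (IsHamOn.eqOn hU hp isOpen_univ isPreconnected_univ (hχ _ hc0).2 (fun t _ ↦ hc t)
    (mem_univ 0) (hχ.zero hc0) (mem_univ t)).symm

lemma add (hχ : IsHamFlow p U χ) {δ : CotangentBundle E G} (hδ : δ ∈ U) (s t : ℝ) :
    χ (s + t) δ = χ s (χ t δ) := by
  have h := hχ.eq_of_isHamAt hU hp (c := fun τ ↦ χ (τ + t) δ) (by simpa using hχ.mem hδ t)
    (fun τ ↦ (hχ.isHamAt hδ (τ + t)).comp_add) s
  simpa using h

lemma neg_apply (hχ : IsHamFlow p U χ) {δ : CotangentBundle E G} (hδ : δ ∈ U) (t : ℝ) :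
    χ (-t) (χ t δ) = δ := by
  rw [← hχ.add hU hp hδ, neg_add_cancel, hχ.zero hδ]

/-- Near time `0` the flow coincides, by uniqueness, with the smooth local flow constructed in a
chart. -/
lemma contMDiffAt_zero (hχ : IsHamFlow p U χ) {δ : CotangentBundle E G} (hδ : δ ∈ U) :
    ContMDiffAt (𝓘(ℝ, ℝ).prod (cotangentModel E)) (cotangentModel E) ∞
      (fun z : ℝ × CotangentBundle E G ↦ χ z.1 z.2) (0, δ) := by
  obtain ⟨Φ, hΦ, ε, hε, h⟩ := exists_local_hamFlow hU hp hδ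
  have h1 : ContMDiffAt (𝓘(ℝ, ℝ).prod (cotangentModel E)) (cotangentModel E) ∞
      (fun z : ℝ × CotangentBundle E G ↦ Φ (z.2, z.1)) (0, δ) :=
    ContMDiffAt.comp (g := Φ) ((0 : ℝ), δ) hΦ (contMDiffAt_snd.prodMk contMDiffAt_fst)
  refine h1.congr_of_eventuallyEq ?_
  have h2 : ∀ᶠ z : ℝ × CotangentBundle E G in 𝓝 (0, δ), z.1 ∈ Ioo (-ε) ε :=
    continuousAt_fst.eventually (Ioo_mem_nhds (by simpa using hε) hε)
  have h3 : ∀ᶠ z : ℝ × CotangentBundle E G in 𝓝 (0, δ), _ :=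
    continuousAt_snd.eventually (h.and (hU.mem_nhds hδ))
  filter_upwards [h2, h3] with z hz1 hz2
  obtain ⟨⟨hz0, hz⟩, hzU⟩ := hz2
  exact (IsHamOn.eqOn hU hp isOpen_Ioo isPreconnected_Ioo hz (fun t _ ↦ hχ.isHamAt hzU t)
    (t₀ := 0) ⟨by simpa using hε, hε⟩ (by rw [hχ.zero hzU, hz0]) hz1).symm

/-- For fixed `δ`, the times `t` of regularity at `(t, δ)` form an open set containing `0`. It is
closed too: for `τ` in the set close to `t`, write `χ_z = χ_{z-τ} ∘ χ_τ`, where `χ_{z-τ}` is regular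
near time `0`. -/
lemma contMDiffAt (hχ : IsHamFlow p U χ) {δ : CotangentBundle E G} (hδ : δ ∈ U) (t : ℝ) :
    ContMDiffAt (𝓘(ℝ, ℝ).prod (cotangentModel E)) (cotangentModel E) ∞
      (fun z : ℝ × CotangentBundle E G ↦ χ z.1 z.2) (t, δ) := by
  -- The argument is run at each finite order `m`, since regularity of finite order at a point is an
  -- open condition.
  rw [contMDiffAt_infty]
  intro m
  have i1 : IsManifold (cotangentModel E) m (CotangentBundle E G) :=
    IsManifold.of_le (n := ∞) (by exact_mod_cast le_top)
  have i2 : IsManifold (𝓘(ℝ, ℝ).prod (cotangentModel E)) m (ℝ × CotangentBundle E G) :=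
    IsManifold.of_le (n := ∞) (by exact_mod_cast le_top)
  set P : ℝ → CotangentBundle E G → Prop := fun t δ ↦
    ContMDiffAt (𝓘(ℝ, ℝ).prod (cotangentModel E)) (cotangentModel E) m
      (fun z : ℝ × CotangentBundle E G ↦ χ z.1 z.2) (t, δ) with hP
  have hP0 : ∀ {δ}, δ ∈ U → P 0 δ := fun hδ ↦
    (hχ.contMDiffAt_zero hU hp hδ).of_le (by exact_mod_cast le_top)
  have hev : ∀ {t δ}, P t δ → ∀ᶠ z : ℝ × CotangentBundle E G in 𝓝 (t, δ), P z.1 z.2 :=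
    fun h ↦ h.eventually_contMDiffAt (by simp)
  have hopen : IsOpen {t | P t δ} := by
    rw [isOpen_iff_mem_nhds]
    intro t ht
    have : ContinuousAt (fun τ : ℝ ↦ (τ, δ)) t := by fun_prop
    exact this.eventually (hev ht)
  refine isPreconnected_univ.subset_of_closure_inter_subset hopen ⟨0, trivial, hP0 hδ⟩ ?_
    (mem_univ t)
  rintro t ⟨ht, -⟩
  have hcont : ContinuousAt (fun τ ↦ (t - τ, χ τ δ)) t := by
    have := (hχ.isHamAt hδ t).continuousAt
    fun_prop
  have h1 : ∀ᶠ τ in 𝓝 t, P (t - τ) (χ τ δ) := by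
    have h2 := hev (hP0 (hχ.mem hδ t))
    rw [← sub_self t] at h2
    exact hcont.eventually h2
  obtain ⟨τ, hτ, hτP⟩ := ((mem_closure_iff_frequently.1 ht).and_eventually h1).exists
  replace hτ : P τ δ := hτ
  change P t δ
  have hτ1 : ContMDiffAt (𝓘(ℝ, ℝ).prod (cotangentModel E)) (cotangentModel E) m
      (fun z : ℝ × CotangentBundle E G ↦ χ τ z.2) (t, δ) :=
    ContMDiffAt.comp (g := fun z : ℝ × CotangentBundle E G ↦ χ z.1 z.2) (t, δ) hτ
      (contMDiffAt_const.prodMk contMDiffAt_snd)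
  have hτ2 : ContMDiffAt (𝓘(ℝ, ℝ).prod (cotangentModel E)) 𝓘(ℝ, ℝ) m
      (fun z : ℝ × CotangentBundle E G ↦ z.1 - τ) (t, δ) :=
    contMDiffAt_fst.sub contMDiffAt_const
  have hcomp : ContMDiffAt (𝓘(ℝ, ℝ).prod (cotangentModel E)) (cotangentModel E) m
      (fun z : ℝ × CotangentBundle E G ↦ χ (z.1 - τ) (χ τ z.2)) (t, δ) :=
    ContMDiffAt.comp (g := fun z : ℝ × CotangentBundle E G ↦ χ z.1 z.2) (t, δ) hτP
      (hτ2.prodMk hτ1)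
  refine hcomp.congr_of_eventuallyEq ?_
  have h3 : ∀ᶠ z : ℝ × CotangentBundle E G in 𝓝 (t, δ), z.2 ∈ U :=
    continuousAt_snd.eventually (hU.mem_nhds hδ)
  filter_upwards [h3] with z hz
  rw [← hχ.add hU hp hz, sub_add_cancel]

lemma contMDiffAt_apply (hχ : IsHamFlow p U χ) {δ : CotangentBundle E G} (hδ : δ ∈ U) (t : ℝ) :
    ContMDiffAt (cotangentModel E) (cotangentModel E) ∞ (χ t) δ :=
  ContMDiffAt.comp (g := fun z : ℝ × CotangentBundle E G ↦ χ z.1 z.2) δ (hχ.contMDiffAt hU hp hδ t)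
    (contMDiffAt_const.prodMk contMDiffAt_id)

/-- The Hamiltonian flow of a homogeneous function of degree one preserves the canonical
one-form. -/
lemma canForm_comp_md (hχ : IsHamFlow p U χ) (heuler : ∀ δ ∈ U, canForm δ (hamVec p δ) = p δ)
    {δ : CotangentBundle E G} (hδ : δ ∈ U) (t : ℝ) :
    (canForm (χ t δ)).comp (md (cotangentModel E) (cotangentModel E) (χ t) δ) = canForm δ := by
  set φ := extChartAt (cotangentModel E) δ with hφ
  set y₀ := φ δ with hy₀
  have hy₀t : y₀ ∈ φ.target := mem_extChartAt_target δ
  have hy₀' : φ.symm y₀ = δ := extChartAt_to_inv δ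
  have hΘ := (contMDiffOn_extChartAt_symm (I := cotangentModel E) (n := ∞) δ).contMDiffAt
    ((isOpen_extChartAt_target δ).mem_nhds hy₀t)
  -- The flow is viewed as one map of the initial point and the time; `θ`, below, is the pullback of
  -- `α` by it. The claim is that the spatial part of `θ` does not depend on time.
  set K : (E × (E →L[ℝ] ℝ)) × ℝ → CotangentBundle E G := fun z ↦ χ z.2 (φ.symm z.1) with hK
  have hKs : ∀ t, ContMDiffAt 𝓘(ℝ, (E × (E →L[ℝ] ℝ)) × ℝ) (cotangentModel E) ∞ K (y₀, t) := by
    intro t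
    have h1 : ContMDiffAt 𝓘(ℝ, (E × (E →L[ℝ] ℝ)) × ℝ) (cotangentModel E) ∞
        (fun z : (E × (E →L[ℝ] ℝ)) × ℝ ↦ φ.symm z.1) (y₀, t) :=
      ContMDiffAt.comp (g := φ.symm) (y₀, t) hΘ contDiffAt_fst.contMDiffAt
    have h2 : ContMDiffAt 𝓘(ℝ, (E × (E →L[ℝ] ℝ)) × ℝ) 𝓘(ℝ, ℝ) ∞
        (fun z : (E × (E →L[ℝ] ℝ)) × ℝ ↦ z.2) (y₀, t) := contDiffAt_snd.contMDiffAt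
    have h3 := hχ.contMDiffAt hU hp hδ t
    rw [← hy₀'] at h3
    exact ContMDiffAt.comp (g := fun z : ℝ × CotangentBundle E G ↦ χ z.1 z.2) (y₀, t) h3
      (h2.prodMk h1)
  set θ : (E × (E →L[ℝ] ℝ)) × ℝ → (E × (E →L[ℝ] ℝ)) × ℝ →L[ℝ] ℝ := fun z ↦
    (canForm (K z)).comp (md 𝓘(ℝ, (E × (E →L[ℝ] ℝ)) × ℝ) (cotangentModel E) K z) with hθ
  have hK2 : ∀ t, ContMDiffAt 𝓘(ℝ, (E × (E →L[ℝ] ℝ)) × ℝ) (cotangentModel E) 2 K (y₀, t) :=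
    fun t ↦ (hKs t).of_le (show ((2 : ℕ∞) : WithTop ℕ∞) ≤ ∞ from mod_cast le_top)
  have hθd : ∀ t, DifferentiableAt ℝ θ (y₀, t) := by
    intro t
    have := differentiableAt_formInChart_pullback (hK2 t) (θ := canForm) (η := θ)
      (hasFDerivAt_formInChart_canForm _ (mem_extChartAt_target _)).differentiableAt
      (Eventually.of_forall fun z ↦ rfl)
    rwa [formInChart_self, extChartAt_model_space_eq_id] at this
  have hcont : ContinuousAt φ.symm y₀ := hΘ.continuousAt
  have hKU : ∀ t : ℝ, ∀ᶠ z in 𝓝 (y₀, t), φ.symm z.1 ∈ U := by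
    intro t
    have h1 : ContinuousAt (fun z : (E × (E →L[ℝ] ℝ)) × ℝ ↦ φ.symm z.1) (y₀, t) :=
      ContinuousAt.comp (g := φ.symm) (f := Prod.fst) hcont continuousAt_fst
    exact h1.eventually (hU.mem_nhds (by change φ.symm y₀ ∈ U; rwa [hy₀']))
  have hKt : ∀ t, ∀ᶠ z in 𝓝 (y₀, t),
      md 𝓘(ℝ, (E × (E →L[ℝ] ℝ)) × ℝ) (cotangentModel E) K z (0, 1) = hamVec p (K z) := by
    intro t
    filter_upwards [hKU t, (hK2 t).eventually_mdifferentiableAt one_le_two] with z hz hzd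
    have h1 := hzd.hasMD.comp (hasMD_iff_hasFDerivAt.2
      (hasFDerivAt_prodMk_right (𝕜 := ℝ) z.1 z.2))
    have h2 := h1.unique (hχ.isHamAt hz z.2)
    simpa using congrArg (fun A : ℝ →L[ℝ] E × (E →L[ℝ] ℝ) ↦ A 1) h2
  -- Cartan's formula: `∂_t(θ(v)) = dθ(∂_t, v) + d(θ(∂_t))(v)`. The first term is `-ω(H_p, K_* v) =
  -- -dp(K_* v)`; the second is `dp(K_* v)`, since `θ(∂_t) = α(H_p) = p ∘ K` by Euler's relation.
  have hderiv : ∀ (v : E × (E →L[ℝ] ℝ)) (t : ℝ), fderiv ℝ θ (y₀, t) (0, 1) (v, 0) = 0 := by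
    intro v t
    have hpK : MDifferentiableAt (cotangentModel E) 𝓘(ℝ, ℝ) p (K (y₀, t)) :=
      (hp.contMDiffAt (hU.mem_nhds (hχ.mem (by rwa [hy₀']) t))).mdifferentiableAt (by simp)
    have h1 := symp_md_md (hK2 t) (η := θ) (Eventually.of_forall fun z ↦ rfl) (0, 1) (v, 0)
    rw [(hKt t).self_of_nhds, symp_hamVec, extD_self] at h1
    have h2 : fderiv ℝ θ (y₀, t) (v, 0) (0, 1) =
        fderiv ℝ (fun z ↦ θ z (0, 1)) (y₀, t) (v, 0) := by
      rw [((hθd t).hasFDerivAt.clm_apply (hasFDerivAt_const _ _)).fderiv]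
      simp
    have h3 : (fun z ↦ θ z (0, 1)) =ᶠ[𝓝 (y₀, t)] p ∘ K := by
      filter_upwards [hKt t, hKU t] with z hz hzU
      change canForm (K z) (md 𝓘(ℝ, (E × (E →L[ℝ] ℝ)) × ℝ) (cotangentModel E) K z (0, 1)) = p (K z)
      rw [hz, heuler _ (hχ.mem hzU _)]
    have h4 : HasFDerivAt (p ∘ K) _ (y₀, t) :=
      hasMD_iff_hasFDerivAt.1 (hpK.hasMD.comp ((hK2 t).hasMD two_ne_zero))
    rw [h2, h3.fderiv_eq, h4.fderiv] at h1
    simp only [ContinuousLinearMap.comp_apply] at h1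
    linarith
  have hθK : ∀ (v : E × (E →L[ℝ] ℝ)) (t : ℝ), θ (y₀, t) (v, 0) =
      canForm (χ t δ) (md (cotangentModel E) (cotangentModel E) (χ t) δ v) := by
    intro v t
    have h1 := HasMD.comp (f := fun y ↦ (y, t)) (x := y₀) ((hK2 t).hasMD two_ne_zero)
      (hasMD_iff_hasFDerivAt.2 (hasFDerivAt_prodMk_left (𝕜 := ℝ) y₀ t))
    have h2 := ((hχ.contMDiffAt_apply hU hp hδ t).hasMD (by simp)).comp_of_eq
      (hasMD_extChartAt_symm (I := cotangentModel E) δ hy₀t) hy₀'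
    rw [hy₀, md_extChartAt_symm_self' δ] at h2
    have h3 := congrArg (fun A : E × (E →L[ℝ] ℝ) →L[ℝ] E × (E →L[ℝ] ℝ) ↦ A v) (h1.unique h2)
    have h4 : K (y₀, t) = χ t δ := by rw [hK]; simp only [hy₀']
    change canForm (K (y₀, t)) (md 𝓘(ℝ, (E × (E →L[ℝ] ℝ)) × ℝ) (cotangentModel E) K (y₀, t) (v, 0))
      = _
    rw [h4]
    exact congrArg _ h3
  refine ContinuousLinearMap.ext fun v ↦ ?_
  have hconst : θ (y₀, t) (v, 0) = θ (y₀, 0) (v, 0) := by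
    have hd : ∀ t, HasDerivAt (fun τ ↦ θ (y₀, τ) (v, 0)) 0 t := by
      intro t
      have h1 : HasFDerivAt (fun z ↦ θ z (v, 0)) _ (y₀, t) :=
        (hθd t).hasFDerivAt.clm_apply (hasFDerivAt_const (v, (0 : ℝ)) _)
      have h2 := h1.comp_hasDerivAt t
        ((hasDerivAt_const t y₀).prodMk (hasDerivAt_id t))
      refine h2.congr_deriv ?_
      simpa using hderiv v t
    exact is_const_of_deriv_eq_zero (fun t ↦ (hd t).differentiableAt) (fun t ↦ (hd t).deriv) t 0
  rw [hθK, hθK] at hconst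
  have h0 : md (cotangentModel E) (cotangentModel E) (χ 0) δ = .id ℝ _ := by
    refine ((hasMD_id δ).congr ?_).md_eq
    filter_upwards [hU.mem_nhds hδ] with z hz
    exact hχ.zero hz
  rw [h0, hχ.zero hδ] at hconst
  exact hconst

end IsHamFlow

end HamiltonianFlows

/-! ### Local sections of submersions -/

section Sections

variable {E F X Y : Type*}
  [NormedAddCommGroup E] [NormedSpace ℝ E] [FiniteDimensional ℝ E]
  [NormedAddCommGroup F] [NormedSpace ℝ F] [FiniteDimensional ℝ F]
  [TopologicalSpace X] [ChartedSpace E X] [IsManifold 𝓘(ℝ, E) ∞ X]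
  [TopologicalSpace Y] [ChartedSpace F Y] [IsManifold 𝓘(ℝ, F) ∞ Y]

/-- A family of affine sections of a submersion between vector spaces. -/
lemma exists_affine_section {f : E → F} {z₀ : E} (hf : ContDiffAt ℝ ∞ f z₀) {A : F →L[ℝ] E}
    (hA : (fderiv ℝ f z₀).comp A = .id ℝ F) :
    ∃ ψ : E × F → F, ContDiffAt ℝ ∞ ψ (z₀, f z₀) ∧ ψ (z₀, f z₀) = 0 ∧
      (∀ᶠ z in 𝓝 (z₀, f z₀), f (z.1 + A (ψ z)) = z.2) ∧
      (∀ᶠ z in 𝓝 z₀, ψ (z, f z) = 0) ∧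
      HasFDerivAt (fun x ↦ z₀ + A (ψ (z₀, x))) A (f z₀) := by
  have : CompleteSpace E := FiniteDimensional.complete ℝ E
  have : CompleteSpace F := FiniteDimensional.complete ℝ F
  -- The equation `f (z + A v) = x` is solved for `v` by the implicit function theorem: its
  -- derivative in `v` at the base point is `Df ∘ A = id`.
  set u : (E × F) × F := ((z₀, f z₀), 0) with hu
  set q : (E × F) × F → F := fun w ↦ f (w.1.1 + A w.2) - w.1.2 with hq
  have hqu : q u = 0 := by simp [hq, hu]
  have harg : ContDiffAt ℝ ∞ (fun w : (E × F) × F ↦ w.1.1 + A w.2) u := by fun_prop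
  have hfu : ContDiffAt ℝ ∞ f ((fun w : (E × F) × F ↦ w.1.1 + A w.2) u) := by simpa [hu] using hf
  have hqs : ContDiffAt ℝ ∞ q u := (hfu.comp u harg).sub (by fun_prop)
  have hfz : HasFDerivAt f (fderiv ℝ f z₀) z₀ := (hf.differentiableAt (by simp)).hasFDerivAt
  have hinr : (fderiv ℝ q u).comp (.inr ℝ (E × F) F) = .id ℝ F := by
    have h1 : HasFDerivAt (fun v : F ↦ q (u.1, v)) ((fderiv ℝ q u).comp (.inr ℝ (E × F) F)) 0 :=
      HasFDerivAt.comp (f := fun v : F ↦ (u.1, v)) (g := q) (0 : F)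
        (hqs.differentiableAt (by simp)).hasFDerivAt (hasFDerivAt_prodMk_right u.1 (0 : F))
    have h2 : HasFDerivAt (fun v : F ↦ q (u.1, v)) ((fderiv ℝ f z₀).comp A) 0 := by
      have h3 : HasFDerivAt (fun v : F ↦ z₀ + A v) A 0 := A.hasFDerivAt.const_add z₀
      have h4 : HasFDerivAt f (fderiv ℝ f z₀) ((fun v : F ↦ z₀ + A v) 0) := by simpa using hfz
      exact (h4.comp (0 : F) h3).sub_const (f z₀)
    rw [h1.unique h2, hA]
  have hinv : ((fderiv ℝ q u).comp (.inr ℝ (E × F) F)).IsInvertible := by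
    rw [hinr]; exact ContinuousLinearMap.isInvertible_equiv (f := ContinuousLinearEquiv.refl ℝ F)
  set ψ := hqs.implicitFunction (by simp) hinv
  have hψ := hqs.contDiffAt_implicitFunction (by simp) hinv
  have hψ0 : ψ (z₀, f z₀) = 0 := hqs.implicitFunction_apply_self (by simp) hinv
  have hsol : ∀ᶠ z in 𝓝 (z₀, f z₀), f (z.1 + A (ψ z)) = z.2 := by
    filter_upwards [hqs.eventually_apply_implicitFunction (by simp) hinv] with z hz
    rw [hqu] at hz
    exact sub_eq_zero.1 hz
  refine ⟨ψ, hψ, hψ0, hsol, ?_, ?_⟩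
  · have hc : ContinuousAt (fun z ↦ (((z, f z), 0) : (E × F) × F)) z₀ := by
      have := hf.continuousAt
      fun_prop
    filter_upwards [hc.eventually (hqs.eventually_apply_eq_iff_implicitFunction (by simp) hinv)]
      with z hz
    exact hz.1 (by rw [hqu]; simp [hq])
  · have h1 : HasFDerivAt (fun x ↦ ψ (z₀, x)) ((fderiv ℝ ψ (z₀, f z₀)).comp (.inr ℝ E F)) (f z₀) :=
      HasFDerivAt.comp (f := fun x : F ↦ (z₀, x)) (g := ψ) (f z₀)
        (hψ.differentiableAt (by simp)).hasFDerivAt (hasFDerivAt_prodMk_right z₀ (f z₀))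
    set B := (fderiv ℝ ψ (z₀, f z₀)).comp (.inr ℝ E F)
    have h2 : HasFDerivAt (fun x ↦ z₀ + A (ψ (z₀, x))) (A.comp B) (f z₀) :=
      (A.hasFDerivAt.comp (f z₀) h1).const_add z₀
    have h3 : HasFDerivAt f (fderiv ℝ f z₀) ((fun x ↦ z₀ + A (ψ (z₀, x))) (f z₀)) := by
      simpa [hψ0] using hfz
    have h4 := (h3.comp (f z₀) h2).unique ((hasFDerivAt_id (f z₀)).congr_of_eventuallyEq (by
      have hc : ContinuousAt (fun x : F ↦ (z₀, x)) (f z₀) := by fun_prop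
      filter_upwards [hc.eventually hsol] with x hx
      exact hx))
    rw [← ContinuousLinearMap.comp_assoc, hA, ContinuousLinearMap.id_comp] at h4
    rwa [h4, ContinuousLinearMap.comp_id] at h2

/-- A smooth map whose differential at `γ₀` has the right inverse `A` has a smooth family of
sections, the one through `γ₀` having the differential `A`. -/
lemma exists_section {r : X → Y} {γ₀ : X} (hr : ContMDiffAt 𝓘(ℝ, E) 𝓘(ℝ, F) ∞ r γ₀)
    {A : F →L[ℝ] E} (hA : (md 𝓘(ℝ, E) 𝓘(ℝ, F) r γ₀).comp A = .id ℝ F) :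
    ∃ σ : X × Y → X, ContMDiffAt (𝓘(ℝ, E).prod 𝓘(ℝ, F)) 𝓘(ℝ, E) ∞ σ (γ₀, r γ₀) ∧
      (∀ᶠ z in 𝓝 (γ₀, r γ₀), r (σ z) = z.2) ∧ (∀ᶠ γ in 𝓝 γ₀, σ (γ, r γ) = γ) ∧
      HasMD 𝓘(ℝ, F) 𝓘(ℝ, E) (fun x ↦ σ (γ₀, x)) (r γ₀) A := by
  have i1 : IsManifold 𝓘(ℝ, E) 1 X := IsManifold.of_le (n := ∞) (by simp)
  have i2 : IsManifold 𝓘(ℝ, F) 1 Y := IsManifold.of_le (n := ∞) (by simp)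
  set φ := extChartAt 𝓘(ℝ, E) γ₀ with hφ
  set κ := extChartAt 𝓘(ℝ, F) (r γ₀) with hκ
  set f := writtenInExtChartAt 𝓘(ℝ, E) 𝓘(ℝ, F) γ₀ r with hf
  have hfφ : ∀ γ ∈ φ.source, f (φ γ) = κ (r γ) := fun γ hγ ↦ by
    rw [hf, writtenInExtChartAt, Function.comp_apply, Function.comp_apply, φ.left_inv hγ]
  have hf0 : f (φ γ₀) = κ (r γ₀) := hfφ _ (mem_extChartAt_source γ₀)
  have hfs : ContDiffAt ℝ ∞ f (φ γ₀) := hr.contDiffAt_writtenInExtChartAt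
  rw [md_eq_fderiv_writtenInExtChartAt (hr.mdifferentiableAt (by simp))] at hA
  obtain ⟨ψ, hψ, hψ0, hsol, hψr, hψd⟩ := exists_affine_section hfs hA
  rw [hf0] at hψ hψ0 hsol hψd
  have hφs : ContMDiffAt 𝓘(ℝ, E) 𝓘(ℝ, E) ∞ φ γ₀ := contMDiffAt_extChartAt
  have hκs : ContMDiffAt 𝓘(ℝ, F) 𝓘(ℝ, F) ∞ κ (r γ₀) := contMDiffAt_extChartAt
  have hch : ContMDiffAt (𝓘(ℝ, E).prod 𝓘(ℝ, F)) 𝓘(ℝ, E × F) ∞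
      (fun z : X × Y ↦ (φ z.1, κ z.2)) (γ₀, r γ₀) :=
    (hφs.comp (γ₀, r γ₀) contMDiffAt_fst).prodMk_space (hκs.comp (γ₀, r γ₀) contMDiffAt_snd)
  have hw : ContDiffAt ℝ ∞ (fun z : E × F ↦ z.1 + A (ψ z)) (φ γ₀, κ (r γ₀)) := by fun_prop
  have hw' : ContMDiffAt (𝓘(ℝ, E).prod 𝓘(ℝ, F)) 𝓘(ℝ, E) ∞
      (fun z : X × Y ↦ φ z.1 + A (ψ (φ z.1, κ z.2))) (γ₀, r γ₀) :=
    ContMDiffAt.comp (g := fun z : E × F ↦ z.1 + A (ψ z)) (γ₀, r γ₀) hw.contMDiffAt hch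
  have hw0 : φ γ₀ + A (ψ (φ γ₀, κ (r γ₀))) = φ γ₀ := by rw [hψ0, map_zero, add_zero]
  have hsymm : ContMDiffAt 𝓘(ℝ, E) 𝓘(ℝ, E) ∞ φ.symm (φ γ₀) :=
    (contMDiffOn_extChartAt_symm γ₀).contMDiffAt
      ((isOpen_extChartAt_target γ₀).mem_nhds (mem_extChartAt_target γ₀))
  have hσ : ContMDiffAt (𝓘(ℝ, E).prod 𝓘(ℝ, F)) 𝓘(ℝ, E) ∞
      (fun z : X × Y ↦ φ.symm (φ z.1 + A (ψ (φ z.1, κ z.2)))) (γ₀, r γ₀) := by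
    rw [← hw0] at hsymm
    exact ContMDiffAt.comp (g := φ.symm) (γ₀, r γ₀) hsymm hw'
  refine ⟨fun z ↦ φ.symm (φ z.1 + A (ψ (φ z.1, κ z.2))), hσ, ?_, ?_, ?_⟩
  · have h1 : ∀ᶠ z : X × Y in 𝓝 (γ₀, r γ₀), φ z.1 + A (ψ (φ z.1, κ z.2)) ∈ φ.target := by
      apply hw'.continuousAt.eventually
      change _ ∈ 𝓝 (φ γ₀ + A (ψ (φ γ₀, κ (r γ₀))))
      rw [hw0]
      exact (isOpen_extChartAt_target γ₀).mem_nhds (mem_extChartAt_target γ₀)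
    have h2 : ∀ᶠ z : X × Y in 𝓝 (γ₀, r γ₀), z.2 ∈ κ.source :=
      continuousAt_snd.eventually (extChartAt_source_mem_nhds (r γ₀))
    have h3 : ∀ᶠ z : X × Y in 𝓝 (γ₀, r γ₀),
        r (φ.symm (φ z.1 + A (ψ (φ z.1, κ z.2)))) ∈ κ.source := by
      have hc : ContinuousAt (fun z : X × Y ↦ r (φ.symm (φ z.1 + A (ψ (φ z.1, κ z.2)))))
          (γ₀, r γ₀) := by
        refine ContinuousAt.comp (g := r) ?_ hσ.continuousAt
        change ContinuousAt r (φ.symm (φ γ₀ + A (ψ (φ γ₀, κ (r γ₀)))))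
        rw [hw0, extChartAt_to_inv]
        exact hr.continuousAt
      apply hc.eventually
      change _ ∈ 𝓝 (r (φ.symm (φ γ₀ + A (ψ (φ γ₀, κ (r γ₀))))))
      rw [hw0, extChartAt_to_inv]
      exact extChartAt_source_mem_nhds (r γ₀)
    filter_upwards [h1, h2, h3, hch.continuousAt.eventually hsol] with z hz1 hz2 hz3 hz4
    refine κ.injOn hz3 hz2 ?_
    rw [← hfφ _ (φ.map_target hz1), φ.right_inv hz1]
    exact hz4
  · filter_upwards [hφs.continuousAt.eventually hψr, extChartAt_source_mem_nhds (I := 𝓘(ℝ, E)) γ₀]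
      with γ hγ hγs
    rw [hfφ γ hγs] at hγ
    simp only [hγ, map_zero, add_zero]
    exact φ.left_inv hγs
  · have h1 := HasMD.comp (f := κ) (x := r γ₀) (hasMD_iff_hasFDerivAt.2 hψd) (hκs.hasMD (by simp))
    have h2 := HasMD.comp_of_eq (hasMD_extChartAt_symm (I := 𝓘(ℝ, E)) γ₀
      (mem_extChartAt_target γ₀)) h1 hw0
    have h3 := md_extChartAt_symm_comp (r γ₀) (mem_chart_source F (r γ₀))
    rw [md_extChartAt_symm_self, ContinuousLinearMap.id_comp] at h3
    rw [h3, md_extChartAt_symm_self] at h2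
    exact h2

end Sections

/-! ### Differential calculus on a Lie groupoid -/

namespace LieGroupoid

section Calculus

variable {E F G M : Type*}
  [NormedAddCommGroup E] [NormedSpace ℝ E] [NormedAddCommGroup F] [NormedSpace ℝ F]
  [TopologicalSpace G] [ChartedSpace E G] [TopologicalSpace M] [ChartedSpace F M]
  (𝒢 : LieGroupoid E F G M)

lemma contMDiff_src : ContMDiff 𝓘(ℝ, E) 𝓘(ℝ, F) ∞ 𝒢.src := 𝒢.isSubmersion_src.contMDiff

lemma contMDiff_rng : ContMDiff 𝓘(ℝ, E) 𝓘(ℝ, F) ∞ 𝒢.rng := 𝒢.isSubmersion_rng.contMDiff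

/-- The differential of the source map. -/
def dsrc (γ : G) : E →L[ℝ] F := md 𝓘(ℝ, E) 𝓘(ℝ, F) 𝒢.src γ

/-- The differential of the range map. -/
def drng (γ : G) : E →L[ℝ] F := md 𝓘(ℝ, E) 𝓘(ℝ, F) 𝒢.rng γ

/-- The differential of the unit map. -/
def dunit (x : M) : F →L[ℝ] E := md 𝓘(ℝ, F) 𝓘(ℝ, E) 𝒢.unit x

lemma hasMD_src (γ : G) : HasMD 𝓘(ℝ, E) 𝓘(ℝ, F) 𝒢.src γ (𝒢.dsrc γ) :=
  𝒢.contMDiff_src.contMDiffAt.hasMD (by simp)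

lemma hasMD_rng (γ : G) : HasMD 𝓘(ℝ, E) 𝓘(ℝ, F) 𝒢.rng γ (𝒢.drng γ) :=
  𝒢.contMDiff_rng.contMDiffAt.hasMD (by simp)

lemma hasMD_unit (x : M) : HasMD 𝓘(ℝ, F) 𝓘(ℝ, E) 𝒢.unit x (𝒢.dunit x) :=
  𝒢.contMDiff_unit.contMDiffAt.hasMD (by simp)

lemma inv_unit (x : M) : 𝒢.inv (𝒢.unit x) = 𝒢.unit x := by
  have h1 := 𝒢.inv_mul (𝒢.unit x)
  have h2 := 𝒢.mul_unit (𝒢.inv (𝒢.unit x))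
  rw [𝒢.src_inv, 𝒢.rng_unit] at h2
  rw [h2, 𝒢.src_unit] at h1
  exact h1

lemma dsrc_dunit (x : M) : (𝒢.dsrc (𝒢.unit x)).comp (𝒢.dunit x) = .id ℝ F :=
  ((𝒢.hasMD_src _).comp (𝒢.hasMD_unit x)).unique
    ((hasMD_id x).congr (Eventually.of_forall 𝒢.src_unit))

lemma drng_dunit (x : M) : (𝒢.drng (𝒢.unit x)).comp (𝒢.dunit x) = .id ℝ F :=
  ((𝒢.hasMD_rng _).comp (𝒢.hasMD_unit x)).unique
    ((hasMD_id x).congr (Eventually.of_forall 𝒢.rng_unit))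

variable {V H N : Type*} [NormedAddCommGroup V] [NormedSpace ℝ V] [TopologicalSpace H]
  [TopologicalSpace N] [ChartedSpace H N] {I : ModelWithCorners ℝ V H}

/-- The multiplication is smooth along composable pairs. -/
lemma contMDiffAt_mul {f₁ f₂ : N → G} {x : N} {n : WithTop ℕ∞} (hn : n ≤ ∞)
    (h₁ : ContMDiffAt I 𝓘(ℝ, E) n f₁ x) (h₂ : ContMDiffAt I 𝓘(ℝ, E) n f₂ x)
    (h : ∀ᶠ z in 𝓝 x, 𝒢.src (f₁ z) = 𝒢.rng (f₂ z)) :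
    ContMDiffAt I 𝓘(ℝ, E) n (fun z ↦ 𝒢.mul (f₁ z) (f₂ z)) x := by
  have hm := (𝒢.contMDiffOn_mul (f₁ x, f₂ x) h.self_of_nhds).of_le hn
  have hst : MapsTo (fun z ↦ (f₁ z, f₂ z)) {z | 𝒢.src (f₁ z) = 𝒢.rng (f₂ z)}
      {γ : G × G | 𝒢.src γ.1 = 𝒢.rng γ.2} := fun z hz ↦ hz
  exact (ContMDiffWithinAt.comp (f := fun z ↦ (f₁ z, f₂ z)) x hm
    (h₁.prodMk h₂).contMDiffWithinAt hst).contMDiffAt h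

/-- The chain rule for the multiplication along composable pairs. -/
lemma hasMD_mul {f₁ f₂ : N → G} {x : N} {A₁ A₂ : V →L[ℝ] E}
    (h₁ : HasMD I 𝓘(ℝ, E) f₁ x A₁) (h₂ : HasMD I 𝓘(ℝ, E) f₂ x A₂)
    (h : ∀ᶠ z in 𝓝 x, 𝒢.src (f₁ z) = 𝒢.rng (f₂ z)) :
    HasMD I 𝓘(ℝ, E) (fun z ↦ 𝒢.mul (f₁ z) (f₂ z)) x
      ((𝒢.dmul (f₁ x) (f₂ x)).comp (A₁.prod A₂)) := by
  -- The derivative of the multiplication within `G⁽²⁾` is used only on the image of `A₁.prod A₂`,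
  -- the velocities of a map into `G⁽²⁾`. There the chain rule determines it.
  have hm := ((𝒢.contMDiffOn_mul (f₁ x, f₂ x) h.self_of_nhds).mdifferentiableWithinAt
    (by simp)).hasMFDerivWithinAt
  have h12 : HasMFDerivWithinAt I (𝓘(ℝ, E).prod 𝓘(ℝ, E)) (fun z ↦ (f₁ z, f₂ z))
      {z | 𝒢.src (f₁ z) = 𝒢.rng (f₂ z)} x (A₁.prod A₂) :=
    HasMFDerivAt.hasMFDerivWithinAt (HasMD.prodMk h₁ h₂)
  have hst : {z | 𝒢.src (f₁ z) = 𝒢.rng (f₂ z)} ⊆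
      (fun z ↦ (f₁ z, f₂ z)) ⁻¹' {γ : G × G | 𝒢.src γ.1 = 𝒢.rng γ.2} := fun z hz ↦ hz
  exact (HasMFDerivWithinAt.comp (f := fun z ↦ (f₁ z, f₂ z)) x hm h12 hst).hasMFDerivAt h

end Calculus

end LieGroupoid

/-! ### Right inverses of the differentials of submersions -/

/-- In adapted charts `f` is a linear projection. Freezing the complementary coordinate at its value
at `x` gives a local section through `x`, and the derivative of that section is a right inverse. -/
lemma exists_rightInverse_of_isSubmersion {E F X Y : Type*}
    [NormedAddCommGroup E] [NormedSpace ℝ E] [NormedAddCommGroup F] [NormedSpace ℝ F]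
    [TopologicalSpace X] [ChartedSpace E X] [TopologicalSpace Y] [ChartedSpace F Y] {f : X → Y}
    (hf : IsSubmersion 𝓘(ℝ, E) 𝓘(ℝ, F) ∞ f) (x : X) :
    ∃ A : F →L[ℝ] E, (md 𝓘(ℝ, E) 𝓘(ℝ, F) f x).comp A = .id ℝ F := by
  have h := hf.isSubmersionAt x
  set φ := h.domChart.extend 𝓘(ℝ, E) with hφ
  set ψ := h.codChart.extend 𝓘(ℝ, F) with hψ
  have hxs : x ∈ φ.source := by rw [hφ, h.domChart.extend_source]; exact h.mem_domChart_source
  have hys : f x ∈ ψ.source := by rw [hψ, h.codChart.extend_source]; exact h.mem_codChart_source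
  set c := (h.equiv (φ x)).2
  set L : F → E := fun y ↦ h.equiv.symm (y, c) with hL
  have hψx : ψ (f x) = (h.equiv (φ x)).1 := by
    have := h.writtenInCharts (φ.map_source hxs)
    simp only [Function.comp_apply] at this
    rwa [φ.left_inv hxs] at this
  have hLx : L (ψ (f x)) = φ x := by
    rw [hL]
    simp only [hψx]
    exact h.equiv.symm_apply_apply (φ x)
  have hφo : IsOpen φ.target := h.domChart.isOpen_extend_target
  have hLs : ContMDiff 𝓘(ℝ, F) 𝓘(ℝ, E) ∞ L :=
    (h.equiv.symm.contDiff.comp (by fun_prop : ContDiff ℝ ∞ fun y : F ↦ (y, c))).contMDiff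
  have hψs : ContMDiffAt 𝓘(ℝ, F) 𝓘(ℝ, F) ∞ ψ (f x) :=
    h.codChart.contMDiffAt_extend h.codChart_mem_maximalAtlas h.mem_codChart_source
  have hsymm : ContMDiffAt 𝓘(ℝ, E) 𝓘(ℝ, E) ∞ φ.symm (L (ψ (f x))) := by
    rw [hLx]
    have := contMDiffOn_extend_symm h.domChart_mem_maximalAtlas
    refine (this (φ x) ⟨h.domChart x, h.domChart.map_source h.mem_domChart_source, rfl⟩).contMDiffAt
      ?_
    rw [modelWithCornersSelf_coe, image_id]
    exact h.domChart.open_target.mem_nhds (h.domChart.map_source h.mem_domChart_source)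
  have hLψ : ContMDiffAt 𝓘(ℝ, F) 𝓘(ℝ, E) ∞ (fun y ↦ L (ψ y)) (f x) :=
    hLs.contMDiffAt.comp (f x) hψs
  have hρ : ContMDiffAt 𝓘(ℝ, F) 𝓘(ℝ, E) ∞ (fun y ↦ φ.symm (L (ψ y))) (f x) :=
    ContMDiffAt.comp (g := φ.symm) (f x) hsymm hLψ
  have hρx : φ.symm (L (ψ (f x))) = x := by rw [hLx, φ.left_inv hxs]
  have hfd : HasMD 𝓘(ℝ, E) 𝓘(ℝ, F) f x (md 𝓘(ℝ, E) 𝓘(ℝ, F) f x) :=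
    h.contMDiffAt.hasMD (by simp)
  refine ⟨_, (hfd.comp_of_eq (hρ.hasMD (by simp)) hρx).unique ((hasMD_id (f x)).congr ?_)⟩
  have h1 : ∀ᶠ y in 𝓝 (f x), L (ψ y) ∈ φ.target := by
    apply hLψ.continuousAt.eventually
    change _ ∈ 𝓝 (L (ψ (f x)))
    rw [hLx]
    exact hφo.mem_nhds (φ.map_source hxs)
  have h2 : ∀ᶠ y in 𝓝 (f x), y ∈ h.codChart.source :=
    h.codChart.open_source.mem_nhds h.mem_codChart_source
  filter_upwards [h1, h2] with y hy1 hy2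
  have hs : φ.symm (L (ψ y)) ∈ h.domChart.source := by
    have := φ.map_target hy1
    rwa [hφ, h.domChart.extend_source] at this
  refine ψ.injOn ?_ ?_ ?_
  · rw [hψ, h.codChart.extend_source]
    exact h.source_subset_preimage_source hs
  · rwa [hψ, h.codChart.extend_source]
  · have h3 := h.writtenInCharts hy1
    simp only [Function.comp_apply] at h3
    refine h3.trans ?_
    simp [hL]

namespace LieGroupoid

/-! ### The differential of the multiplication -/

section Multiplication

variable {E F G M : Type*}
  [NormedAddCommGroup E] [NormedSpace ℝ E] [NormedAddCommGroup F] [NormedSpace ℝ F]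
  [TopologicalSpace G] [ChartedSpace E G] [TopologicalSpace M] [ChartedSpace F M]
  (𝒢 : LieGroupoid E F G M)

lemma exists_dsrc_comp_eq_id (γ : G) : ∃ A : F →L[ℝ] E, (𝒢.dsrc γ).comp A = .id ℝ F :=
  exists_rightInverse_of_isSubmersion 𝒢.isSubmersion_src γ

lemma exists_drng_comp_eq_id (γ : G) : ∃ A : F →L[ℝ] E, (𝒢.drng γ).comp A = .id ℝ F :=
  exists_rightInverse_of_isSubmersion 𝒢.isSubmersion_rng γ

/-- The derivative of the identity `υ(r(γ)) γ = γ`. The other rules for `dmul` at units are obtained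
in the same way. -/
lemma dmul_dunit_left (γ : G) (t : E) :
    𝒢.dmul (𝒢.unit (𝒢.rng γ)) γ (𝒢.dunit (𝒢.rng γ) (𝒢.drng γ t), t) = t := by
  have h := (𝒢.hasMD_mul ((𝒢.hasMD_unit (𝒢.rng γ)).comp (𝒢.hasMD_rng γ)) (hasMD_id γ)
    (Eventually.of_forall fun z ↦ 𝒢.src_unit (𝒢.rng z))).unique
      ((hasMD_id γ).congr (Eventually.of_forall 𝒢.unit_mul))
  exact congrArg (fun A : E →L[ℝ] E ↦ A t) h

lemma dmul_dunit_right (γ : G) (t : E) :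
    𝒢.dmul γ (𝒢.unit (𝒢.src γ)) (t, 𝒢.dunit (𝒢.src γ) (𝒢.dsrc γ t)) = t := by
  have h := (𝒢.hasMD_mul (hasMD_id γ) ((𝒢.hasMD_unit (𝒢.src γ)).comp (𝒢.hasMD_src γ))
    (Eventually.of_forall fun z ↦ (𝒢.rng_unit (𝒢.src z)).symm)).unique
      ((hasMD_id γ).congr (Eventually.of_forall 𝒢.mul_unit))
  exact congrArg (fun A : E →L[ℝ] E ↦ A t) h

lemma dUnitSrc_eq (x : M) : 𝒢.dUnitSrc x = (𝒢.dunit x).comp (𝒢.dsrc (𝒢.unit x)) :=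
  (HasMD.comp_of_eq (𝒢.hasMD_unit x) (𝒢.hasMD_src (𝒢.unit x)) (𝒢.src_unit x)).md_eq

lemma algebroidProj_apply (x : M) (w : E) :
    𝒢.algebroidProj x w = w - 𝒢.dunit x (𝒢.dsrc (𝒢.unit x) w) := by
  rw [algebroidProj, dUnitSrc_eq]
  rfl

lemma dsrc_dunit_apply (x : M) (v : F) : 𝒢.dsrc (𝒢.unit x) (𝒢.dunit x v) = v :=
  congrArg (fun A : F →L[ℝ] F ↦ A v) (𝒢.dsrc_dunit x)

lemma drng_dunit_apply (x : M) (v : F) : 𝒢.drng (𝒢.unit x) (𝒢.dunit x v) = v :=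
  congrArg (fun A : F →L[ℝ] F ↦ A v) (𝒢.drng_dunit x)

lemma algebroidProj_dunit (x : M) (v : F) : 𝒢.algebroidProj x (𝒢.dunit x v) = 0 := by
  rw [algebroidProj_apply, dsrc_dunit_apply, sub_self]

lemma dsrc_algebroidProj (x : M) (w : E) : 𝒢.dsrc (𝒢.unit x) (𝒢.algebroidProj x w) = 0 := by
  rw [algebroidProj_apply, map_sub, dsrc_dunit_apply, sub_self]

/-- Right multiplication by a local section `ρ` of the range map. -/
lemma hasMD_mul_section {γ₁ : G} {ρ : M → G} {B : F →L[ℝ] E}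
    (hρ : HasMD 𝓘(ℝ, F) 𝓘(ℝ, E) ρ (𝒢.src γ₁) B) (hr : ∀ᶠ x in 𝓝 (𝒢.src γ₁), 𝒢.rng (ρ x) = x) :
    HasMD 𝓘(ℝ, E) 𝓘(ℝ, E) (fun g ↦ 𝒢.mul g (ρ (𝒢.src g))) γ₁
      ((𝒢.dmul γ₁ (ρ (𝒢.src γ₁))).comp ((ContinuousLinearMap.id ℝ E).prod (B.comp (𝒢.dsrc γ₁)))) :=
  𝒢.hasMD_mul (hasMD_id γ₁) (hρ.comp (𝒢.hasMD_src γ₁)) ((𝒢.hasMD_src γ₁).continuousAt.eventually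
    (hr.mono fun _ hx ↦ hx.symm))

lemma dmul_dunit_section {γ : G} {ρ : M → G} {B : F →L[ℝ] E}
    (hρ : HasMD 𝓘(ℝ, F) 𝓘(ℝ, E) ρ (𝒢.rng γ) B) (hr : ∀ᶠ x in 𝓝 (𝒢.rng γ), 𝒢.rng (ρ x) = x)
    (hργ : ρ (𝒢.rng γ) = γ) (v : F) :
    𝒢.dmul (𝒢.unit (𝒢.rng γ)) γ (𝒢.dunit (𝒢.rng γ) v, B v) = B v := by
  have h := (𝒢.hasMD_mul (𝒢.hasMD_unit (𝒢.rng γ)) hρ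
    (hr.mono fun x hx ↦ by rw [𝒢.src_unit, hx])).unique (hρ.congr
      (hr.mono fun x hx ↦ by have := 𝒢.unit_mul (ρ x); rwa [hx] at this))
  rw [hργ] at h
  exact congrArg (fun A : F →L[ℝ] E ↦ A v) h

lemma dmul_section_dunit {γ : G} {τ : M → G} {B : F →L[ℝ] E}
    (hτ : HasMD 𝓘(ℝ, F) 𝓘(ℝ, E) τ (𝒢.src γ) B) (hs : ∀ᶠ x in 𝓝 (𝒢.src γ), 𝒢.src (τ x) = x)
    (hτγ : τ (𝒢.src γ) = γ) (v : F) :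
    𝒢.dmul γ (𝒢.unit (𝒢.src γ)) (B v, 𝒢.dunit (𝒢.src γ) v) = B v := by
  have h := (𝒢.hasMD_mul hτ (𝒢.hasMD_unit (𝒢.src γ))
    (hs.mono fun x hx ↦ by rw [𝒢.rng_unit, hx])).unique (hτ.congr
      (hs.mono fun x hx ↦ by have := 𝒢.mul_unit (τ x); rwa [hx] at this))
  rw [hτγ] at h
  exact congrArg (fun A : F →L[ℝ] E ↦ A v) h

/-- The differential of right multiplication by `γ` in terms of a section through `γ`. -/
lemma dRightMul_comp_algebroidProj {γ : G} {ρ : M → G} {B : F →L[ℝ] E}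
    (hρ : HasMD 𝓘(ℝ, F) 𝓘(ℝ, E) ρ (𝒢.rng γ) B) (hr : ∀ᶠ x in 𝓝 (𝒢.rng γ), 𝒢.rng (ρ x) = x)
    (hργ : ρ (𝒢.rng γ) = γ) :
    (𝒢.dRightMul γ).comp (𝒢.algebroidProj (𝒢.rng γ)) =
      md 𝓘(ℝ, E) 𝓘(ℝ, E) (fun g ↦ 𝒢.mul g (ρ (𝒢.src g))) (𝒢.unit (𝒢.rng γ)) -
        md 𝓘(ℝ, E) 𝓘(ℝ, E) (fun g ↦ ρ (𝒢.src g)) (𝒢.unit (𝒢.rng γ)) := by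
  have hρ' := hρ
  have hr' := hr
  rw [← 𝒢.src_unit (𝒢.rng γ)] at hρ' hr'
  have h1 := (𝒢.hasMD_mul_section hρ' hr').md_eq
  have h2 := (hρ'.comp (𝒢.hasMD_src _)).md_eq
  have h3 : (fun g ↦ ρ (𝒢.src g)) = ρ ∘ 𝒢.src := rfl
  rw [h1, h3, h2, 𝒢.src_unit, hργ]
  refine ContinuousLinearMap.ext fun w ↦ ?_
  set D := 𝒢.dmul (𝒢.unit (𝒢.rng γ)) γ
  set v := 𝒢.dsrc (𝒢.unit (𝒢.rng γ)) w
  change D (𝒢.algebroidProj (𝒢.rng γ) w, 0) = D (w, B v) - B v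
  -- The vector `(X, 0)` tangent to `G⁽²⁾` is a difference of two vectors tangent to `G⁽²⁾` on which
  -- `dmul` is the derivative of an actual map. This expresses `dR_γ` through derivatives of smooth
  -- maps defined near the unit.
  have h4 : (𝒢.algebroidProj (𝒢.rng γ) w, (0 : E)) =
      (w, B v) - (𝒢.dunit (𝒢.rng γ) v, B v) := by
    rw [algebroidProj_apply, Prod.mk_sub_mk, sub_self]
  rw [h4, map_sub, 𝒢.dmul_dunit_section hρ hr hργ]

/-- The differential of the inversion. -/
lemma hasMD_inv (γ : G) : HasMD 𝓘(ℝ, E) 𝓘(ℝ, E) 𝒢.inv γ (md 𝓘(ℝ, E) 𝓘(ℝ, E) 𝒢.inv γ) :=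
  𝒢.contMDiff_inv.contMDiffAt.hasMD (by simp)

lemma hasMD_inv_unit (x : M) : HasMD 𝓘(ℝ, E) 𝓘(ℝ, E) 𝒢.inv (𝒢.unit x) (𝒢.dinv x) :=
  𝒢.hasMD_inv (𝒢.unit x)

lemma dinv_dunit (x : M) (v : F) : 𝒢.dinv x (𝒢.dunit x v) = 𝒢.dunit x v := by
  have h := ((𝒢.hasMD_inv_unit x).comp (𝒢.hasMD_unit x)).unique
    ((𝒢.hasMD_unit x).congr (Eventually.of_forall 𝒢.inv_unit))
  exact congrArg (fun A : F →L[ℝ] E ↦ A v) h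

/-- The differential of `L_γ ∘ ι` in terms of a section of the source map through `γ`. -/
lemma dLeftMul_comp_dinv_comp_algebroidProj {γ : G} {τ : M → G} {B : F →L[ℝ] E}
    (hτ : HasMD 𝓘(ℝ, F) 𝓘(ℝ, E) τ (𝒢.src γ) B) (hs : ∀ᶠ x in 𝓝 (𝒢.src γ), 𝒢.src (τ x) = x)
    (hτγ : τ (𝒢.src γ) = γ) :
    (𝒢.dLeftMul γ).comp ((𝒢.dinv (𝒢.src γ)).comp (𝒢.algebroidProj (𝒢.src γ))) =
      md 𝓘(ℝ, E) 𝓘(ℝ, E) (fun g ↦ 𝒢.mul (τ (𝒢.src g)) (𝒢.inv g)) (𝒢.unit (𝒢.src γ)) -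
        md 𝓘(ℝ, E) 𝓘(ℝ, E) (fun g ↦ τ (𝒢.src g)) (𝒢.unit (𝒢.src γ)) := by
  have hτ' := hτ
  have hs' := hs
  rw [← 𝒢.src_unit (𝒢.src γ)] at hτ' hs'
  have h2 := hτ'.comp (𝒢.hasMD_src _)
  have h1 := (𝒢.hasMD_mul h2 (𝒢.hasMD_inv_unit (𝒢.src γ)) (by
    filter_upwards [(𝒢.hasMD_src _).continuousAt.eventually hs'] with g hg
    rw [Function.comp_apply, hg, 𝒢.rng_inv])).md_eq
  have h3 : (fun g ↦ τ (𝒢.src g)) = τ ∘ 𝒢.src := rfl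
  simp only [Function.comp_apply] at h1
  rw [h1, h3, h2.md_eq, 𝒢.src_unit, hτγ, 𝒢.inv_unit]
  refine ContinuousLinearMap.ext fun w ↦ ?_
  set D := 𝒢.dmul γ (𝒢.unit (𝒢.src γ))
  set v := 𝒢.dsrc (𝒢.unit (𝒢.src γ)) w
  change D (0, 𝒢.dinv (𝒢.src γ) (𝒢.algebroidProj (𝒢.src γ) w)) =
    D (B v, 𝒢.dinv (𝒢.src γ) w) - B v
  have h4 : ((0 : E), 𝒢.dinv (𝒢.src γ) (𝒢.algebroidProj (𝒢.src γ) w)) =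
      (B v, 𝒢.dinv (𝒢.src γ) w) - (B v, 𝒢.dunit (𝒢.src γ) v) := by
    rw [algebroidProj_apply, map_sub, dinv_dunit, Prod.mk_sub_mk, sub_self]
  rw [h4, map_sub, 𝒢.dmul_section_dunit hτ hs hτγ]

/-- The differential of the inversion at a unit. -/
lemma dinv_apply (x : M) (w : E) :
    𝒢.dinv x w = 𝒢.dunit x (𝒢.drng (𝒢.unit x) w) - w + 𝒢.dunit x (𝒢.dsrc (𝒢.unit x) w) := by
  have h1 := (𝒢.hasMD_mul (hasMD_id (𝒢.unit x)) (𝒢.hasMD_inv_unit x)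
    (Eventually.of_forall fun g ↦ (𝒢.rng_inv g).symm)).unique ((HasMD.comp_of_eq (𝒢.hasMD_unit x)
      (𝒢.hasMD_rng (𝒢.unit x)) (𝒢.rng_unit x)).congr (Eventually.of_forall 𝒢.mul_inv))
  have h2 := congrArg (fun A : E →L[ℝ] E ↦ A w) h1
  have hr : 𝒢.drng (𝒢.unit x) (𝒢.dinv x w) = 𝒢.dsrc (𝒢.unit x) w := by
    have h := ((𝒢.hasMD_rng _).comp_of_eq (𝒢.hasMD_inv_unit x) (𝒢.inv_unit x)).unique
      ((𝒢.hasMD_src _).congr (Eventually.of_forall 𝒢.rng_inv))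
    exact congrArg (fun A : E →L[ℝ] F ↦ A w) h
  simp only [𝒢.inv_unit, id_eq] at h2
  change 𝒢.dmul (𝒢.unit x) (𝒢.unit x) (w, 𝒢.dinv x w) = 𝒢.dunit x (𝒢.drng (𝒢.unit x) w) at h2
  have h3 := 𝒢.dmul_dunit_right (𝒢.unit x) w
  have h4 := 𝒢.dmul_dunit_left (𝒢.unit x) (𝒢.dinv x w)
  have h5 := 𝒢.dmul_dunit_left (𝒢.unit x) (𝒢.dunit x (𝒢.dsrc (𝒢.unit x) w))
  rw [𝒢.src_unit] at h3
  rw [𝒢.rng_unit] at h4 h5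
  rw [drng_dunit_apply] at h5
  rw [hr] at h4
  set v := 𝒢.dsrc (𝒢.unit x) w
  -- The pair is decomposed into pairs with a component tangent to the units, on which `dmul` is
  -- known; then `g ι(g) = υ(r(g))` is solved for the derivative of `ι`.
  have e : (w, 𝒢.dinv x w) = (w, 𝒢.dunit x v) + ((𝒢.dunit x v, 𝒢.dinv x w) -
      (𝒢.dunit x v, 𝒢.dunit x v)) := by ext <;> simp
  rw [e, map_add, map_sub, h3, h4, h5] at h2
  rw [← h2]
  abel

end Multiplication

end LieGroupoid

/-! ### The range and source maps of the cotangent groupoid -/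

namespace LieGroupoid

section CotangentGroupoid

variable {E F G M : Type*}
  [NormedAddCommGroup E] [NormedSpace ℝ E] [NormedAddCommGroup F] [NormedSpace ℝ F]
  [TopologicalSpace G] [ChartedSpace E G] [TopologicalSpace M] [ChartedSpace F M]
  (𝒢 : LieGroupoid E F G M)

lemma cotRng_eq (δ : CotangentBundle E G) : 𝒢.cotRng δ = cotMk (𝒢.unit (𝒢.rng δ.1))
    (δ.form.comp ((𝒢.dRightMul δ.1).comp (𝒢.algebroidProj (𝒢.rng δ.1)))) := rfl

lemma cotSrc_eq (δ : CotangentBundle E G) : 𝒢.cotSrc δ = cotMk (𝒢.unit (𝒢.src δ.1))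
    (-(δ.form.comp ((𝒢.dLeftMul δ.1).comp
      ((𝒢.dinv (𝒢.src δ.1)).comp (𝒢.algebroidProj (𝒢.src δ.1)))))) := rfl

lemma mem_dualAlgebroid_iff (δ : CotangentBundle E G) : δ ∈ 𝒢.dualAlgebroid ↔
    ∃ x : M, δ.1 = 𝒢.unit x ∧ δ.form.comp (𝒢.dunit x) = 0 :=
  exists_congr fun _ ↦ and_congr_right fun _ ↦
    ⟨fun h ↦ ContinuousLinearMap.ext fun w ↦ h w, fun h w ↦
      congrArg (fun A : F →L[ℝ] ℝ ↦ A w) h⟩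

lemma cotRng_mem (δ : CotangentBundle E G) : 𝒢.cotRng δ ∈ 𝒢.dualAlgebroid := by
  rw [mem_dualAlgebroid_iff, cotRng_eq]
  refine ⟨𝒢.rng δ.1, rfl, ContinuousLinearMap.ext fun w ↦ ?_⟩
  change δ.form (𝒢.dRightMul δ.1 (𝒢.algebroidProj (𝒢.rng δ.1) (𝒢.dunit (𝒢.rng δ.1) w))) = 0
  rw [algebroidProj_dunit, map_zero, map_zero]

lemma cotSrc_mem (δ : CotangentBundle E G) : 𝒢.cotSrc δ ∈ 𝒢.dualAlgebroid := by
  rw [mem_dualAlgebroid_iff, cotSrc_eq]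
  refine ⟨𝒢.src δ.1, rfl, ContinuousLinearMap.ext fun w ↦ ?_⟩
  change -δ.form (𝒢.dLeftMul δ.1 (𝒢.dinv (𝒢.src δ.1)
    (𝒢.algebroidProj (𝒢.src δ.1) (𝒢.dunit (𝒢.src δ.1) w)))) = 0
  rw [algebroidProj_dunit, map_zero, map_zero, map_zero, neg_zero]

lemma cotRng_of_mem {δ : CotangentBundle E G} (hδ : δ ∈ 𝒢.dualAlgebroid) : 𝒢.cotRng δ = δ := by
  obtain ⟨x, hx, hξ⟩ := (𝒢.mem_dualAlgebroid_iff δ).1 hδ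
  refine CotangentBundle.ext_form ?_ ?_
  · change 𝒢.unit (𝒢.rng δ.1) = δ.1
    rw [hx, 𝒢.rng_unit]
  · change δ.form.comp ((𝒢.dRightMul δ.1).comp (𝒢.algebroidProj (𝒢.rng δ.1))) = δ.form
    rw [hx, 𝒢.dRightMul_comp_algebroidProj (γ := 𝒢.unit x) (ρ := 𝒢.unit) (𝒢.hasMD_unit _)
      (Eventually.of_forall 𝒢.rng_unit) (by rw [𝒢.rng_unit]), 𝒢.rng_unit]
    have h1 : md 𝓘(ℝ, E) 𝓘(ℝ, E) (fun g ↦ 𝒢.mul g (𝒢.unit (𝒢.src g))) (𝒢.unit x) = .id ℝ E :=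
      ((hasMD_id _).congr (Eventually.of_forall 𝒢.mul_unit)).md_eq
    have h2 : md 𝓘(ℝ, E) 𝓘(ℝ, E) (fun g ↦ 𝒢.unit (𝒢.src g)) (𝒢.unit x) =
      (𝒢.dunit x).comp (𝒢.dsrc (𝒢.unit x)) := 𝒢.dUnitSrc_eq x
    rw [h1, h2, ContinuousLinearMap.comp_sub, ← ContinuousLinearMap.comp_assoc, hξ,
      ContinuousLinearMap.zero_comp, sub_zero, ContinuousLinearMap.comp_id]

/-- This is where the sign in `s_Γ` matters: on `ker ds` at a unit, `dι` is `-1` modulo the tangent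
space of the units, which the covector annihilates. -/
lemma cotSrc_of_mem {δ : CotangentBundle E G} (hδ : δ ∈ 𝒢.dualAlgebroid) : 𝒢.cotSrc δ = δ := by
  obtain ⟨x, hx, hξ⟩ := (𝒢.mem_dualAlgebroid_iff δ).1 hδ
  refine CotangentBundle.ext_form ?_ ?_
  · change 𝒢.unit (𝒢.src δ.1) = δ.1
    rw [hx, 𝒢.src_unit]
  · change -(δ.form.comp ((𝒢.dLeftMul δ.1).comp
      ((𝒢.dinv (𝒢.src δ.1)).comp (𝒢.algebroidProj (𝒢.src δ.1))))) = δ.form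
    have h0 : 𝒢.unit (𝒢.src (𝒢.unit x)) = 𝒢.unit x := by rw [𝒢.src_unit]
    rw [hx, 𝒢.dLeftMul_comp_dinv_comp_algebroidProj (γ := 𝒢.unit x) (τ := 𝒢.unit) (𝒢.hasMD_unit _)
      (Eventually.of_forall 𝒢.src_unit) h0, 𝒢.src_unit]
    have h1 : md 𝓘(ℝ, E) 𝓘(ℝ, E) (fun g ↦ 𝒢.mul (𝒢.unit (𝒢.src g)) (𝒢.inv g)) (𝒢.unit x) =
        𝒢.dinv x := by
      refine ((𝒢.hasMD_inv_unit x).congr (Eventually.of_forall fun g ↦ ?_)).md_eq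
      have := 𝒢.unit_mul (𝒢.inv g)
      rwa [𝒢.rng_inv] at this
    have h2 : md 𝓘(ℝ, E) 𝓘(ℝ, E) (fun g ↦ 𝒢.unit (𝒢.src g)) (𝒢.unit x) =
      (𝒢.dunit x).comp (𝒢.dsrc (𝒢.unit x)) := 𝒢.dUnitSrc_eq x
    have hξ' : ∀ v, δ.form (𝒢.dunit x v) = 0 := fun v ↦ congrArg (fun A : F →L[ℝ] ℝ ↦ A v) hξ
    rw [h1, h2]
    refine ContinuousLinearMap.ext fun w ↦ ?_
    change -δ.form (𝒢.dinv x w - 𝒢.dunit x (𝒢.dsrc (𝒢.unit x) w)) = δ.form w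
    rw [dinv_apply, map_sub, map_add, map_sub, hξ', hξ']
    ring

lemma cotRng_dilation (a : ℝ) (δ : CotangentBundle E G) :
    𝒢.cotRng (dilation a δ) = dilation a (𝒢.cotRng δ) := rfl

lemma mem_kerCotRng_iff (δ : CotangentBundle E G) : δ ∈ 𝒢.kerCotRng ↔ (𝒢.cotRng δ).form = 0 :=
  Iff.rfl

lemma mem_kerCotSrc_iff (δ : CotangentBundle E G) : δ ∈ 𝒢.kerCotSrc ↔ (𝒢.cotSrc δ).form = 0 :=
  Iff.rfl

lemma cotRng_mem_nonzero {δ : CotangentBundle E G} (hδ : δ ∈ 𝒢.kerCotRngᶜ) :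
    𝒢.cotRng δ ∈ 𝒢.dualAlgebroidNonzero :=
  ⟨𝒢.cotRng_mem δ, hδ⟩

lemma cotSrc_mem_nonzero {δ : CotangentBundle E G} (hδ : δ ∉ 𝒢.kerCotSrc) :
    𝒢.cotSrc δ ∈ 𝒢.dualAlgebroidNonzero :=
  ⟨𝒢.cotSrc_mem δ, hδ⟩

lemma notMem_kerCotRng {δ : CotangentBundle E G} (hδ : δ ∈ 𝒢.dualAlgebroidNonzero) :
    δ ∈ 𝒢.kerCotRngᶜ := by
  intro h
  rw [mem_kerCotRng_iff, 𝒢.cotRng_of_mem hδ.1] at h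
  exact hδ.2 h

lemma notMem_kerCotSrc {δ : CotangentBundle E G} (hδ : δ ∈ 𝒢.dualAlgebroidNonzero) :
    δ ∉ 𝒢.kerCotSrc := by
  intro h
  rw [mem_kerCotSrc_iff, 𝒢.cotSrc_of_mem hδ.1] at h
  exact hδ.2 h

lemma form_ne_zero_of_mem {δ : CotangentBundle E G} (hδ : δ ∈ 𝒢.kerCotRngᶜ) : δ.form ≠ 0 := by
  intro h
  refine hδ ?_
  rw [mem_kerCotRng_iff, cotRng_eq, h]
  exact ContinuousLinearMap.zero_comp _

end CotangentGroupoid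

/-! ### Smoothness of `r_Γ` and `s_Γ`, and Euler's relation for `p₀ ∘ r_Γ`. -/

section Smoothness

variable {E F G M : Type*}
  [NormedAddCommGroup E] [NormedSpace ℝ E] [FiniteDimensional ℝ E]
  [NormedAddCommGroup F] [NormedSpace ℝ F] [FiniteDimensional ℝ F]
  [TopologicalSpace G] [ChartedSpace E G] [IsManifold 𝓘(ℝ, E) ∞ G]
  [TopologicalSpace M] [ChartedSpace F M] [IsManifold 𝓘(ℝ, F) ∞ M]

omit [FiniteDimensional ℝ E] [FiniteDimensional ℝ F] in
/-- The consequences of `exists_section` at the points near the base point. -/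
lemma eventually_section {r : G → M} {γ₀ : G} {σ : G × M → G}
    (hr : ContinuousAt r γ₀)
    (hσ : ContMDiffAt (𝓘(ℝ, E).prod 𝓘(ℝ, F)) 𝓘(ℝ, E) ∞ σ (γ₀, r γ₀))
    (hrσ : ∀ᶠ z in 𝓝 (γ₀, r γ₀), r (σ z) = z.2) :
    ∀ᶠ γ in 𝓝 γ₀, (∀ᶠ x in 𝓝 (r γ), r (σ (γ, x)) = x) ∧
      MDifferentiableAt 𝓘(ℝ, F) 𝓘(ℝ, E) (fun x ↦ σ (γ, x)) (r γ) := by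
  have hc : ContinuousAt (fun γ ↦ (γ, r γ)) γ₀ := continuousAt_id.prodMk hr
  filter_upwards [hc.eventually hrσ.eventually_nhds,
    hc.eventually (hσ.eventually_mdifferentiableAt (by simp))] with γ h1 h2
  have hs : ContMDiffAt 𝓘(ℝ, F) (𝓘(ℝ, E).prod 𝓘(ℝ, F)) 1 (fun x ↦ (γ, x)) (r γ) :=
    contMDiffAt_const.prodMk contMDiffAt_id
  refine ⟨?_, ?_⟩
  · have hc' : ContinuousAt (fun x : M ↦ (γ, x)) (r γ) := hs.continuousAt
    exact hc'.eventually h1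
  · exact MDifferentiableAt.comp (r γ) h2 (hs.mdifferentiableAt (by simp))

variable (𝒢 : LieGroupoid E F G M)

/-- With sections `σ (γ, ·)` of `r` through `γ`, depending smoothly on `γ`, the covector of `r_Γ(γ,
ξ)` is the difference of the pullbacks of `ξ` by `g ↦ g σ(γ, s(g))` and `g ↦ σ(γ, s(g))`. Both are
smooth families of pullbacks. For `s_Γ` sections of `s` are used instead. -/
theorem contMDiff_cotRng : ContMDiff (cotangentModel E) (cotangentModel E) ∞ 𝒢.cotRng := by
  intro δ₀
  obtain ⟨A, hA⟩ := 𝒢.exists_drng_comp_eq_id δ₀.1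
  obtain ⟨σ, hσ, hrσ, hσγ, -⟩ := exists_section (𝒢.contMDiff_rng δ₀.1) hA
  have hπ : ContMDiff (cotangentModel E) 𝓘(ℝ, E) ∞ (fun δ : CotangentBundle E G ↦ δ.1) :=
    contMDiff_cotangent_proj
  have hbase : ContMDiffAt (cotangentModel E) 𝓘(ℝ, E) ∞
      (fun δ : CotangentBundle E G ↦ 𝒢.unit (𝒢.rng δ.1)) δ₀ :=
    ((𝒢.contMDiff_unit.comp 𝒢.contMDiff_rng).comp hπ).contMDiffAt
  have harg : ContMDiffAt ((cotangentModel E).prod 𝓘(ℝ, E)) (𝓘(ℝ, E).prod 𝓘(ℝ, F)) ∞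
      (fun z : CotangentBundle E G × G ↦ (z.1.1, 𝒢.src z.2)) (δ₀, 𝒢.unit (𝒢.rng δ₀.1)) :=
    ((hπ.comp contMDiff_fst).prodMk (𝒢.contMDiff_src.comp contMDiff_snd)).contMDiffAt
  have harg0 : (δ₀.1, 𝒢.src (𝒢.unit (𝒢.rng δ₀.1))) = (δ₀.1, 𝒢.rng δ₀.1) := by rw [𝒢.src_unit]
  have h2 : ContMDiffAt ((cotangentModel E).prod 𝓘(ℝ, E)) 𝓘(ℝ, E) ∞
      (fun z : CotangentBundle E G × G ↦ σ (z.1.1, 𝒢.src z.2)) (δ₀, 𝒢.unit (𝒢.rng δ₀.1)) :=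
    ContMDiffAt.comp_of_eq hσ harg harg0
  have h1 : ContMDiffAt ((cotangentModel E).prod 𝓘(ℝ, E)) 𝓘(ℝ, E) ∞
      (fun z : CotangentBundle E G × G ↦ 𝒢.mul z.2 (σ (z.1.1, 𝒢.src z.2)))
      (δ₀, 𝒢.unit (𝒢.rng δ₀.1)) := by
    refine 𝒢.contMDiffAt_mul le_rfl contMDiffAt_snd h2 ?_
    have := harg.continuousAt
    rw [ContinuousAt, harg0] at this
    filter_upwards [this.eventually hrσ] with z hz
    exact hz.symm
  have hσπ : ∀ᶠ δ : CotangentBundle E G in 𝓝 δ₀, σ (δ.1, 𝒢.rng δ.1) = δ.1 :=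
    hπ.continuous.continuousAt.eventually hσγ
  have hr := eventually_section 𝒢.contMDiff_rng.continuous.continuousAt hσ hrσ
  have c1 := ContMDiffAt.covector_comp (δ := id) (g := fun δ ↦ 𝒢.unit (𝒢.rng δ.1))
    (h := fun (δ : CotangentBundle E G) g ↦ 𝒢.mul g (σ (δ.1, 𝒢.src g)))
    contMDiffAt_id hbase h1 le_rfl (by
      filter_upwards [hσπ] with δ hδ
      rw [𝒢.src_unit, hδ, 𝒢.unit_mul]
      rfl)
  have c2 := ContMDiffAt.covector_comp (δ := id) (g := fun δ ↦ 𝒢.unit (𝒢.rng δ.1))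
    (h := fun (δ : CotangentBundle E G) g ↦ σ (δ.1, 𝒢.src g))
    contMDiffAt_id hbase h2 le_rfl (by
      filter_upwards [hσπ] with δ hδ
      rw [𝒢.src_unit, hδ]
      rfl)
  refine (c1.covector_add (c2.covector_smul (-1))).congr_of_eventuallyEq ?_
  filter_upwards [hσπ, hπ.continuous.continuousAt.eventually hr] with δ h3 h4
  rw [cotRng_eq, 𝒢.dRightMul_comp_algebroidProj (ρ := fun x ↦ σ (δ.1, x)) h4.2.hasMD h4.1 h3,
    ContinuousLinearMap.comp_sub]
  exact congrArg (cotMk _) (ContinuousLinearMap.ext fun w ↦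
    (sub_eq_add_neg _ _).trans (congrArg _ (neg_one_mul _).symm))

theorem contMDiff_cotSrc : ContMDiff (cotangentModel E) (cotangentModel E) ∞ 𝒢.cotSrc := by
  intro δ₀
  obtain ⟨A, hA⟩ := 𝒢.exists_dsrc_comp_eq_id δ₀.1
  obtain ⟨τ, hτ, hsτ, hτγ, -⟩ := exists_section (𝒢.contMDiff_src δ₀.1) hA
  have hπ : ContMDiff (cotangentModel E) 𝓘(ℝ, E) ∞ (fun δ : CotangentBundle E G ↦ δ.1) :=
    contMDiff_cotangent_proj
  have hbase : ContMDiffAt (cotangentModel E) 𝓘(ℝ, E) ∞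
      (fun δ : CotangentBundle E G ↦ 𝒢.unit (𝒢.src δ.1)) δ₀ :=
    ((𝒢.contMDiff_unit.comp 𝒢.contMDiff_src).comp hπ).contMDiffAt
  have harg : ContMDiffAt ((cotangentModel E).prod 𝓘(ℝ, E)) (𝓘(ℝ, E).prod 𝓘(ℝ, F)) ∞
      (fun z : CotangentBundle E G × G ↦ (z.1.1, 𝒢.src z.2)) (δ₀, 𝒢.unit (𝒢.src δ₀.1)) :=
    ((hπ.comp contMDiff_fst).prodMk (𝒢.contMDiff_src.comp contMDiff_snd)).contMDiffAt
  have harg0 : (δ₀.1, 𝒢.src (𝒢.unit (𝒢.src δ₀.1))) = (δ₀.1, 𝒢.src δ₀.1) := by rw [𝒢.src_unit]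
  have h2 : ContMDiffAt ((cotangentModel E).prod 𝓘(ℝ, E)) 𝓘(ℝ, E) ∞
      (fun z : CotangentBundle E G × G ↦ τ (z.1.1, 𝒢.src z.2)) (δ₀, 𝒢.unit (𝒢.src δ₀.1)) :=
    ContMDiffAt.comp_of_eq hτ harg harg0
  have h1 : ContMDiffAt ((cotangentModel E).prod 𝓘(ℝ, E)) 𝓘(ℝ, E) ∞
      (fun z : CotangentBundle E G × G ↦ 𝒢.mul (τ (z.1.1, 𝒢.src z.2)) (𝒢.inv z.2))
      (δ₀, 𝒢.unit (𝒢.src δ₀.1)) := by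
    refine 𝒢.contMDiffAt_mul le_rfl h2 (𝒢.contMDiff_inv.comp contMDiff_snd).contMDiffAt ?_
    have := harg.continuousAt
    rw [ContinuousAt, harg0] at this
    filter_upwards [this.eventually hsτ] with z hz
    rw [hz]
    exact (𝒢.rng_inv _).symm
  have hτπ : ∀ᶠ δ : CotangentBundle E G in 𝓝 δ₀, τ (δ.1, 𝒢.src δ.1) = δ.1 :=
    hπ.continuous.continuousAt.eventually hτγ
  have hs := eventually_section 𝒢.contMDiff_src.continuous.continuousAt hτ hsτ
  have c1 := ContMDiffAt.covector_comp (δ := id) (g := fun δ ↦ 𝒢.unit (𝒢.src δ.1))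
    (h := fun (δ : CotangentBundle E G) g ↦ 𝒢.mul (τ (δ.1, 𝒢.src g)) (𝒢.inv g))
    contMDiffAt_id hbase h1 le_rfl (by
      filter_upwards [hτπ] with δ hδ
      rw [𝒢.src_unit, hδ, 𝒢.inv_unit, 𝒢.mul_unit]
      rfl)
  have c2 := ContMDiffAt.covector_comp (δ := id) (g := fun δ ↦ 𝒢.unit (𝒢.src δ.1))
    (h := fun (δ : CotangentBundle E G) g ↦ τ (δ.1, 𝒢.src g))
    contMDiffAt_id hbase h2 le_rfl (by
      filter_upwards [hτπ] with δ hδ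
      rw [𝒢.src_unit, hδ]
      rfl)
  refine ((c1.covector_smul (-1)).covector_add c2).congr_of_eventuallyEq ?_
  filter_upwards [hτπ, hπ.continuous.continuousAt.eventually hs] with δ h3 h4
  rw [cotSrc_eq, 𝒢.dLeftMul_comp_dinv_comp_algebroidProj (τ := fun x ↦ τ (δ.1, x)) h4.2.hasMD
    h4.1 h3, ContinuousLinearMap.comp_sub, neg_sub, sub_eq_add_neg, add_comm]
  exact congrArg (cotMk _) (ContinuousLinearMap.ext fun w ↦
    congrArg₂ (fun a b : ℝ ↦ a + b) (neg_one_mul _).symm rfl)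

omit [FiniteDimensional ℝ E] in
lemma _root_.isOpen_form_ne_zero : IsOpen {δ : CotangentBundle E G | δ.form ≠ 0} := by
  rw [isOpen_iff_mem_nhds]
  intro δ₀ hδ₀
  have h := (contMDiffAt_cotangent_iff.1
    (contMDiffAt_id (I := cotangentModel E) (n := 0) (x := δ₀))).2.continuousAt
  have h0 : cotCoord (id δ₀ : CotangentBundle E G).1 (id δ₀) ≠ 0 := by
    rw [id, ← cotMk_self δ₀, cotMk_proj, cotCoord_self]
    exact hδ₀
  filter_upwards [h.eventually_ne h0] with δ hδ hzero
  refine hδ ?_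
  rw [cotCoord, id, hzero, ContinuousLinearMap.zero_comp]

lemma isOpen_compl_kerCotRng : IsOpen 𝒢.kerCotRngᶜ :=
  isOpen_form_ne_zero.preimage 𝒢.contMDiff_cotRng.continuous

lemma isOpen_compl_kerCotSrc : IsOpen 𝒢.kerCotSrcᶜ :=
  isOpen_form_ne_zero.preimage 𝒢.contMDiff_cotSrc.continuous

variable {𝒢} {p₀ : CotangentBundle E G → ℝ}

lemma IsHomogeneousSymbol.contMDiffOn_comp (hp₀ : 𝒢.IsHomogeneousSymbol p₀) :
    ContMDiffOn (cotangentModel E) 𝓘(ℝ, ℝ) ∞ (p₀ ∘ 𝒢.cotRng) 𝒢.kerCotRngᶜ :=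
  hp₀.contMDiffOn.comp 𝒢.contMDiff_cotRng.contMDiffOn fun _ hδ ↦ 𝒢.cotRng_mem_nonzero hδ

omit [FiniteDimensional ℝ E] [FiniteDimensional ℝ F] [IsManifold 𝓘(ℝ, F) ∞ M] in
lemma IsHomogeneousSymbol.comp_dilation (hp₀ : 𝒢.IsHomogeneousSymbol p₀) {a : ℝ} (ha : 0 < a)
    {δ : CotangentBundle E G} (hδ : δ ∈ 𝒢.kerCotRngᶜ) :
    (p₀ ∘ 𝒢.cotRng) (dilation a δ) = a * (p₀ ∘ 𝒢.cotRng) δ := by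
  rw [Function.comp_apply, 𝒢.cotRng_dilation]
  exact hp₀.homogeneous a ha _ (𝒢.cotRng_mem_nonzero hδ)

/-- Euler's relation. -/
lemma IsHomogeneousSymbol.canForm_hamVec (hp₀ : 𝒢.IsHomogeneousSymbol p₀)
    {δ : CotangentBundle E G} (hδ : δ ∈ 𝒢.kerCotRngᶜ) :
    canForm δ (hamVec (p₀ ∘ 𝒢.cotRng) δ) = (p₀ ∘ 𝒢.cotRng) δ := by
  set p := p₀ ∘ 𝒢.cotRng
  have hp := (hp₀.contMDiffOn_comp.contMDiffAt
    (𝒢.isOpen_compl_kerCotRng.mem_nhds hδ)).mdifferentiableAt (by simp)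
  -- The velocity of `a ↦ (γ, a ξ)` at `a = 1` is the vertical vector `(0, ξ)`. Pairing it with
  -- `H_p` by `ω` gives `ξ(dπ H_p) = α(H_p)` on one side, and on the other `dp(0, ξ)`, which is `p`
  -- by homogeneity.
  have h1 : symp (hamVec p δ) ((0 : E), δ.form) = canForm δ (hamVec p δ) := by
    simp [symp, canForm_apply]
  rw [← h1, symp_hamVec]
  have h2 : HasMD 𝓘(ℝ, ℝ) 𝓘(ℝ, E →L[ℝ] ℝ) (fun a : ℝ ↦ a • δ.form) 1
      ((1 : ℝ →L[ℝ] ℝ).smulRight δ.form) :=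
    hasMD_iff_hasFDerivAt.2 ((1 : ℝ →L[ℝ] ℝ).smulRight δ.form).hasFDerivAt
  have h3 : HasMD 𝓘(ℝ, E →L[ℝ] ℝ) (cotangentModel E) (cotMk δ.1) ((1 : ℝ) • δ.form)
      (.inr ℝ E (E →L[ℝ] ℝ)) := hasMD_cotMk δ.1 _
  have h4 := h3.comp_smulRight (c := fun a : ℝ ↦ a • δ.form) h2
  have h5 := HasMD.comp_smulRight (c := fun a : ℝ ↦ cotMk δ.1 (a • δ.form)) (t := 1)
    (f := p) (A := md (cotangentModel E) 𝓘(ℝ, ℝ) p δ) (by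
      rw [one_smul, cotMk_self]; exact hp.hasMD) h4
  have h6 : HasDerivAt (fun a : ℝ ↦ p (cotMk δ.1 (a • δ.form))) (p δ) 1 := by
    have : HasDerivAt (fun a : ℝ ↦ a * p δ) (1 * p δ) 1 := (hasDerivAt_id 1).mul_const _
    rw [one_mul] at this
    refine this.congr_of_eventuallyEq ?_
    filter_upwards [Ioi_mem_nhds (zero_lt_one : (0 : ℝ) < 1)] with a ha
    exact hp₀.comp_dilation ha hδ
  exact (hasMD_smulRight_iff.1 h5).unique h6

end Smoothness

end LieGroupoid

/-! ### Common right inverses, the inverse function theorem on manifolds -/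

/-- Two surjective linear maps `R`, `S` between finite-dimensional spaces: some right inverse `A` of
`R` is such that `S ∘ A` is bijective. -/
lemma exists_rightInverse_comp_bijective {K E F : Type*} [Field K] [AddCommGroup E] [Module K E]
    [AddCommGroup F] [Module K F] [FiniteDimensional K F]
    {R S : E →ₗ[K] F} (hR : Function.Surjective R) (hS : Function.Surjective S) :
    ∃ A : F →ₗ[K] E, (∀ v, R (A v) = v) ∧ Function.Bijective (S ∘ₗ A) := by
  obtain ⟨A₀, hA₀⟩ := R.exists_rightInverse_of_surjective (LinearMap.range_eq_top.2 hR)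
  have hRA : ∀ v, R (A₀ v) = v := fun v ↦ congrArg (fun B : F →ₗ[K] F ↦ B v) hA₀
  set I := (LinearMap.ker R).map S with hI
  set T : F →ₗ[K] F := S ∘ₗ A₀ with hT
  set N := LinearMap.ker (I.mkQ ∘ₗ T) with hN
  have hTN : ∀ v ∈ N, T v ∈ I := fun v hv ↦ (Submodule.Quotient.mk_eq_zero I).1 hv
  have hqT : Function.Surjective (I.mkQ ∘ₗ T) := by
    intro y
    obtain ⟨f, rfl⟩ := I.mkQ_surjective y
    obtain ⟨e, rfl⟩ := hS f
    refine ⟨R e, ?_⟩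
    have : S (A₀ (R e) - e) ∈ I :=
      Submodule.mem_map_of_mem (by rw [LinearMap.mem_ker, map_sub, hRA, sub_self])
    rw [map_sub] at this
    exact (Submodule.Quotient.eq I).2 this
  -- `T = S ∘ A₀` is surjective modulo `I = S(ker R)`, so the space `N` of vectors mapped into `I`
  -- has the dimension of `I`.
  have hdim : Module.finrank K N = Module.finrank K I := by
    have h1 := LinearMap.finrank_range_add_finrank_ker (I.mkQ ∘ₗ T)
    have h2 := Submodule.finrank_quotient_add_finrank I
    rw [LinearMap.range_eq_top.2 hqT, finrank_top, ← h2] at h1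
    exact Nat.add_left_cancel h1
  let j : N ≃ₗ[K] I := LinearEquiv.ofFinrankEq N I hdim
  let S' : LinearMap.ker R →ₗ[K] I := S.restrict fun x hx ↦ Submodule.mem_map_of_mem hx
  have hS' : Function.Surjective S' := by
    rintro ⟨y, x, hx, rfl⟩
    exact ⟨⟨x, hx⟩, rfl⟩
  obtain ⟨g, hg⟩ := S'.exists_rightInverse_of_surjective (LinearMap.range_eq_top.2 hS')
  have hSg : ∀ i, S (g i) = i := fun i ↦
    congrArg (fun B : I →ₗ[K] I ↦ (B i : F)) hg
  obtain ⟨C, hC⟩ := N.exists_isCompl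
  let TN : N →ₗ[K] I := T.restrict hTN
  -- A correction with values in `ker R` does not affect `R ∘ A₀`. It is chosen so that `S ∘ (A₀ +
  -- L)` is the isomorphism `j` on `N`, while modulo `I` it is still `T`; injectivity follows.
  let L : F →ₗ[K] E := (LinearMap.ker R).subtype ∘ₗ g ∘ₗ (j.toLinearMap - TN) ∘ₗ
    N.projectionOnto C hC
  have hRL : ∀ v, R (L v) = 0 := fun v ↦ (g ((j.toLinearMap - TN) (N.projectionOnto C hC v))).2
  have hinj : Function.Injective (S ∘ₗ (A₀ + L)) := by
    rw [injective_iff_map_eq_zero]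
    intro v hv
    set n := N.projectionOnto C hC v with hn
    have h1 : S (L v) = j n - T n := hSg _
    have h2 : T v + (j n - T n) = 0 := by
      rw [← h1]
      simpa [hT] using hv
    have h3 : T (v - n) + j n = 0 := by
      rw [map_sub, ← h2]
      abel
    have h4 : v - n ∈ N := by
      refine (Submodule.Quotient.mk_eq_zero I).2 ?_
      rw [eq_neg_of_add_eq_zero_left h3]
      exact I.neg_mem (j n).2
    have h5 : v ∈ N := by
      have := N.add_mem h4 n.2
      rwa [sub_add_cancel] at this
    have h6 : (n : F) = v := by rw [hn, Submodule.projectionOnto_apply_of_mem_left hC h5]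
    rw [h6, sub_self, map_zero, zero_add] at h3
    have h7 : n = 0 := j.map_eq_zero_iff.1 (Subtype.ext h3)
    rw [← h6, h7]
    rfl
  refine ⟨A₀ + L, fun v ↦ ?_, hinj, LinearMap.injective_iff_surjective.1 hinj⟩
  rw [LinearMap.add_apply, map_add, hRA, hRL, add_zero]

/-- The inverse function theorem for maps between manifolds. -/
lemma ContMDiffAt.exists_local_inverse {V W X Y : Type*} [NormedAddCommGroup V] [NormedSpace ℝ V]
    [FiniteDimensional ℝ V] [NormedAddCommGroup W] [NormedSpace ℝ W] [FiniteDimensional ℝ W]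
    [TopologicalSpace X] [ChartedSpace V X] [IsManifold 𝓘(ℝ, V) ∞ X]
    [TopologicalSpace Y] [ChartedSpace W Y] [IsManifold 𝓘(ℝ, W) ∞ Y] {b : X → Y} {x : X}
    (hb : ContMDiffAt 𝓘(ℝ, V) 𝓘(ℝ, W) ∞ b x)
    (hbij : Function.Bijective (md 𝓘(ℝ, V) 𝓘(ℝ, W) b x)) :
    ∃ κ : Y → X, ContMDiffAt 𝓘(ℝ, W) 𝓘(ℝ, V) ∞ κ (b x) ∧ (∀ᶠ y in 𝓝 x, κ (b y) = y) ∧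
      ∀ᶠ z in 𝓝 (b x), b (κ z) = z := by
  have : CompleteSpace V := FiniteDimensional.complete ℝ V
  have : CompleteSpace W := FiniteDimensional.complete ℝ W
  set φ := extChartAt 𝓘(ℝ, V) x with hφ
  set ψ := extChartAt 𝓘(ℝ, W) (b x) with hψ
  set f := writtenInExtChartAt 𝓘(ℝ, V) 𝓘(ℝ, W) x b with hf
  have hfs : ContDiffAt ℝ ∞ f (φ x) := hb.contDiffAt_writtenInExtChartAt
  have hfφ : ∀ y ∈ φ.source, f (φ y) = ψ (b y) := fun y hy ↦ by
    rw [hf, writtenInExtChartAt, Function.comp_apply, Function.comp_apply, φ.left_inv hy]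
  have hfx : f (φ x) = ψ (b x) := hfφ x (mem_extChartAt_source x)
  rw [md_eq_fderiv_writtenInExtChartAt (hb.mdifferentiableAt (by simp))] at hbij
  let e : V ≃L[ℝ] W := (LinearEquiv.ofBijective (fderiv ℝ f (φ x)).toLinearMap hbij).toContinuousLinearEquiv
  have he : HasFDerivAt f (e : V →L[ℝ] W) (φ x) := (hfs.differentiableAt (by simp)).hasFDerivAt
  have hst := hfs.hasStrictFDerivAt' he (by simp)
  set g := hfs.localInverse he (by simp) with hg
  have hgs : ContDiffAt ℝ ∞ g (f (φ x)) := hfs.to_localInverse he (by simp)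
  have hgx : g (f (φ x)) = φ x := hfs.localInverse_apply_image he (by simp)
  have hgl : ∀ᶠ y in 𝓝 (φ x), g (f y) = y := hst.eventually_left_inverse
  have hgr : ∀ᶠ z in 𝓝 (f (φ x)), f (g z) = z := hst.eventually_right_inverse
  rw [hfx] at hgs hgr hgx
  have hφc : ContinuousAt φ x := continuousAt_extChartAt x
  have hψs : ContMDiffAt 𝓘(ℝ, W) 𝓘(ℝ, W) ∞ ψ (b x) := contMDiffAt_extChartAt
  have hsymm : ContMDiffAt 𝓘(ℝ, V) 𝓘(ℝ, V) ∞ φ.symm (φ x) :=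
    (contMDiffOn_extChartAt_symm x).contMDiffAt
      ((isOpen_extChartAt_target x).mem_nhds (mem_extChartAt_target x))
  have hgψ : ContMDiffAt 𝓘(ℝ, W) 𝓘(ℝ, V) ∞ (fun z ↦ g (ψ z)) (b x) :=
    ContMDiffAt.comp (g := g) (b x) hgs.contMDiffAt hψs
  have hκ : ContMDiffAt 𝓘(ℝ, W) 𝓘(ℝ, V) ∞ (fun z ↦ φ.symm (g (ψ z))) (b x) :=
    ContMDiffAt.comp_of_eq hsymm hgψ hgx
  have hκx : φ.symm (g (ψ (b x))) = x := by rw [hgx]; exact extChartAt_to_inv x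
  refine ⟨fun z ↦ φ.symm (g (ψ z)), hκ, ?_, ?_⟩
  · filter_upwards [hφc.eventually hgl, extChartAt_source_mem_nhds (I := 𝓘(ℝ, V)) x] with y hy hys
    rw [← hfφ y hys, hy]
    exact φ.left_inv hys
  · have h1 : ∀ᶠ z in 𝓝 (b x), g (ψ z) ∈ φ.target := by
      apply hgψ.continuousAt.eventually
      change _ ∈ 𝓝 (g (ψ (b x)))
      rw [hgx]
      exact (isOpen_extChartAt_target x).mem_nhds (mem_extChartAt_target x)
    have h2 : ∀ᶠ z in 𝓝 (b x), b (φ.symm (g (ψ z))) ∈ ψ.source := by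
      have hc : ContinuousAt (fun z ↦ b (φ.symm (g (ψ z)))) (b x) :=
        ContinuousAt.comp_of_eq hb.continuousAt hκ.continuousAt hκx
      apply hc.eventually
      change _ ∈ 𝓝 (b (φ.symm (g (ψ (b x)))))
      rw [hκx]
      exact extChartAt_source_mem_nhds (b x)
    filter_upwards [h1, h2, extChartAt_source_mem_nhds (I := 𝓘(ℝ, W)) (b x),
      hψs.continuousAt.eventually hgr] with z hz1 hz2 hz3 hz4
    refine ψ.injOn hz2 hz3 ?_
    rw [← hfφ _ (φ.map_target hz1), φ.right_inv hz1]
    exact hz4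

/-! ### Local bisections -/

namespace LieGroupoid

section Bisections

variable {E F G M : Type*}
  [NormedAddCommGroup E] [NormedSpace ℝ E]
  [NormedAddCommGroup F] [NormedSpace ℝ F]
  [TopologicalSpace G] [ChartedSpace E G]
  [TopologicalSpace M] [ChartedSpace F M]

/-- `σ` is a local bisection over the open set `V`, that is, a section of the range map such that
`s ∘ σ` has the local inverse `κ`. -/
structure IsLocalBisection (𝒢 : LieGroupoid E F G M) (σ : M → G) (κ : M → M) (V : Set M) :
    Prop where
  isOpen : IsOpen V
  contMDiffAt_section : ∀ y ∈ V, ContMDiffAt 𝓘(ℝ, F) 𝓘(ℝ, E) 3 σ y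
  contMDiffAt_inverse : ∀ y ∈ V, ContMDiffAt 𝓘(ℝ, F) 𝓘(ℝ, F) 3 κ (𝒢.src (σ y))
  rng_section : ∀ y ∈ V, 𝒢.rng (σ y) = y
  left_inverse : ∀ y ∈ V, κ (𝒢.src (σ y)) = y
  right_inverse : ∀ y ∈ V, ∀ᶠ z in 𝓝 (𝒢.src (σ y)), 𝒢.src (σ (κ z)) = z

lemma exists_isLocalBisection [FiniteDimensional ℝ E] [FiniteDimensional ℝ F]
    [IsManifold 𝓘(ℝ, E) ∞ G] [IsManifold 𝓘(ℝ, F) ∞ M] (𝒢 : LieGroupoid E F G M) (γ : G) :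
    ∃ σ κ V, 𝒢.IsLocalBisection σ κ V ∧ 𝒢.rng γ ∈ V ∧ σ (𝒢.rng γ) = γ := by
  obtain ⟨A₁, hA₁⟩ := 𝒢.exists_drng_comp_eq_id γ
  obtain ⟨A₂, hA₂⟩ := 𝒢.exists_dsrc_comp_eq_id γ
  obtain ⟨A, hA, hbij⟩ := exists_rightInverse_comp_bijective (R := (𝒢.drng γ).toLinearMap)
    (S := (𝒢.dsrc γ).toLinearMap)
    (fun v ↦ ⟨A₁ v, congrArg (fun B : F →L[ℝ] F ↦ B v) hA₁⟩)
    (fun v ↦ ⟨A₂ v, congrArg (fun B : F →L[ℝ] F ↦ B v) hA₂⟩)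
  obtain ⟨σ', hσ', hrσ', hσγ', hσd⟩ := exists_section (𝒢.contMDiff_rng γ)
    (A := LinearMap.toContinuousLinearMap A) (ContinuousLinearMap.ext hA)
  set x := 𝒢.rng γ with hx
  set σ : M → G := fun y ↦ σ' (γ, y) with hσdef
  have hσx : σ x = γ := hσγ'.self_of_nhds
  have hs : ContMDiffAt 𝓘(ℝ, F) (𝓘(ℝ, E).prod 𝓘(ℝ, F)) ∞ (fun y ↦ (γ, y)) x :=
    contMDiffAt_const.prodMk contMDiffAt_id
  have hσ : ContMDiffAt 𝓘(ℝ, F) 𝓘(ℝ, E) ∞ σ x := ContMDiffAt.comp x hσ' hs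
  have hrσ : ∀ᶠ y in 𝓝 x, 𝒢.rng (σ y) = y := by
    have hc : ContinuousAt (fun y : M ↦ (γ, y)) x := hs.continuousAt
    exact hc.eventually hrσ'
  have hb : ContMDiffAt 𝓘(ℝ, F) 𝓘(ℝ, F) ∞ (fun y ↦ 𝒢.src (σ y)) x :=
    (𝒢.contMDiff_src _).comp x hσ
  have hbd : md 𝓘(ℝ, F) 𝓘(ℝ, F) (fun y ↦ 𝒢.src (σ y)) x =
      (𝒢.dsrc γ).comp (LinearMap.toContinuousLinearMap A) :=
    ((𝒢.hasMD_src γ).comp_of_eq hσd hσx).md_eq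
  obtain ⟨κ, hκ, hκl, hκr⟩ := hb.exists_local_inverse (by rw [hbd]; exact hbij)
  -- Regularity propagates to the nearby points at a finite order only. Order three suffices: the
  -- lift to `T*G` costs one derivative, and pulling back `dα` requires order two.
  have h3 : (3 : WithTop ℕ∞) ≤ ∞ := show ((3 : ℕ∞) : WithTop ℕ∞) ≤ ∞ from mod_cast le_top
  have i1 : IsManifold 𝓘(ℝ, E) 3 G := IsManifold.of_le h3
  have i2 : IsManifold 𝓘(ℝ, F) 3 M := IsManifold.of_le h3
  have hev : ∀ᶠ y in 𝓝 x, ContMDiffAt 𝓘(ℝ, F) 𝓘(ℝ, E) 3 σ y ∧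
      ContMDiffAt 𝓘(ℝ, F) 𝓘(ℝ, F) 3 κ (𝒢.src (σ y)) ∧ 𝒢.rng (σ y) = y ∧
      κ (𝒢.src (σ y)) = y ∧ ∀ᶠ z in 𝓝 (𝒢.src (σ y)), 𝒢.src (σ (κ z)) = z := by
    filter_upwards [(hσ.of_le h3).eventually_contMDiffAt (by simp),
      hb.continuousAt.eventually ((hκ.of_le h3).eventually_contMDiffAt (by simp)), hrσ, hκl,
      hb.continuousAt.eventually hκr.eventually_nhds] with y h1 h2 h3 h4 h5
    exact ⟨h1, h2, h3, h4, h5⟩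
  obtain ⟨V, hV, hVo, hxV⟩ := eventually_nhds_iff.1 hev
  exact ⟨σ, κ, V, ⟨hVo, fun y hy ↦ (hV y hy).1, fun y hy ↦ (hV y hy).2.1,
    fun y hy ↦ (hV y hy).2.2.1, fun y hy ↦ (hV y hy).2.2.2.1, fun y hy ↦ (hV y hy).2.2.2.2⟩,
    hxV, hσx⟩

end Bisections

end LieGroupoid

/-! ### Right translation by a local bisection and its lift to the cotangent bundle -/

namespace LieGroupoid

section Translation

set_option synthInstance.maxHeartbeats 200000

variable {E F G M : Type*}
  [NormedAddCommGroup E] [NormedSpace ℝ E] [NormedAddCommGroup F] [NormedSpace ℝ F]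
  [TopologicalSpace G] [ChartedSpace E G] [TopologicalSpace M] [ChartedSpace F M]
  (𝒢 : LieGroupoid E F G M)

/-- Right translation by the bisection `σ`. -/
def transl (σ : M → G) (γ : G) : G := 𝒢.mul γ (σ (𝒢.src γ))

lemma transl_mul {σ : M → G} {g a : G} (hga : 𝒢.src g = 𝒢.rng a)
    (ha : 𝒢.rng (σ (𝒢.src a)) = 𝒢.src a) : 𝒢.transl σ (𝒢.mul g a) = 𝒢.mul g (𝒢.transl σ a) := by
  rw [transl, transl, 𝒢.src_mul _ _ hga, 𝒢.mul_assoc _ _ _ hga ha.symm]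

/-- The inverse of right translation by the bisection `σ`. -/
def translInv (σ : M → G) (κ : M → M) (γ : G) : G := 𝒢.mul γ (𝒢.inv (σ (κ (𝒢.src γ))))

namespace IsLocalBisection

variable {𝒢} {σ : M → G} {κ : M → M} {V : Set M} (hB : 𝒢.IsLocalBisection σ κ V) {γ : G}

include hB

lemma mono {V' : Set M} (hV' : IsOpen V') (h : V' ⊆ V) : 𝒢.IsLocalBisection σ κ V' :=
  ⟨hV', fun y hy ↦ hB.contMDiffAt_section y (h hy), fun y hy ↦ hB.contMDiffAt_inverse y (h hy),
    fun y hy ↦ hB.rng_section y (h hy), fun y hy ↦ hB.left_inverse y (h hy),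
    fun y hy ↦ hB.right_inverse y (h hy)⟩

lemma eventually_src_mem (hγ : 𝒢.src γ ∈ V) : ∀ᶠ g in 𝓝 γ, 𝒢.src g ∈ V :=
  𝒢.contMDiff_src.continuous.continuousAt.eventually (hB.isOpen.mem_nhds hγ)

lemma rng_transl (hγ : 𝒢.src γ ∈ V) : 𝒢.rng (𝒢.transl σ γ) = 𝒢.rng γ :=
  𝒢.rng_mul _ _ (hB.rng_section _ hγ).symm

lemma src_transl (hγ : 𝒢.src γ ∈ V) : 𝒢.src (𝒢.transl σ γ) = 𝒢.src (σ (𝒢.src γ)) :=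
  𝒢.src_mul _ _ (hB.rng_section _ hγ).symm

lemma translInv_transl (hγ : 𝒢.src γ ∈ V) : 𝒢.translInv σ κ (𝒢.transl σ γ) = γ := by
  have hr := hB.rng_section _ hγ
  rw [translInv, hB.src_transl hγ, hB.left_inverse _ hγ, transl,
    𝒢.mul_assoc _ _ _ hr.symm (𝒢.rng_inv _).symm, 𝒢.mul_inv, hr, 𝒢.mul_unit]

lemma eventually_inverse (hγ : 𝒢.src γ ∈ V) : ∀ᶠ g in 𝓝 (𝒢.transl σ γ),
    κ (𝒢.src g) ∈ V ∧ 𝒢.src (σ (κ (𝒢.src g))) = 𝒢.src g := by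
  have hs : ContinuousAt 𝒢.src (𝒢.transl σ γ) := 𝒢.contMDiff_src.continuous.continuousAt
  rw [ContinuousAt, hB.src_transl hγ] at hs
  have hκ := (hB.contMDiffAt_inverse _ hγ).continuousAt
  rw [ContinuousAt, hB.left_inverse _ hγ] at hκ
  exact hs.eventually ((hκ.eventually (hB.isOpen.mem_nhds hγ)).and (hB.right_inverse _ hγ))

lemma eventually_transl_translInv (hγ : 𝒢.src γ ∈ V) : ∀ᶠ g in 𝓝 (𝒢.transl σ γ),
    𝒢.transl σ (𝒢.translInv σ κ g) = g := by
  filter_upwards [hB.eventually_inverse hγ] with g hg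
  have hr := hB.rng_section _ hg.1
  set a := σ (κ (𝒢.src g)) with ha
  have h1 : 𝒢.src g = 𝒢.rng (𝒢.inv a) := by rw [𝒢.rng_inv, hg.2]
  have h2 : 𝒢.src (𝒢.mul g (𝒢.inv a)) = κ (𝒢.src g) := by rw [𝒢.src_mul _ _ h1, 𝒢.src_inv, hr]
  rw [transl, translInv, ← ha, h2, ← ha, 𝒢.mul_assoc _ _ _ h1 (𝒢.src_inv a), 𝒢.inv_mul, hg.2,
    𝒢.mul_unit]

lemma contMDiffAt_transl (hγ : 𝒢.src γ ∈ V) : ContMDiffAt 𝓘(ℝ, E) 𝓘(ℝ, E) 3 (𝒢.transl σ) γ := by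
  have h3 : (3 : WithTop ℕ∞) ≤ ∞ := show ((3 : ℕ∞) : WithTop ℕ∞) ≤ ∞ from mod_cast le_top
  refine 𝒢.contMDiffAt_mul h3 contMDiffAt_id ((hB.contMDiffAt_section _ hγ).comp γ
    (𝒢.contMDiff_src.contMDiffAt.of_le h3)) ?_
  filter_upwards [hB.eventually_src_mem hγ] with g hg
  exact (hB.rng_section _ hg).symm

lemma contMDiffAt_translInv (hγ : 𝒢.src γ ∈ V) :
    ContMDiffAt 𝓘(ℝ, E) 𝓘(ℝ, E) 3 (𝒢.translInv σ κ) (𝒢.transl σ γ) := by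
  have h3 : (3 : WithTop ℕ∞) ≤ ∞ := show ((3 : ℕ∞) : WithTop ℕ∞) ≤ ∞ from mod_cast le_top
  have hs : ContMDiffAt 𝓘(ℝ, E) 𝓘(ℝ, F) 3 𝒢.src (𝒢.transl σ γ) :=
    𝒢.contMDiff_src.contMDiffAt.of_le h3
  have hκ : ContMDiffAt 𝓘(ℝ, E) 𝓘(ℝ, F) 3 (fun g ↦ κ (𝒢.src g)) (𝒢.transl σ γ) :=
    ContMDiffAt.comp_of_eq (hB.contMDiffAt_inverse _ hγ) hs (hB.src_transl hγ)
  have hσ : ContMDiffAt 𝓘(ℝ, E) 𝓘(ℝ, E) 3 (fun g ↦ σ (κ (𝒢.src g))) (𝒢.transl σ γ) :=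
    ContMDiffAt.comp_of_eq (hB.contMDiffAt_section _ hγ) hκ (by
      rw [hB.src_transl hγ, hB.left_inverse _ hγ])
  have hi : ContMDiffAt 𝓘(ℝ, E) 𝓘(ℝ, E) 3 (fun g ↦ 𝒢.inv (σ (κ (𝒢.src g)))) (𝒢.transl σ γ) :=
    (𝒢.contMDiff_inv.contMDiffAt.of_le h3).comp (𝒢.transl σ γ) hσ
  refine 𝒢.contMDiffAt_mul h3 contMDiffAt_id hi ?_
  filter_upwards [hB.eventually_inverse hγ] with g hg
  rw [𝒢.rng_inv, hg.2]

lemma hasMD_transl (hγ : 𝒢.src γ ∈ V) :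
    HasMD 𝓘(ℝ, E) 𝓘(ℝ, E) (𝒢.transl σ) γ (md 𝓘(ℝ, E) 𝓘(ℝ, E) (𝒢.transl σ) γ) :=
  (hB.contMDiffAt_transl hγ).hasMD (by simp)

lemma hasMD_translInv (hγ : 𝒢.src γ ∈ V) :
    HasMD 𝓘(ℝ, E) 𝓘(ℝ, E) (𝒢.translInv σ κ) (𝒢.transl σ γ)
      (md 𝓘(ℝ, E) 𝓘(ℝ, E) (𝒢.translInv σ κ) (𝒢.transl σ γ)) :=
  (hB.contMDiffAt_translInv hγ).hasMD (by simp)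

lemma md_translInv_comp_md_transl (hγ : 𝒢.src γ ∈ V) :
    (md 𝓘(ℝ, E) 𝓘(ℝ, E) (𝒢.translInv σ κ) (𝒢.transl σ γ)).comp
      (md 𝓘(ℝ, E) 𝓘(ℝ, E) (𝒢.transl σ) γ) = .id ℝ E :=
  ((hB.hasMD_translInv hγ).comp (hB.hasMD_transl hγ)).unique ((hasMD_id γ).congr
    ((hB.eventually_src_mem hγ).mono fun _ hg ↦ hB.translInv_transl hg))

lemma md_transl_comp_md_translInv (hγ : 𝒢.src γ ∈ V) :
    (md 𝓘(ℝ, E) 𝓘(ℝ, E) (𝒢.transl σ) γ).comp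
      (md 𝓘(ℝ, E) 𝓘(ℝ, E) (𝒢.translInv σ κ) (𝒢.transl σ γ)) = .id ℝ E :=
  ((hB.hasMD_transl hγ).comp_of_eq (hB.hasMD_translInv hγ) (hB.translInv_transl hγ)).unique
    ((hasMD_id _).congr (hB.eventually_transl_translInv hγ))

end IsLocalBisection

variable [FiniteDimensional ℝ E] [FiniteDimensional ℝ F]
  [IsManifold 𝓘(ℝ, E) ∞ G] [IsManifold 𝓘(ℝ, F) ∞ M]

/-- A range section through `γ`, differentiable at `r(γ)`. -/
lemma exists_rng_section (γ : G) : ∃ (ρ : M → G) (B : F →L[ℝ] E),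
    HasMD 𝓘(ℝ, F) 𝓘(ℝ, E) ρ (𝒢.rng γ) B ∧ (∀ᶠ x in 𝓝 (𝒢.rng γ), 𝒢.rng (ρ x) = x) ∧
      ρ (𝒢.rng γ) = γ := by
  obtain ⟨A, hA⟩ := 𝒢.exists_drng_comp_eq_id γ
  obtain ⟨σ, -, hrσ, hσγ, hσd⟩ := exists_section (𝒢.contMDiff_rng γ) hA
  have hc : ContinuousAt (fun x : M ↦ (γ, x)) (𝒢.rng γ) := by fun_prop
  exact ⟨fun x ↦ σ (γ, x), A, hσd, hc.eventually hrσ, hσγ.self_of_nhds⟩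

/-- The maps `g ↦ g ρ(s(g))` and `g ↦ ρ(s(g))`, whose derivatives have `dR_γ` as their difference,
have the same source. -/
lemma dsrc_dRightMul_algebroidProj (γ : G) (w : E) :
    𝒢.dsrc γ (𝒢.dRightMul γ (𝒢.algebroidProj (𝒢.rng γ) w)) = 0 := by
  obtain ⟨ρ, B, hρ, hr, hργ⟩ := 𝒢.exists_rng_section γ
  have hρ' := hρ
  have hr' := hr
  rw [← 𝒢.src_unit (𝒢.rng γ)] at hρ' hr'
  have h0 := 𝒢.dRightMul_comp_algebroidProj hρ hr hργ
  have h1 := 𝒢.hasMD_mul_section hρ' hr'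
  have h2 := hρ'.comp (𝒢.hasMD_src (𝒢.unit (𝒢.rng γ)))
  have e1 : 𝒢.mul (𝒢.unit (𝒢.rng γ)) (ρ (𝒢.src (𝒢.unit (𝒢.rng γ)))) = γ := by
    rw [𝒢.src_unit, hργ, 𝒢.unit_mul]
  have e2 : ρ (𝒢.src (𝒢.unit (𝒢.rng γ))) = γ := by rw [𝒢.src_unit, hργ]
  have h3 := ((𝒢.hasMD_src γ).comp_of_eq h1 e1).unique
    (((𝒢.hasMD_src γ).comp_of_eq h2 e2).congr (by
      filter_upwards [(𝒢.hasMD_src (𝒢.unit (𝒢.rng γ))).continuousAt.eventually hr'] with g hg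
      exact 𝒢.src_mul _ _ hg.symm))
  have h4 : 𝒢.dRightMul γ (𝒢.algebroidProj (𝒢.rng γ) w) = _ :=
    congrArg (fun A : E →L[ℝ] E ↦ A w) h0
  rw [h4, sub_apply, map_sub, sub_eq_zero]
  have h5 : md 𝓘(ℝ, E) 𝓘(ℝ, E) (fun g ↦ ρ (𝒢.src g)) (𝒢.unit (𝒢.rng γ)) = _ := h2.md_eq
  rw [h1.md_eq, h5]
  exact congrArg (fun A : E →L[ℝ] F ↦ A w) h3

variable {𝒢} {σ : M → G} {κ : M → M} {V : Set M}

/-- Infinitesimal form of associativity: translating a section through `γ` by `σ` gives a section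
through the translated point. -/
lemma dRightMul_transl {γ : G} {B : F →L[ℝ] E} (hσ : HasMD 𝓘(ℝ, F) 𝓘(ℝ, E) σ (𝒢.src γ) B)
    (hrσ : ∀ᶠ x in 𝓝 (𝒢.src γ), 𝒢.rng (σ x) = x) :
    (𝒢.dRightMul (𝒢.transl σ γ)).comp (𝒢.algebroidProj (𝒢.rng γ)) =
      (md 𝓘(ℝ, E) 𝓘(ℝ, E) (𝒢.transl σ) γ).comp
        ((𝒢.dRightMul γ).comp (𝒢.algebroidProj (𝒢.rng γ))) := by
  obtain ⟨ρ, C, hρ, hr, hργ⟩ := 𝒢.exists_rng_section γ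
  have hρ' := hρ
  have hr' := hr
  rw [← 𝒢.src_unit (𝒢.rng γ)] at hρ' hr'
  have hmd : HasMD 𝓘(ℝ, E) 𝓘(ℝ, E) (𝒢.transl σ) γ (md 𝓘(ℝ, E) 𝓘(ℝ, E) (𝒢.transl σ) γ) :=
    (𝒢.hasMD_mul_section hσ hrσ).mdifferentiableAt.hasMD
  have hrt' : ∀ᶠ g in 𝓝 γ, 𝒢.rng (σ (𝒢.src g)) = 𝒢.src g :=
    (𝒢.hasMD_src γ).continuousAt.eventually hrσ
  have hρV : ∀ᶠ x in 𝓝 (𝒢.rng γ), 𝒢.rng (σ (𝒢.src (ρ x))) = 𝒢.src (ρ x) := by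
    have hc := hρ.continuousAt
    rw [ContinuousAt, hργ] at hc
    exact hc.eventually hrt'
  have hrt : 𝒢.rng (𝒢.transl σ γ) = 𝒢.rng γ := 𝒢.rng_mul _ _ hrt'.self_of_nhds.symm
  have ht : HasMD 𝓘(ℝ, F) 𝓘(ℝ, E) (fun x ↦ 𝒢.transl σ (ρ x)) (𝒢.rng γ) _ :=
    hmd.comp_of_eq hρ hργ
  have htr : ∀ᶠ x in 𝓝 (𝒢.rng γ), 𝒢.rng (𝒢.transl σ (ρ x)) = x := by
    filter_upwards [hr, hρV] with x h1 h2
    rw [transl, 𝒢.rng_mul _ _ h2.symm, h1]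
  have h1 := 𝒢.dRightMul_comp_algebroidProj (γ := 𝒢.transl σ γ) (ρ := fun x ↦ 𝒢.transl σ (ρ x))
    (by rw [hrt]; exact ht) (by rw [hrt]; exact htr) (by rw [hrt, hργ])
  rw [hrt] at h1
  rw [h1, 𝒢.dRightMul_comp_algebroidProj hρ hr hργ, ContinuousLinearMap.comp_sub]
  have hm := 𝒢.hasMD_mul_section hρ' hr'
  have hm' := hρ'.comp (𝒢.hasMD_src (𝒢.unit (𝒢.rng γ)))
  have e1 : 𝒢.mul (𝒢.unit (𝒢.rng γ)) (ρ (𝒢.src (𝒢.unit (𝒢.rng γ)))) = γ := by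
    rw [𝒢.src_unit, hργ, 𝒢.unit_mul]
  have e2 : ρ (𝒢.src (𝒢.unit (𝒢.rng γ))) = γ := by rw [𝒢.src_unit, hργ]
  have hm'' : md 𝓘(ℝ, E) 𝓘(ℝ, E) (fun g ↦ ρ (𝒢.src g)) (𝒢.unit (𝒢.rng γ)) = _ := hm'.md_eq
  rw [hm.md_eq, hm'']
  have hs := (𝒢.hasMD_src (𝒢.unit (𝒢.rng γ))).continuousAt
  rw [← 𝒢.src_unit (𝒢.rng γ)] at hρV
  congr 1
  · refine ((hmd.comp_of_eq hm e1).congr ?_).md_eq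
    filter_upwards [hs.eventually hr', hs.eventually hρV] with g hg1 hg2
    exact (𝒢.transl_mul hg1.symm hg2).symm
  · exact (hmd.comp_of_eq hm' e2).md_eq

lemma IsLocalBisection.md_transl_dRightMul (hB : 𝒢.IsLocalBisection σ κ V) {γ : G}
    (hγ : 𝒢.src γ ∈ V) :
    (𝒢.dRightMul (𝒢.transl σ γ)).comp (𝒢.algebroidProj (𝒢.rng γ)) =
      (md 𝓘(ℝ, E) 𝓘(ℝ, E) (𝒢.transl σ) γ).comp
        ((𝒢.dRightMul γ).comp (𝒢.algebroidProj (𝒢.rng γ))) :=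
  dRightMul_transl ((hB.contMDiffAt_section _ hγ).hasMD (by simp))
    (by filter_upwards [hB.isOpen.mem_nhds hγ] with y hy using hB.rng_section y hy)

variable (𝒢) in
/-- The lift to the cotangent bundle of right translation by a local bisection, shifted by the
differential of `f ∘ s`. -/
def cotTransl (σ : M → G) (κ : M → M) (f : M → ℝ) (δ : CotangentBundle E G) :
    CotangentBundle E G :=
  cotMk (𝒢.transl σ δ.1) ((δ.form + md 𝓘(ℝ, E) 𝓘(ℝ, ℝ) (fun g ↦ f (𝒢.src g)) δ.1).comp
    (md 𝓘(ℝ, E) 𝓘(ℝ, E) (𝒢.translInv σ κ) (𝒢.transl σ δ.1)))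

variable {f : M → ℝ} {δ : CotangentBundle E G}

namespace IsLocalBisection

variable (hB : 𝒢.IsLocalBisection σ κ V)

include hB

omit [FiniteDimensional ℝ E] [FiniteDimensional ℝ F]
  [IsManifold 𝓘(ℝ, E) ∞ G] [IsManifold 𝓘(ℝ, F) ∞ M] in
-- The relation that characterizes the lift: translation pulls the new covector back to `ξ + d(f ∘
-- s)`.
lemma cotTransl_form_comp (hδ : 𝒢.src δ.1 ∈ V) :
    (𝒢.cotTransl σ κ f δ).form.comp (md 𝓘(ℝ, E) 𝓘(ℝ, E) (𝒢.transl σ) δ.1) =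
      δ.form + md 𝓘(ℝ, E) 𝓘(ℝ, ℝ) (fun g ↦ f (𝒢.src g)) δ.1 := by
  have := hB.md_translInv_comp_md_transl hδ
  rw [cotTransl, cotMk_form, ContinuousLinearMap.comp_assoc, this, ContinuousLinearMap.comp_id]

omit [FiniteDimensional ℝ E] [FiniteDimensional ℝ F] [IsManifold 𝓘(ℝ, F) ∞ M] in
lemma contMDiffAt_cotTransl (hf : ContMDiffAt 𝓘(ℝ, F) 𝓘(ℝ, ℝ) 3 f (𝒢.src δ.1))
    (hδ : 𝒢.src δ.1 ∈ V) :
    ContMDiffAt (cotangentModel E) (cotangentModel E) 2 (𝒢.cotTransl σ κ f) δ := by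
  have h3 : (3 : WithTop ℕ∞) ≤ ∞ := show ((3 : ℕ∞) : WithTop ℕ∞) ≤ ∞ from mod_cast le_top
  have h23 : (2 : WithTop ℕ∞) + 1 ≤ 3 := by norm_num
  have h23' : (2 : WithTop ℕ∞) ≤ 3 := le_trans le_self_add h23
  have hπ : ContMDiffAt (cotangentModel E) 𝓘(ℝ, E) 2 (fun δ : CotangentBundle E G ↦ δ.1) δ :=
    contMDiff_cotangent_proj.contMDiffAt
  have hfs : ContMDiffAt 𝓘(ℝ, E) 𝓘(ℝ, ℝ) 3 (fun g ↦ f (𝒢.src g)) δ.1 :=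
    hf.comp δ.1 (𝒢.contMDiff_src.contMDiffAt.of_le h3)
  have hd : ContMDiffAt (cotangentModel E) (cotangentModel E) 2 (fun δ : CotangentBundle E G ↦
      cotMk δ.1 (md 𝓘(ℝ, E) 𝓘(ℝ, ℝ) (fun g ↦ f (𝒢.src g)) δ.1)) δ :=
    ContMDiffAt.comp (g := fun γ ↦ cotMk γ (md 𝓘(ℝ, E) 𝓘(ℝ, ℝ) (fun g ↦ f (𝒢.src g)) γ)) δ
      (hfs.covector_md h23) hπ
  have hid : ContMDiffAt (cotangentModel E) (cotangentModel E) 2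
      (fun δ : CotangentBundle E G ↦ cotMk δ.1 δ.form) δ := contMDiffAt_id
  have hh : ContMDiffAt ((cotangentModel E).prod 𝓘(ℝ, E)) 𝓘(ℝ, E) 3
      (Function.uncurry fun (_ : CotangentBundle E G) g ↦ 𝒢.translInv σ κ g)
      (δ, 𝒢.transl σ δ.1) :=
    (hB.contMDiffAt_translInv hδ).comp (δ, 𝒢.transl σ δ.1) contMDiffAt_snd
  exact (hid.covector_add hd).covector_comp
    (((hB.contMDiffAt_transl hδ).of_le h23').comp δ hπ) hh h23
    ((hπ.continuousAt.eventually (hB.eventually_src_mem hδ)).mono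
      fun z hz ↦ hB.translInv_transl hz)

omit [FiniteDimensional ℝ E] [FiniteDimensional ℝ F] [IsManifold 𝓘(ℝ, F) ∞ M] in
-- `α` is tautological: its pullback by a map covering the translation is the pulled-back covector,
-- here `ξ + d(f ∘ s)`. So `α` changes by an exact form and `ω` is preserved.
lemma canForm_cotTransl (hf : ContMDiffAt 𝓘(ℝ, F) 𝓘(ℝ, ℝ) 3 f (𝒢.src δ.1))
    (hδ : 𝒢.src δ.1 ∈ V) :
    (canForm (𝒢.cotTransl σ κ f δ)).comp
        (md (cotangentModel E) (cotangentModel E) (𝒢.cotTransl σ κ f) δ) =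
      canForm δ + md (cotangentModel E) 𝓘(ℝ, ℝ)
        (fun δ : CotangentBundle E G ↦ f (𝒢.src δ.1)) δ := by
  have h1 := (hasMD_cotangent_proj (𝒢.cotTransl σ κ f δ)).comp
    ((hB.contMDiffAt_cotTransl hf hδ).hasMD two_ne_zero)
  have h2 := h1.unique ((hB.hasMD_transl hδ).comp (hasMD_cotangent_proj δ))
  have hfs : HasMD 𝓘(ℝ, E) 𝓘(ℝ, ℝ) (fun g ↦ f (𝒢.src g)) δ.1
      (md 𝓘(ℝ, E) 𝓘(ℝ, ℝ) (fun g ↦ f (𝒢.src g)) δ.1) :=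
    ((hf.mdifferentiableAt (by simp)).comp δ.1 (𝒢.hasMD_src δ.1).mdifferentiableAt).hasMD
  have h3 := (hfs.comp (hasMD_cotangent_proj δ)).md_eq
  have h4 : (fun δ : CotangentBundle E G ↦ f (𝒢.src δ.1)) =
    (fun g ↦ f (𝒢.src g)) ∘ fun δ : CotangentBundle E G ↦ δ.1 := rfl
  rw [canForm, ContinuousLinearMap.comp_assoc, h2, ← ContinuousLinearMap.comp_assoc,
    hB.cotTransl_form_comp hδ, h4, h3, ContinuousLinearMap.add_comp]
  rfl

/-- Right-invariance of `r_Γ`: right translation carries `dR_γ` to that of the translated point, and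
`d(f ∘ s)` vanishes on the range of `dR_γ`, which lies in `ker ds`. -/
lemma cotRng_cotTransl (hf : ContMDiffAt 𝓘(ℝ, F) 𝓘(ℝ, ℝ) 3 f (𝒢.src δ.1))
    (hδ : 𝒢.src δ.1 ∈ V) : 𝒢.cotRng (𝒢.cotTransl σ κ f δ) = 𝒢.cotRng δ := by
  have hr := hB.rng_transl hδ
  have hfs : md 𝓘(ℝ, E) 𝓘(ℝ, ℝ) (fun g ↦ f (𝒢.src g)) δ.1 =
      (md 𝓘(ℝ, F) 𝓘(ℝ, ℝ) f (𝒢.src δ.1)).comp (𝒢.dsrc δ.1) :=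
    ((hf.hasMD (by simp)).comp (𝒢.hasMD_src δ.1)).md_eq
  refine CotangentBundle.ext_form ?_ ?_
  · change 𝒢.unit (𝒢.rng (𝒢.transl σ δ.1)) = 𝒢.unit (𝒢.rng δ.1)
    rw [hr]
  · change (𝒢.cotTransl σ κ f δ).form.comp ((𝒢.dRightMul (𝒢.transl σ δ.1)).comp
      (𝒢.algebroidProj (𝒢.rng (𝒢.transl σ δ.1)))) =
      δ.form.comp ((𝒢.dRightMul δ.1).comp (𝒢.algebroidProj (𝒢.rng δ.1)))
    rw [hr, hB.md_transl_dRightMul hδ, ← ContinuousLinearMap.comp_assoc,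
      hB.cotTransl_form_comp hδ, hfs]
    refine ContinuousLinearMap.ext fun w ↦ ?_
    change δ.form (𝒢.dRightMul δ.1 (𝒢.algebroidProj (𝒢.rng δ.1) w)) +
      md 𝓘(ℝ, F) 𝓘(ℝ, ℝ) f (𝒢.src δ.1)
        (𝒢.dsrc δ.1 (𝒢.dRightMul δ.1 (𝒢.algebroidProj (𝒢.rng δ.1) w))) = _
    rw [𝒢.dsrc_dRightMul_algebroidProj, map_zero, add_zero]
    rfl

omit [FiniteDimensional ℝ E] [FiniteDimensional ℝ F]
  [IsManifold 𝓘(ℝ, E) ∞ G] [IsManifold 𝓘(ℝ, F) ∞ M] in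
-- `r_Γ(γ, ξ)` retains `ξ` on right translates of `ker ds` and loses it along the section `σ`; the
-- condition on `df` restores exactly that part.
lemma cotTransl_cotRng (hV : 𝒢.rng δ.1 ∈ V) (hσ : σ (𝒢.rng δ.1) = δ.1)
    (hf : ContMDiffAt 𝓘(ℝ, F) 𝓘(ℝ, ℝ) 3 f (𝒢.rng δ.1))
    (hdf : md 𝓘(ℝ, F) 𝓘(ℝ, ℝ) f (𝒢.rng δ.1) =
      δ.form.comp (md 𝓘(ℝ, F) 𝓘(ℝ, E) σ (𝒢.rng δ.1))) :
    𝒢.cotTransl σ κ f (𝒢.cotRng δ) = δ := by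
  set x := 𝒢.rng δ.1 with hx
  have hs : 𝒢.src (𝒢.unit x) = x := 𝒢.src_unit x
  have hsV : 𝒢.src (𝒢.unit x) ∈ V := by rwa [hs]
  have ht : 𝒢.transl σ (𝒢.unit x) = δ.1 := by rw [transl, hs, hσ, 𝒢.unit_mul]
  have hσd : HasMD 𝓘(ℝ, F) 𝓘(ℝ, E) σ x (md 𝓘(ℝ, F) 𝓘(ℝ, E) σ x) :=
    (hB.contMDiffAt_section x hV).hasMD (by simp)
  have hfs : md 𝓘(ℝ, E) 𝓘(ℝ, ℝ) (fun g ↦ f (𝒢.src g)) (𝒢.unit x) =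
      (md 𝓘(ℝ, F) 𝓘(ℝ, ℝ) f x).comp (𝒢.dsrc (𝒢.unit x)) :=
    ((hf.hasMD (by simp)).comp_of_eq (𝒢.hasMD_src (𝒢.unit x)) hs).md_eq
  have hσs : md 𝓘(ℝ, E) 𝓘(ℝ, E) (fun g ↦ σ (𝒢.src g)) (𝒢.unit x) =
      (md 𝓘(ℝ, F) 𝓘(ℝ, E) σ x).comp (𝒢.dsrc (𝒢.unit x)) :=
    (hσd.comp_of_eq (𝒢.hasMD_src (𝒢.unit x)) hs).md_eq
  have hη : (𝒢.cotRng δ).form + md 𝓘(ℝ, E) 𝓘(ℝ, ℝ) (fun g ↦ f (𝒢.src g)) (𝒢.unit x) =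
      δ.form.comp (md 𝓘(ℝ, E) 𝓘(ℝ, E) (𝒢.transl σ) (𝒢.unit x)) := by
    have h1 := 𝒢.dRightMul_comp_algebroidProj hσd
      (by filter_upwards [hB.isOpen.mem_nhds hV] with y hy using hB.rng_section y hy) hσ
    change δ.form.comp ((𝒢.dRightMul δ.1).comp (𝒢.algebroidProj x)) + _ = _
    rw [h1, hfs, hdf, hσs, ContinuousLinearMap.comp_sub, ContinuousLinearMap.comp_assoc]
    exact sub_add_cancel _ _
  refine CotangentBundle.ext_form ht ?_
  change ((𝒢.cotRng δ).form + md 𝓘(ℝ, E) 𝓘(ℝ, ℝ) (fun g ↦ f (𝒢.src g)) (𝒢.unit x)).comp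
    (md 𝓘(ℝ, E) 𝓘(ℝ, E) (𝒢.translInv σ κ) (𝒢.transl σ (𝒢.unit x))) = δ.form
  rw [hη, ContinuousLinearMap.comp_assoc, hB.md_transl_comp_md_translInv hsV,
    ContinuousLinearMap.comp_id]

end IsLocalBisection

/-- Every point of the cotangent bundle is obtained from its range by the lift of a local
bisection. -/
lemma exists_cotTransl (𝒢 : LieGroupoid E F G M) (δ : CotangentBundle E G) :
    ∃ (σ : M → G) (κ : M → M) (V : Set M) (f : M → ℝ), 𝒢.IsLocalBisection σ κ V ∧
      𝒢.rng δ.1 ∈ V ∧ σ (𝒢.rng δ.1) = δ.1 ∧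
      (∀ y ∈ V, ContMDiffAt 𝓘(ℝ, F) 𝓘(ℝ, ℝ) 3 f y) ∧ 𝒢.cotTransl σ κ f (𝒢.cotRng δ) = δ := by
  obtain ⟨σ, κ, V, hB, hV, hσ⟩ := 𝒢.exists_isLocalBisection δ.1
  set x := 𝒢.rng δ.1 with hx
  -- Only the differential of `f` at `r(γ)` is prescribed, so `f` can be taken linear in a chart.
  set β : F →L[ℝ] ℝ := δ.form.comp (md 𝓘(ℝ, F) 𝓘(ℝ, E) σ x)
  set f : M → ℝ := fun y ↦ β (extChartAt 𝓘(ℝ, F) x y)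
  have h3 : (3 : WithTop ℕ∞) ≤ ∞ := show ((3 : ℕ∞) : WithTop ℕ∞) ≤ ∞ from mod_cast le_top
  have hf : ∀ y ∈ (chartAt F x).source, ContMDiffAt 𝓘(ℝ, F) 𝓘(ℝ, ℝ) 3 f y := fun y hy ↦
    (β.contDiff.contMDiff.contMDiffAt.comp y (contMDiffAt_extChartAt' hy)).of_le h3
  have hB' := hB.mono (hB.isOpen.inter (chartAt F x).open_source) inter_subset_left
  have hV' : x ∈ V ∩ (chartAt F x).source := ⟨hV, mem_chart_source F x⟩
  refine ⟨σ, κ, _, f, hB', hV', hσ, fun y hy ↦ hf y hy.2,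
    hB'.cotTransl_cotRng hV' hσ (hf x hV'.2) ?_⟩
  have h1 := md_extChartAt_symm_comp x (mem_chart_source F x)
  rw [md_extChartAt_symm_self, ContinuousLinearMap.id_comp] at h1
  have h2 : HasMD 𝓘(ℝ, F) 𝓘(ℝ, F) (extChartAt 𝓘(ℝ, F) x) x _ :=
    (contMDiffAt_extChartAt (n := 1)).hasMD one_ne_zero
  rw [h1] at h2
  exact ((hasMD_iff_hasFDerivAt.2 (β.hasFDerivAt (x := extChartAt 𝓘(ℝ, F) x x))).comp h2).md_eq

end Translation

end LieGroupoid

/-! ### Symmetries of the Hamiltonian flow, completeness -/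

section Dilation

set_option synthInstance.maxHeartbeats 200000

variable {E G : Type*} [NormedAddCommGroup E] [NormedSpace ℝ E]
  [TopologicalSpace G] [ChartedSpace E G]

lemma dilation_form (a : ℝ) (δ : CotangentBundle E G) : (dilation a δ).form = a • δ.form := rfl

lemma dilation_dilation_inv {a : ℝ} (ha : a ≠ 0) (δ : CotangentBundle E G) :
    dilation a (dilation a⁻¹ δ) = δ :=
  CotangentBundle.ext_form rfl (by rw [dilation_form, dilation_form, smul_inv_smul₀ ha])

variable [IsManifold 𝓘(ℝ, E) ∞ G]

lemma canForm_comp {V H N : Type*} [NormedAddCommGroup V] [NormedSpace ℝ V] [TopologicalSpace H]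
    [TopologicalSpace N] [ChartedSpace H N] {I : ModelWithCorners ℝ V H}
    {f : N → CotangentBundle E G} {x : N} {A : V →L[ℝ] E × (E →L[ℝ] ℝ)} {B : V →L[ℝ] E}
    (hf : HasMD I (cotangentModel E) f x A) (hB : HasMD I 𝓘(ℝ, E) (fun z ↦ (f z).1) x B) :
    (canForm (f x)).comp A = (f x).form.comp B := by
  rw [canForm, ContinuousLinearMap.comp_assoc, ((hasMD_cotangent_proj (f x)).comp hf).unique hB]

lemma contMDiff_dilation (a : ℝ) :
    ContMDiff (cotangentModel E) (cotangentModel E) ∞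
      (dilation a : CotangentBundle E G → CotangentBundle E G) := fun _ ↦
  ContMDiffAt.covector_smul a (g := fun δ : CotangentBundle E G ↦ δ.1) (ξ := fun δ ↦ δ.form)
    contMDiffAt_id

lemma canForm_dilation (a : ℝ) (δ : CotangentBundle E G) :
    (canForm (dilation a δ)).comp
      (md (cotangentModel E) (cotangentModel E) (dilation a) δ) = a • canForm δ :=
  canForm_comp ((contMDiff_dilation a).contMDiffAt.hasMD (by simp)) (hasMD_cotangent_proj δ)

variable [FiniteDimensional ℝ E] {p : CotangentBundle E G → ℝ} {U : Set (CotangentBundle E G)}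

/-- The Hamiltonian curves of a homogeneous function of degree one are permuted by the positive
dilations. -/
lemma IsHamOn.dilation (hU : IsOpen U) (hp : ContMDiffOn (cotangentModel E) 𝓘(ℝ, ℝ) ∞ p U)
    {a : ℝ} (ha : a ≠ 0) (hmem : ∀ δ ∈ U, dilation a δ ∈ U)
    (hpa : ∀ δ ∈ U, p (dilation a δ) = a * p δ) {c : ℝ → CotangentBundle E G} {s : Set ℝ}
    (h : IsHamOn p U c s) : IsHamOn p U (fun t ↦ dilation a (c t)) s := by
  intro t ht
  obtain ⟨h1, h2⟩ := h t ht
  have h3 := (contMDiff_dilation (E := E) (G := G) a).contMDiffAt (x := c t)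
  refine ⟨hmem _ h1, h2.comp_map (h3.mdifferentiableAt (by simp)) ?_⟩
  have hpd : ∀ δ ∈ U, MDifferentiableAt (cotangentModel E) 𝓘(ℝ, ℝ) p δ := fun δ hδ ↦
    (hp.contMDiffAt (hU.mem_nhds hδ)).mdifferentiableAt (by simp)
  refine md_hamVec (φ := fun _ ↦ 0) ha
    (h3.of_le (show ((2 : ℕ∞) : WithTop ℕ∞) ≤ ∞ from mod_cast le_top)) contMDiffAt_const
    (Eventually.of_forall fun z ↦ ?_) (hpd _ (hmem _ h1)) (hpd _ h1)
    ((hU.eventually_mem h1).mono hpa)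
  rw [canForm_dilation, (hasMD_const (I := cotangentModel E) (J := 𝓘(ℝ, ℝ)) (0 : ℝ) z).md_eq,
    add_zero]

end Dilation

/-! ### Curves in a manifold with zero velocity. -/

section LocallyConstant

variable {F M : Type*} [NormedAddCommGroup F] [NormedSpace ℝ F]
  [TopologicalSpace M] [ChartedSpace F M] [IsManifold 𝓘(ℝ, F) ∞ M]

lemma eventually_eq_of_hasMD_zero {c : ℝ → M} {t : ℝ}
    (h : ∀ᶠ τ in 𝓝 t, HasMD 𝓘(ℝ, ℝ) 𝓘(ℝ, F) c τ 0) : ∀ᶠ τ in 𝓝 t, c τ = c t := by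
  set φ := extChartAt 𝓘(ℝ, F) (c t)
  have hφ : φ.source ∈ 𝓝 (c t) := extChartAt_source_mem_nhds (I := 𝓘(ℝ, F)) (c t)
  have hs := h.self_of_nhds.continuousAt.eventually hφ
  have : IsManifold 𝓘(ℝ, F) 1 M := IsManifold.of_le (n := ∞) (by simp)
  obtain ⟨r, hr, hball⟩ := Metric.eventually_nhds_iff_ball.1 (h.and hs)
  have hd : ∀ τ ∈ Metric.ball t r, HasFDerivAt (fun τ ↦ φ (c τ)) (0 : ℝ →L[ℝ] F) τ := by
    intro τ hτ
    obtain ⟨h1, h2⟩ := hball τ hτ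
    have h3 := (mdifferentiableAt_extChartAt (I := 𝓘(ℝ, F)) (x := c t) (y := c τ)
      (by rw [← extChartAt_source (I := 𝓘(ℝ, F))]; exact h2)).hasMD
    have h4 := h3.comp h1
    rw [ContinuousLinearMap.comp_zero] at h4
    exact hasMD_iff_hasFDerivAt.1 h4
  filter_upwards [Metric.ball_mem_nhds t hr] with τ hτ
  refine φ.injOn (hball τ hτ).2 (mem_extChartAt_source (c t)) ?_
  exact Metric.isOpen_ball.is_const_of_fderiv_eq_zero (𝕜 := ℝ)
    (convex_ball t r).isPreconnected (fun z hz ↦ (hd z hz).differentiableAt.differentiableWithinAt)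
    (fun z hz ↦ (hd z hz).fderiv) hτ (Metric.mem_ball_self hr)

lemma eq_of_hasMD_zero {c : ℝ → M} {s : Set ℝ} (hs : IsOpen s) (hs' : IsPreconnected s)
    (h : ∀ t ∈ s, HasMD 𝓘(ℝ, ℝ) 𝓘(ℝ, F) c t 0) {t₀ t : ℝ} (ht₀ : t₀ ∈ s) (ht : t ∈ s) :
    c t = c t₀ := by
  have hloc : ∀ t ∈ s, ∀ᶠ τ in 𝓝 t, c τ = c t := fun t ht ↦
    eventually_eq_of_hasMD_zero ((hs.eventually_mem ht).mono h)
  have hsub := hs'.subset_of_closure_inter_subset (u := {t | ∀ᶠ τ in 𝓝 t, c τ = c t₀})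
    isOpen_setOfPred_eventually_nhds ⟨t₀, ht₀, hloc t₀ ht₀⟩ ?_
  · exact (hsub ht).self_of_nhds
  · rintro t ⟨htc, hts⟩
    obtain ⟨τ, hτ, hτ'⟩ := ((mem_closure_iff_frequently.1 htc).and_eventually (hloc t hts)).exists
    filter_upwards [hloc t hts] with τ' h'
    rw [h', ← hτ', hτ.self_of_nhds]

end LocallyConstant

/-! ### Invariance of the source along the curves, and completeness by compactness and homogeneity.
-/

namespace LieGroupoid

section Completeness

set_option synthInstance.maxHeartbeats 200000

variable {E F G M : Type*}
  [NormedAddCommGroup E] [NormedSpace ℝ E] [FiniteDimensional ℝ E]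
  [NormedAddCommGroup F] [NormedSpace ℝ F] [FiniteDimensional ℝ F]
  [TopologicalSpace G] [ChartedSpace E G] [IsManifold 𝓘(ℝ, E) ∞ G]
  [TopologicalSpace M] [ChartedSpace F M] [IsManifold 𝓘(ℝ, F) ∞ M]
  {𝒢 : LieGroupoid E F G M} {p₀ : CotangentBundle E G → ℝ}

lemma cotRng_add_comp_dsrc (γ : G) (ξ : E →L[ℝ] ℝ) (β : F →L[ℝ] ℝ) :
    𝒢.cotRng (cotMk γ (ξ + β.comp (𝒢.dsrc γ))) = 𝒢.cotRng (cotMk γ ξ) := by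
  refine CotangentBundle.ext_form rfl (ContinuousLinearMap.ext fun w ↦ ?_)
  change ξ (𝒢.dRightMul γ (𝒢.algebroidProj (𝒢.rng γ) w)) +
    β (𝒢.dsrc γ (𝒢.dRightMul γ (𝒢.algebroidProj (𝒢.rng γ) w))) = _
  rw [𝒢.dsrc_dRightMul_algebroidProj, map_zero, add_zero]
  rfl

omit [FiniteDimensional ℝ E] [FiniteDimensional ℝ F]
  [IsManifold 𝓘(ℝ, E) ∞ G] [IsManifold 𝓘(ℝ, F) ∞ M] in
lemma dilation_mem_compl_kerCotRng {a : ℝ} (ha : a ≠ 0) {δ : CotangentBundle E G}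
    (hδ : δ ∈ 𝒢.kerCotRngᶜ) : dilation a δ ∈ 𝒢.kerCotRngᶜ := by
  intro h
  rw [mem_kerCotRng_iff, cotRng_dilation, dilation_form, smul_eq_zero] at h
  exact h.elim ha hδ

omit [FiniteDimensional ℝ E] [FiniteDimensional ℝ F]
  [IsManifold 𝓘(ℝ, E) ∞ G] [IsManifold 𝓘(ℝ, F) ∞ M] in
lemma dilation_mem_dualAlgebroidNonzero {a : ℝ} (ha : a ≠ 0) {δ : CotangentBundle E G}
    (hδ : δ ∈ 𝒢.dualAlgebroidNonzero) : dilation a δ ∈ 𝒢.dualAlgebroidNonzero := by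
  have h := 𝒢.cotRng_mem_nonzero (dilation_mem_compl_kerCotRng ha (𝒢.notMem_kerCotRng hδ))
  rwa [cotRng_dilation, 𝒢.cotRng_of_mem hδ.1] at h

variable (hp₀ : 𝒢.IsHomogeneousSymbol p₀)

include hp₀

lemma IsHomogeneousSymbol.mdifferentiableAt {δ : CotangentBundle E G} (hδ : δ ∈ 𝒢.kerCotRngᶜ) :
    MDifferentiableAt (cotangentModel E) 𝓘(ℝ, ℝ) (p₀ ∘ 𝒢.cotRng) δ :=
  (hp₀.contMDiffOn_comp.contMDiffAt (𝒢.isOpen_compl_kerCotRng.mem_nhds hδ)).mdifferentiableAt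
    (by simp)

/-- `p` does not change when a covector `β ∘ ds` is added to `ξ`, because `r_Γ` does not. Its
derivative in that vertical direction is `β(ds(H_p))`, which is therefore zero for every `β`. -/
lemma IsHomogeneousSymbol.dsrc_hamVec {δ : CotangentBundle E G} (hδ : δ ∈ 𝒢.kerCotRngᶜ) :
    𝒢.dsrc δ.1 (hamVec (p₀ ∘ 𝒢.cotRng) δ).1 = 0 := by
  rw [SeparatingDual.eq_zero_iff_forall_dual_eq_zero (R := ℝ)]
  intro β
  set ζ : E →L[ℝ] ℝ := ContinuousLinearMap.comp (β : F →L[ℝ] ℝ) (𝒢.dsrc δ.1) with hζ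
  have h1 : symp (hamVec (p₀ ∘ 𝒢.cotRng) δ) ((0 : E), ζ) =
      β (𝒢.dsrc δ.1 (hamVec (p₀ ∘ 𝒢.cotRng) δ).1) := by
    simp [symp, hζ]
  rw [← h1, symp_hamVec]
  have h2 : HasMD 𝓘(ℝ, ℝ) 𝓘(ℝ, E →L[ℝ] ℝ) (fun a : ℝ ↦ δ.form + a • ζ) 0
      ((1 : ℝ →L[ℝ] ℝ).smulRight ζ) :=
    hasMD_iff_hasFDerivAt.2 (((1 : ℝ →L[ℝ] ℝ).smulRight ζ).hasFDerivAt.const_add _)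
  have h3 : HasMD 𝓘(ℝ, E →L[ℝ] ℝ) (cotangentModel E) (cotMk δ.1) (δ.form + (0 : ℝ) • ζ)
      (.inr ℝ E (E →L[ℝ] ℝ)) := hasMD_cotMk _ _
  have h4 := (hp₀.mdifferentiableAt hδ).hasMD.comp_of_eq
    (HasMD.comp (f := fun a : ℝ ↦ δ.form + a • ζ) h3 h2) (by
    simp [cotMk_self])
  have h5 := (h4.congr_deriv rfl).unique ((hasMD_const (I := 𝓘(ℝ, ℝ)) (J := 𝓘(ℝ, ℝ))
    ((p₀ ∘ 𝒢.cotRng) δ) (0 : ℝ)).congr (Eventually.of_forall fun a ↦ ?_))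
  · simpa using congrArg (fun A : ℝ →L[ℝ] ℝ ↦ A 1) h5
  · change p₀ (𝒢.cotRng (cotMk δ.1 (δ.form + a • ζ))) = _
    have h6 : a • ζ = (a • (β : F →L[ℝ] ℝ)).comp (𝒢.dsrc δ.1) := by rw [hζ]; rfl
    rw [h6, cotRng_add_comp_dsrc]
    rfl

/-- The source of the base point is constant along the Hamiltonian curves. -/
lemma IsHomogeneousSymbol.src_eq {c : ℝ → CotangentBundle E G} {s : Set ℝ} (hs : IsOpen s)
    (hs' : IsPreconnected s) (h : IsHamOn (p₀ ∘ 𝒢.cotRng) 𝒢.kerCotRngᶜ c s) {t₀ t : ℝ}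
    (ht₀ : t₀ ∈ s) (ht : t ∈ s) : 𝒢.src (c t).1 = 𝒢.src (c t₀).1 := by
  refine eq_of_hasMD_zero (c := fun t ↦ 𝒢.src (c t).1) (F := F) hs hs' (fun τ hτ ↦ ?_) ht₀ ht
  have h1 := ((𝒢.hasMD_src (c τ).1).comp (hasMD_cotangent_proj (c τ))).comp_smulRight (h τ hτ).2
  refine h1.congr_deriv ?_
  change (1 : ℝ →L[ℝ] ℝ).smulRight (𝒢.dsrc (c τ).1 (hamVec (p₀ ∘ 𝒢.cotRng) (c τ)).1) = 0
  rw [hp₀.dsrc_hamVec (h τ hτ).1]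
  ext
  simp

/-- The lift preserves `α` up to an exact form and preserves `p`, hence carries Hamiltonian vectors
to Hamiltonian vectors, as long as the sources remain in the domain `V` of the bisection. -/
lemma IsLocalBisection.isHamOn_cotTransl {σ : M → G} {κ : M → M} {V : Set M} {f : M → ℝ}
    (hB : 𝒢.IsLocalBisection σ κ V) (hf : ∀ y ∈ V, ContMDiffAt 𝓘(ℝ, F) 𝓘(ℝ, ℝ) 3 f y)
    {c : ℝ → CotangentBundle E G} {s : Set ℝ} (h : IsHamOn (p₀ ∘ 𝒢.cotRng) 𝒢.kerCotRngᶜ c s)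
    (hV : ∀ t ∈ s, 𝒢.src (c t).1 ∈ V) :
    IsHamOn (p₀ ∘ 𝒢.cotRng) 𝒢.kerCotRngᶜ (fun t ↦ 𝒢.cotTransl σ κ f (c t)) s := by
  intro t ht
  obtain ⟨h1, h2⟩ := h t ht
  have h3 := hB.contMDiffAt_cotTransl (hf _ (hV t ht)) (hV t ht)
  have hev : ∀ᶠ δ : CotangentBundle E G in 𝓝 (c t), 𝒢.src δ.1 ∈ V :=
    (hasMD_cotangent_proj (c t)).continuousAt.eventually (hB.eventually_src_mem (hV t ht))
  have hmem : 𝒢.cotTransl σ κ f (c t) ∈ 𝒢.kerCotRngᶜ := by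
    rw [mem_compl_iff, mem_kerCotRng_iff, hB.cotRng_cotTransl (hf _ (hV t ht)) (hV t ht)]
    exact h1
  have h23 : (2 : WithTop ℕ∞) ≤ 3 := by norm_num
  have hφ : ContMDiffAt (cotangentModel E) 𝓘(ℝ, ℝ) 2
      (fun δ : CotangentBundle E G ↦ f (𝒢.src δ.1)) (c t) :=
    ((hf _ (hV t ht)).of_le h23).comp (c t) ((𝒢.contMDiff_src.contMDiffAt.of_le
      (show ((2 : ℕ∞) : WithTop ℕ∞) ≤ ∞ from mod_cast le_top)).comp (c t)
        contMDiff_cotangent_proj.contMDiffAt)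
  refine ⟨hmem, h2.comp_map (h3.mdifferentiableAt (by simp)) ?_⟩
  refine md_hamVec (a := 1) one_ne_zero h3 hφ ?_ (hp₀.mdifferentiableAt hmem)
    (hp₀.mdifferentiableAt h1) ?_
  · filter_upwards [hev] with z hz
    rw [hB.canForm_cotTransl (hf _ hz) hz, one_smul]
  · filter_upwards [hev] with z hz
    rw [one_mul, Function.comp_apply, hB.cotRng_cotTransl (hf _ hz) hz]
    rfl

/-- Every Hamiltonian curve through `r_Γ(δ)` is translated to one through `δ`. -/
lemma IsHomogeneousSymbol.exists_isHamOn_of_cotRng {δ : CotangentBundle E G} {ε : ℝ} (hε : 0 < ε)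
    (h : ∃ c : ℝ → CotangentBundle E G, c 0 = 𝒢.cotRng δ ∧
      IsHamOn (p₀ ∘ 𝒢.cotRng) 𝒢.kerCotRngᶜ c (Ioo (-ε) ε)) :
    ∃ c : ℝ → CotangentBundle E G, c 0 = δ ∧
      IsHamOn (p₀ ∘ 𝒢.cotRng) 𝒢.kerCotRngᶜ c (Ioo (-ε) ε) := by
  obtain ⟨c, hc0, hc⟩ := h
  obtain ⟨σ, κ, V, f, hB, hV, -, hf, hδ⟩ := exists_cotTransl 𝒢 δ
  refine ⟨fun t ↦ 𝒢.cotTransl σ κ f (c t), (congrArg _ hc0).trans hδ,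
    IsLocalBisection.isHamOn_cotTransl hp₀ hB hf hc fun t ht ↦ ?_⟩
  -- The source is constant along `c`, equal to `r(γ)`, so `c` never leaves the domain of the
  -- translation and no time of existence is lost.
  rw [hp₀.src_eq isOpen_Ioo isPreconnected_Ioo hc (t₀ := 0) ⟨by simpa using hε, hε⟩ ht, hc0]
  change 𝒢.src (𝒢.unit (𝒢.rng δ.1)) ∈ V
  rwa [𝒢.src_unit]

lemma IsHomogeneousSymbol.isHamOn_dilation {a : ℝ} (ha : 0 < a) {c : ℝ → CotangentBundle E G}
    {s : Set ℝ} (h : IsHamOn (p₀ ∘ 𝒢.cotRng) 𝒢.kerCotRngᶜ c s) :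
    IsHamOn (p₀ ∘ 𝒢.cotRng) 𝒢.kerCotRngᶜ (fun t ↦ dilation a (c t)) s :=
  h.dilation 𝒢.isOpen_compl_kerCotRng hp₀.contMDiffOn_comp ha.ne'
    (fun _ hδ ↦ dilation_mem_compl_kerCotRng ha.ne' hδ) fun _ hδ ↦ hp₀.comp_dilation ha hδ

omit hp₀ in
lemma isClosed_dualAlgebroid [T2Space G] : IsClosed 𝒢.dualAlgebroid := by
  have : 𝒢.dualAlgebroid = {δ | 𝒢.cotRng δ = δ} := by
    ext δ
    refine ⟨fun h ↦ 𝒢.cotRng_of_mem h, fun h ↦ ?_⟩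
    replace h : 𝒢.cotRng δ = δ := h
    rw [← h]
    exact 𝒢.cotRng_mem δ
  rw [this]
  exact isClosed_eq 𝒢.contMDiff_cotRng.continuous continuous_id

/-- The times of existence of the Hamiltonian curves are locally bounded below. -/
lemma IsHomogeneousSymbol.eventually_exists_isHamOn [T2Space G] {δ₀ : CotangentBundle E G}
    (hδ₀ : δ₀.form ≠ 0) : ∀ᶠ z : ℝ × CotangentBundle E G in 𝓝 (0, δ₀), 0 < z.1 →
      z.2 ∈ 𝒢.dualAlgebroidNonzero → ∃ c : ℝ → CotangentBundle E G, c 0 = z.2 ∧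
        IsHamOn (p₀ ∘ 𝒢.cotRng) 𝒢.kerCotRngᶜ c (Ioo (-z.1) z.1) := by
  -- The claim is made for all nonzero covectors so that a full unit sphere of the dual of the model
  -- space can be used later. Outside the closed set `A*G` it is vacuous near `δ₀`.
  by_cases hmem : δ₀ ∈ 𝒢.dualAlgebroid
  · obtain ⟨Φ, -, ε, hε, h⟩ := exists_local_hamFlow 𝒢.isOpen_compl_kerCotRng hp₀.contMDiffOn_comp
      (𝒢.notMem_kerCotRng ⟨hmem, hδ₀⟩)
    have h1 : ∀ᶠ z : ℝ × CotangentBundle E G in 𝓝 (0, δ₀), z.1 < ε :=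
      continuousAt_fst.eventually (Iio_mem_nhds hε)
    have h2 : ∀ᶠ z : ℝ × CotangentBundle E G in 𝓝 (0, δ₀), _ := continuousAt_snd.eventually h
    filter_upwards [h1, h2] with z hz1 hz2 _ _
    exact ⟨_, hz2.1, hz2.2.mono (Ioo_subset_Ioo (neg_le_neg hz1.le) hz1.le)⟩
  · have h1 : ∀ᶠ z : ℝ × CotangentBundle E G in 𝓝 (0, δ₀), z.2 ∈ 𝒢.dualAlgebroidᶜ :=
      continuousAt_snd.eventually (isClosed_dualAlgebroid.isOpen_compl.mem_nhds hmem)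
    filter_upwards [h1] with z hz _ hz'
    exact absurd hz'.1 hz

/-- In a chart, the local bounds hold along the compact unit sphere of covectors, uniformly for
units near `υ(x)`; dilations extend them to all nonzero elements of `A*G` there. -/
lemma IsHomogeneousSymbol.eventually_forall_exists_isHamOn [T2Space G] (x : M) :
    ∀ᶠ z : ℝ × M in 𝓝 (0, x), 0 < z.1 → ∀ δ ∈ 𝒢.dualAlgebroidNonzero, δ.1 = 𝒢.unit z.2 →
      ∃ c : ℝ → CotangentBundle E G, c 0 = δ ∧
        IsHamOn (p₀ ∘ 𝒢.cotRng) 𝒢.kerCotRngᶜ c (Ioo (-z.1) z.1) := by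
  -- The chart of `T*G` at the zero covector contains all the covectors over the chart of `G`.
  set δ₀ : CotangentBundle E G := cotMk (𝒢.unit x) 0 with hδ₀
  set φ := extChartAt 𝓘(ℝ, E) (𝒢.unit x) with hφ
  set Φ := extChartAt (cotangentModel E) δ₀ with hΦ
  have hφx : φ (𝒢.unit x) ∈ φ.target := mem_extChartAt_target _
  have key : ∀ ξ ∈ Metric.sphere (0 : E →L[ℝ] ℝ) 1,
      ∀ᶠ w : (ℝ × M) × (E →L[ℝ] ℝ) in 𝓝 ((0, x), ξ), 0 < w.1.1 →
        Φ.symm (φ (𝒢.unit w.1.2), w.2) ∈ 𝒢.dualAlgebroidNonzero →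
          ∃ c : ℝ → CotangentBundle E G, c 0 = Φ.symm (φ (𝒢.unit w.1.2), w.2) ∧
            IsHamOn (p₀ ∘ 𝒢.cotRng) 𝒢.kerCotRngᶜ c (Ioo (-w.1.1) w.1.1) := by
    intro ξ hξ
    have ht : (φ (𝒢.unit x), ξ) ∈ Φ.target :=
      (mem_extChartAt_cotangent_target δ₀ (φ (𝒢.unit x), ξ)).2 hφx
    have hne : (Φ.symm (φ (𝒢.unit x), ξ)).form ≠ 0 := by
      intro h0
      have h1 := (extChartAt_cotangent_symm δ₀ ht).2
      rw [← hΦ, h0, ContinuousLinearMap.zero_comp] at h1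
      have h2 : ξ = 0 := h1.symm
      rw [h2] at hξ
      simp at hξ
    have hc : ContinuousAt (fun w : (ℝ × M) × (E →L[ℝ] ℝ) ↦
        (w.1.1, Φ.symm (φ (𝒢.unit w.1.2), w.2))) ((0, x), ξ) := by
      have h1 : ContinuousAt (fun w : (ℝ × M) × (E →L[ℝ] ℝ) ↦ φ (𝒢.unit w.1.2)) ((0, x), ξ) :=
        ContinuousAt.comp (g := φ) (continuousAt_extChartAt (I := 𝓘(ℝ, E)) (𝒢.unit x))
          (𝒢.contMDiff_unit.continuous.continuousAt.comp
            (continuousAt_snd.comp continuousAt_fst))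
      have h2 : ContinuousAt Φ.symm (φ (𝒢.unit x), ξ) := continuousAt_extChartAt_symm'' ht
      have h3 : ContinuousAt (fun w : (ℝ × M) × (E →L[ℝ] ℝ) ↦ (φ (𝒢.unit w.1.2), w.2))
        ((0, x), ξ) := h1.prodMk continuousAt_snd
      exact (continuousAt_fst.comp continuousAt_fst).prodMk (ContinuousAt.comp (g := Φ.symm) h2 h3)
    exact hc.eventually (hp₀.eventually_exists_isHamOn hne)
  have hK := (isCompact_sphere (0 : E →L[ℝ] ℝ) 1).eventually_forall_of_forall_eventually
    (x₀ := ((0 : ℝ), x)) (P := fun z ξ ↦ 0 < z.1 →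
      Φ.symm (φ (𝒢.unit z.2), ξ) ∈ 𝒢.dualAlgebroidNonzero →
        ∃ c : ℝ → CotangentBundle E G, c 0 = Φ.symm (φ (𝒢.unit z.2), ξ) ∧
          IsHamOn (p₀ ∘ 𝒢.cotRng) 𝒢.kerCotRngᶜ c (Ioo (-z.1) z.1)) key
  have hsrc : ∀ᶠ z : ℝ × M in 𝓝 (0, x), 𝒢.unit z.2 ∈ (chartAt E (𝒢.unit x)).source :=
    (𝒢.contMDiff_unit.continuous.continuousAt.comp continuousAt_snd).eventually
      ((chartAt E (𝒢.unit x)).open_source.mem_nhds (mem_chart_source E (𝒢.unit x)))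
  filter_upwards [hK, hsrc] with z hz hzs hz0 δ hδ hδz
  rw [← hδz] at hzs
  set ξ := cotCoord δ₀.1 δ with hξ
  have hchart := extChartAt_cotangent δ₀ (δ := δ) hzs
  have hξ0 : ξ ≠ 0 := by
    intro h0
    have h1 := (extChartAt_cotangent_symm δ₀ (y := Φ δ)
      (Φ.map_source ((mem_extChartAt_cotangent_source δ₀ δ).2 hzs))).2
    rw [← hΦ, Φ.left_inv ((mem_extChartAt_cotangent_source δ₀ δ).2 hzs), hchart] at h1
    change δ.form.comp (md 𝓘(ℝ, E) 𝓘(ℝ, E) φ.symm (φ δ.1)) = ξ at h1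
    have h2 := congrArg (fun A : E →L[ℝ] ℝ ↦
      A.comp (md 𝓘(ℝ, E) 𝓘(ℝ, E) φ δ.1)) h1
    simp only [ContinuousLinearMap.comp_assoc] at h2
    rw [md_extChartAt_symm_comp (𝒢.unit x) hzs, ContinuousLinearMap.comp_id, h0,
      ContinuousLinearMap.zero_comp] at h2
    exact hδ.2 h2
  have hpos : 0 < ‖ξ‖ := norm_pos_iff.2 hξ0
  -- Normalization to the unit sphere of the chart; the dilation by `‖ξ‖` later carries the curve
  -- back without changing its interval of definition.
  set δ' := dilation ‖ξ‖⁻¹ δ with hδ'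
  have hmem : δ' ∈ 𝒢.dualAlgebroidNonzero := dilation_mem_dualAlgebroidNonzero (inv_ne_zero hpos.ne') hδ
  have hδ'z : Φ.symm (φ (𝒢.unit z.2), ‖ξ‖⁻¹ • ξ) = δ' := by
    have h1 := extChartAt_cotangent δ₀ (δ := δ') hzs
    have h2 := Φ.left_inv ((mem_extChartAt_cotangent_source δ₀ δ').2 hzs)
    rw [h1] at h2
    rw [← hδz]
    exact h2
  have := hz (‖ξ‖⁻¹ • ξ) (by simp [norm_smul, hpos.ne']) hz0
  rw [hδ'z] at this
  obtain ⟨c, hc0, hc⟩ := this hmem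
  refine ⟨_, ?_, hp₀.isHamOn_dilation hpos hc⟩
  rw [hc0, hδ', dilation_dilation_inv hpos.ne']

variable [T2Space G] [CompactSpace M]

/-- Compactness of `M` gives one `ε` valid on all of `A*G ∖ 0`. Translation transfers it to every
`δ` outside `ker r_Γ`, and a uniform time of existence implies completeness. -/
theorem IsHomogeneousSymbol.exists_isHamFlow :
    ∃ χ, IsHamFlow (p₀ ∘ 𝒢.cotRng) 𝒢.kerCotRngᶜ χ := by
  have h := (isCompact_univ (X := M)).eventually_forall_of_forall_eventually
    (x₀ := (0 : ℝ)) (P := fun ε x ↦ 0 < ε → ∀ δ ∈ 𝒢.dualAlgebroidNonzero, δ.1 = 𝒢.unit x →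
      ∃ c : ℝ → CotangentBundle E G, c 0 = δ ∧
        IsHamOn (p₀ ∘ 𝒢.cotRng) 𝒢.kerCotRngᶜ c (Ioo (-ε) ε)) fun x _ ↦ hp₀.eventually_forall_exists_isHamOn x
  obtain ⟨ε, hε, hε0⟩ := ((h.filter_mono nhdsWithin_le_nhds).and
    (self_mem_nhdsWithin (s := Ioi (0 : ℝ)))).exists
  refine _root_.exists_isHamFlow (exists_isHamOn_of_uniform 𝒢.isOpen_compl_kerCotRng
    hp₀.contMDiffOn_comp hε0 fun δ hδ ↦ hp₀.exists_isHamOn_of_cotRng hε0 ?_)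
  exact hε (𝒢.rng δ.1) (mem_univ _) hε0 _ (𝒢.cotRng_mem_nonzero hδ) rfl

end Completeness

end LieGroupoid

/-! ### The flow and the multiplication of the cotangent groupoid -/

namespace LieGroupoid

section FlowProduct

set_option synthInstance.maxHeartbeats 200000

variable {E F G M : Type*}
  [NormedAddCommGroup E] [NormedSpace ℝ E] [FiniteDimensional ℝ E]
  [NormedAddCommGroup F] [NormedSpace ℝ F] [FiniteDimensional ℝ F]
  [TopologicalSpace G] [ChartedSpace E G] [IsManifold 𝓘(ℝ, E) ∞ G]
  [TopologicalSpace M] [ChartedSpace F M] [IsManifold 𝓘(ℝ, F) ∞ M]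
  {𝒢 : LieGroupoid E F G M}

/-- Right-invariance of `r_Γ` in the pullback direction, where `s ∘ σ` need not be invertible. -/
lemma cotRng_comp_md_transl {σ : M → G} {γ : G} {B : F →L[ℝ] E}
    (hσ : HasMD 𝓘(ℝ, F) 𝓘(ℝ, E) σ (𝒢.src γ) B)
    (hrσ : ∀ᶠ x in 𝓝 (𝒢.src γ), 𝒢.rng (σ x) = x) (ξ : E →L[ℝ] ℝ) :
    𝒢.cotRng (cotMk γ (ξ.comp (md 𝓘(ℝ, E) 𝓘(ℝ, E) (𝒢.transl σ) γ))) =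
      𝒢.cotRng (cotMk (𝒢.transl σ γ) ξ) := by
  have hr : 𝒢.rng (𝒢.transl σ γ) = 𝒢.rng γ := 𝒢.rng_mul _ _ hrσ.self_of_nhds.symm
  refine CotangentBundle.ext_form ?_ ?_
  · change 𝒢.unit (𝒢.rng γ) = 𝒢.unit (𝒢.rng (𝒢.transl σ γ))
    rw [hr]
  · change (ξ.comp (md 𝓘(ℝ, E) 𝓘(ℝ, E) (𝒢.transl σ) γ)).comp ((𝒢.dRightMul γ).comp
        (𝒢.algebroidProj (𝒢.rng γ))) = ξ.comp ((𝒢.dRightMul (𝒢.transl σ γ)).comp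
          (𝒢.algebroidProj (𝒢.rng (𝒢.transl σ γ))))
    rw [hr, dRightMul_transl hσ hrσ, ContinuousLinearMap.comp_assoc]

/-- A smooth family in the fiber of `r_Γ` over `η`, passing through `η`. -/
lemma exists_cotRng_family {η : CotangentBundle E G} {x : M} (hx : η.1 = 𝒢.unit x)
    (hη : η ∈ 𝒢.dualAlgebroid) :
    ∃ (D : G → CotangentBundle E G) (B : E →L[ℝ] E),
      ContMDiffAt 𝓘(ℝ, E) (cotangentModel E) ∞ D (𝒢.unit x) ∧ D (𝒢.unit x) = η ∧
      (∀ᶠ γ in 𝓝 (𝒢.unit x), 𝒢.cotRng (D γ) = η) ∧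
      HasMD 𝓘(ℝ, E) 𝓘(ℝ, E) (fun γ ↦ (D γ).1) (𝒢.unit x) B ∧
      ∀ Y, 𝒢.drng (𝒢.unit x) Y = 0 → B Y = Y := by
  obtain ⟨σ, hσ, hrσ, hσγ, hσd⟩ := exists_section (𝒢.contMDiff_rng (𝒢.unit x))
    (A := 𝒢.dunit x) (𝒢.drng_dunit x)
  have hrx : 𝒢.rng (𝒢.unit x) = x := 𝒢.rng_unit x
  have hev := eventually_section (hasMD_rng 𝒢 (𝒢.unit x)).continuousAt hσ hrσ
  have hσσ : σ (𝒢.unit x, x) = 𝒢.unit x := by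
    have := hσγ.self_of_nhds
    rwa [hrx] at this
  have hσr := hσ
  rw [hrx] at hσ hrσ hσd
  -- `b` moves `γ` into the `r`-fiber over `x` along the local sections of `r`.
  set b : G → G := fun γ ↦ σ (γ, x) with hb
  have hbs : ContMDiffAt 𝓘(ℝ, E) 𝓘(ℝ, E) ∞ b (𝒢.unit x) :=
    ContMDiffAt.comp (g := σ) (𝒢.unit x) hσ (contMDiffAt_id.prodMk contMDiffAt_const)
  have hbx : b (𝒢.unit x) = 𝒢.unit x := hσσ
  have hib : ContMDiffAt 𝓘(ℝ, E) 𝓘(ℝ, E) ∞ (fun γ ↦ 𝒢.inv (b γ)) (𝒢.unit x) :=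
    𝒢.contMDiff_inv.contMDiffAt.comp (𝒢.unit x) hbs
  have hibx : 𝒢.inv (b (𝒢.unit x)) = 𝒢.unit x := by rw [hbx, 𝒢.inv_unit]
  have hrb : ∀ᶠ γ in 𝓝 (𝒢.unit x), 𝒢.rng (b γ) = x :=
    (continuousAt_id.prodMk (continuousAt_const (y := x))).eventually hrσ
  have hibt : Tendsto (fun γ ↦ 𝒢.inv (b γ)) (𝓝 (𝒢.unit x)) (𝓝 (𝒢.unit x)) := by
    have := hib.continuousAt
    rwa [ContinuousAt, hibx] at this
  have htr : ∀ᶠ γ in 𝓝 (𝒢.unit x),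
      𝒢.transl (fun y ↦ σ (𝒢.inv (b γ), y)) (b γ) = 𝒢.unit x := by
    filter_upwards [hibt.eventually hσγ, hrb] with γ h1 h2
    rw [𝒢.rng_inv] at h1
    rw [transl, h1, 𝒢.mul_inv, h2]
  -- Translation by the section through `b(γ)⁻¹` maps `b(γ)` to `υ(x)`. Pulling `η` back by it gives
  -- a covector at `b(γ)` whose range is still `r_Γ(η) = η`.
  set D : G → CotangentBundle E G := fun γ ↦ cotMk (b γ) (η.form.comp
    (md 𝓘(ℝ, E) 𝓘(ℝ, E) (𝒢.transl fun y ↦ σ (𝒢.inv (b γ), y)) (b γ))) with hD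
  have hBd := hbs.hasMD (by simp)
  refine ⟨D, md 𝓘(ℝ, E) 𝓘(ℝ, E) b (𝒢.unit x), ?_, ?_, ?_, hBd, fun Y hY ↦ ?_⟩
  · have hh : ContMDiffAt (𝓘(ℝ, E).prod 𝓘(ℝ, E)) 𝓘(ℝ, E) ∞
        (Function.uncurry fun γ g ↦ 𝒢.transl (fun y ↦ σ (𝒢.inv (b γ), y)) g)
        (𝒢.unit x, b (𝒢.unit x)) := by
      have h1 : ContMDiffAt (𝓘(ℝ, E).prod 𝓘(ℝ, E)) (𝓘(ℝ, E).prod 𝓘(ℝ, F)) ∞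
          (fun z : G × G ↦ (𝒢.inv (b z.1), 𝒢.src z.2)) (𝒢.unit x, b (𝒢.unit x)) :=
        (ContMDiffAt.comp (g := fun γ ↦ 𝒢.inv (b γ)) (𝒢.unit x, b (𝒢.unit x)) hib
          contMDiffAt_fst).prodMk (𝒢.contMDiff_src.contMDiffAt.comp _ contMDiffAt_snd)
      have h2 : (𝒢.inv (b (𝒢.unit x)), 𝒢.src (b (𝒢.unit x))) = (𝒢.unit x, x) := by
        rw [hibx, hbx, 𝒢.src_unit]
      have h3 : Tendsto (fun z : G × G ↦ (𝒢.inv (b z.1), 𝒢.src z.2))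
          (𝓝 (𝒢.unit x, b (𝒢.unit x))) (𝓝 (𝒢.unit x, x)) := by
        have := h1.continuousAt
        rwa [ContinuousAt, h2] at this
      refine 𝒢.contMDiffAt_mul le_rfl contMDiffAt_snd
        (ContMDiffAt.comp_of_eq (g := σ) hσ h1 h2) ?_
      filter_upwards [h3.eventually hrσ] with z hz
      exact hz.symm
    refine ContMDiffAt.covector_comp (δ := fun _ ↦ η) contMDiffAt_const hbs hh (by simp) ?_
    filter_upwards [htr] with γ h
    rw [h, hx]
  · refine CotangentBundle.ext_form (hbx.trans hx.symm) ?_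
    change η.form.comp (md 𝓘(ℝ, E) 𝓘(ℝ, E)
      (𝒢.transl fun y ↦ σ (𝒢.inv (b (𝒢.unit x)), y)) (b (𝒢.unit x))) = η.form
    rw [hibx, hbx]
    have h1 : HasMD 𝓘(ℝ, F) 𝓘(ℝ, E) (fun y ↦ σ (𝒢.unit x, y)) (𝒢.src (𝒢.unit x)) (𝒢.dunit x) := by
      rwa [𝒢.src_unit]
    have h2 : ∀ᶠ y in 𝓝 (𝒢.src (𝒢.unit x)), 𝒢.rng (σ (𝒢.unit x, y)) = y := by
      rw [𝒢.src_unit]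
      exact ((continuousAt_const (y := 𝒢.unit x)).prodMk continuousAt_id).eventually hrσ
    have h3 : md 𝓘(ℝ, E) 𝓘(ℝ, E) (𝒢.transl fun y ↦ σ (𝒢.unit x, y)) (𝒢.unit x) = _ :=
      (𝒢.hasMD_mul_section h1 h2).md_eq
    rw [h3, 𝒢.src_unit, hσσ]
    refine ContinuousLinearMap.ext fun w ↦ congrArg η.form ?_
    have h4 := 𝒢.dmul_dunit_right (𝒢.unit x) w
    rwa [𝒢.src_unit] at h4
  · filter_upwards [hibt.eventually hev, htr] with γ h1 h2
    obtain ⟨h3, h4⟩ := h1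
    rw [𝒢.rng_inv] at h3 h4
    rw [hD]
    dsimp only
    rw [cotRng_comp_md_transl h4.hasMD h3, h2, ← hx]
    exact 𝒢.cotRng_of_mem hη
  -- From `σ(γ, r(γ)) = γ`: on vectors with `dr Y = 0`, only the derivative of `σ` in its first
  -- variable contributes, and that is the derivative of `b`.
  · have h1 := hσ.hasMD (by simp)
    have h2 : HasMD 𝓘(ℝ, E) 𝓘(ℝ, E) (fun γ ↦ σ (γ, 𝒢.rng γ)) (𝒢.unit x) _ :=
      HasMD.comp_of_eq (g := σ) h1 ((hasMD_id _).prodMk (𝒢.hasMD_rng (𝒢.unit x)))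
        (by rw [hrx])
    have h3 := h2.unique ((hasMD_id _).congr hσγ)
    have h4 : HasMD 𝓘(ℝ, E) 𝓘(ℝ, E) b (𝒢.unit x) _ :=
      HasMD.comp_of_eq (g := σ) h1 ((hasMD_id _).prodMk (hasMD_const x _)) rfl
    have h5 := congrArg (fun A : E →L[ℝ] E ↦ A Y) h3
    rw [h4.md_eq]
    simpa [hY] using h5

variable [T2Space G] {p₀ : CotangentBundle E G → ℝ} (hp₀ : 𝒢.IsHomogeneousSymbol p₀)
  {χ : ℝ → CotangentBundle E G → CotangentBundle E G}
  (hχ : IsHamFlow (p₀ ∘ 𝒢.cotRng) 𝒢.kerCotRngᶜ χ)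

include hp₀ hχ

omit [T2Space G] in
lemma src_flow {δ : CotangentBundle E G} (hδ : δ ∈ 𝒢.kerCotRngᶜ) (t : ℝ) :
    𝒢.src (χ t δ).1 = 𝒢.src δ.1 := by
  have := hp₀.src_eq isOpen_univ isPreconnected_univ (hχ δ hδ).2 (mem_univ 0) (mem_univ t)
  rwa [hχ.zero hδ] at this

lemma flow_dilation {a : ℝ} (ha : 0 < a) {δ : CotangentBundle E G} (hδ : δ ∈ 𝒢.kerCotRngᶜ)
    (t : ℝ) : χ t (dilation a δ) = dilation a (χ t δ) := by
  have h1 := hp₀.isHamOn_dilation ha (hχ δ hδ).2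
  have h2 := hχ.eq_of_isHamAt 𝒢.isOpen_compl_kerCotRng hp₀.contMDiffOn_comp
    (h1 0 trivial).1 (fun τ ↦ (h1 τ trivial).2) t
  rw [hχ.zero hδ] at h2
  exact h2.symm

/-- The flow commutes with the lifts of local bisections. -/
lemma exists_flow_eq_cotTransl {δ : CotangentBundle E G} (hδ : δ ∈ 𝒢.kerCotRngᶜ) :
    ∃ (σ : M → G) (κ : M → M) (V : Set M) (f : M → ℝ), 𝒢.IsLocalBisection σ κ V ∧
      𝒢.rng δ.1 ∈ V ∧ σ (𝒢.rng δ.1) = δ.1 ∧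
      (∀ y ∈ V, ContMDiffAt 𝓘(ℝ, F) 𝓘(ℝ, ℝ) 3 f y) ∧ 𝒢.cotTransl σ κ f (𝒢.cotRng δ) = δ ∧
      ∀ t, 𝒢.src (χ t (𝒢.cotRng δ)).1 = 𝒢.rng δ.1 ∧
        χ t δ = 𝒢.cotTransl σ κ f (χ t (𝒢.cotRng δ)) := by
  obtain ⟨σ, κ, V, f, hB, hV, hσ, hf, hΨ⟩ := exists_cotTransl 𝒢 δ
  have hη : 𝒢.cotRng δ ∈ 𝒢.kerCotRngᶜ := 𝒢.notMem_kerCotRng (𝒢.cotRng_mem_nonzero hδ)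
  have hs : ∀ t, 𝒢.src (χ t (𝒢.cotRng δ)).1 = 𝒢.rng δ.1 := fun t ↦
    (src_flow hp₀ hχ hη t).trans (𝒢.src_unit _)
  refine ⟨σ, κ, V, f, hB, hV, hσ, hf, hΨ, fun t ↦ ⟨hs t, ?_⟩⟩
  have h1 := IsLocalBisection.isHamOn_cotTransl hp₀ hB hf (hχ _ hη).2 fun t _ ↦ by
    rwa [hs t]
  have h2 := hχ.eq_of_isHamAt 𝒢.isOpen_compl_kerCotRng hp₀.contMDiffOn_comp
    (h1 0 trivial).1 (fun τ ↦ (h1 τ trivial).2) t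
  rw [hχ.zero hη, hΨ] at h2
  exact h2.symm

/-- `χ_t(δ)` is the lifted translate of `χ_t(r_Γ(δ))`, whose source is `r(γ)`; at such a point,
translation is multiplication by `σ(r(γ)) = γ`. -/
lemma flow_proj {δ : CotangentBundle E G} (hδ : δ ∈ 𝒢.kerCotRngᶜ) (t : ℝ) :
    (χ t δ).1 = 𝒢.mul (χ t (𝒢.cotRng δ)).1 δ.1 := by
  obtain ⟨σ, κ, V, f, hB, hV, hσ, hf, hΨ, h⟩ := exists_flow_eq_cotTransl hp₀ hχ hδ
  obtain ⟨h1, h2⟩ := h t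
  rw [h2]
  change 𝒢.mul _ (σ (𝒢.src _)) = _
  rw [h1, hσ]

lemma cotRng_flow {δ : CotangentBundle E G} (hδ : δ ∈ 𝒢.kerCotRngᶜ) (t : ℝ) :
    𝒢.cotRng (χ t δ) = 𝒢.cotRng (χ t (𝒢.cotRng δ)) := by
  obtain ⟨σ, κ, V, f, hB, hV, hσ, hf, hΨ, h⟩ := exists_flow_eq_cotTransl hp₀ hχ hδ
  obtain ⟨h1, h2⟩ := h t
  rw [h2, hB.cotRng_cotTransl (by rw [h1]; exact hf _ hV) (by rwa [h1])]

/-- The step that determines `s_Γ` on `Λ_t`. Along the family `D` in the fiber of `r_Γ` over `η`,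
the base point of `χ_t(D(γ))` is the fixed element `(χ_t η).1` times that of `D(γ)`. Pulling `α`
back by `χ_t ∘ D` therefore gives the left-hand side, and by `D` the right-hand side; the two agree
as `χ_t` preserves `α`. -/
lemma flow_form_dmul {η : CotangentBundle E G} {x : M} (hx : η.1 = 𝒢.unit x)
    (hη : η ∈ 𝒢.dualAlgebroidNonzero) (t : ℝ) {Y : E} (hY : 𝒢.drng (𝒢.unit x) Y = 0) :
    (χ t η).form (𝒢.dmul (χ t η).1 (𝒢.unit x) (0, Y)) = η.form Y := by
  obtain ⟨D, B, hD, hDx, hDr, hB, hBY⟩ := exists_cotRng_family hx hη.1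
  have hηU := 𝒢.notMem_kerCotRng hη
  have hU := 𝒢.isOpen_compl_kerCotRng
  have hDU : ∀ᶠ γ in 𝓝 (𝒢.unit x), D γ ∈ 𝒢.kerCotRngᶜ := by
    refine hD.continuousAt.eventually (hU.mem_nhds ?_)
    rwa [hDx]
  have hsx : 𝒢.src (χ t η).1 = x := by rw [src_flow hp₀ hχ hηU, hx, 𝒢.src_unit]
  have hDd := hD.hasMD (by simp)
  have hχd := (hχ.contMDiffAt_apply hU hp₀.contMDiffOn_comp hηU t).hasMD (by simp)
  have hcomp := hχd.comp_of_eq hDd hDx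
  have hbase : HasMD 𝓘(ℝ, E) 𝓘(ℝ, E) (fun γ ↦ (χ t (D γ)).1) (𝒢.unit x)
      ((𝒢.dmul (χ t η).1 (𝒢.unit x)).comp ((0 : E →L[ℝ] E).prod B)) := by
    have h1 := 𝒢.hasMD_mul (hasMD_const (I := 𝓘(ℝ, E)) (J := 𝓘(ℝ, E)) (χ t η).1 (𝒢.unit x)) hB (by
      filter_upwards [hDr] with γ hγ
      have h2 : 𝒢.unit (𝒢.rng (D γ).1) = η.1 := congrArg (fun δ : CotangentBundle E G ↦ δ.1) hγ
      rw [hsx, ← 𝒢.src_unit (𝒢.rng (D γ).1), h2, hx, 𝒢.src_unit])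
    rw [hDx, hx] at h1
    refine h1.congr ?_
    filter_upwards [hDr, hDU] with γ hγ hγU
    rw [flow_proj hp₀ hχ hγU, hγ]
  have h1 := canForm_comp hcomp hbase
  have h2 := canForm_comp hDd hB
  have h3 := hχ.canForm_comp_md hU hp₀.contMDiffOn_comp
    (fun δ hδ ↦ hp₀.canForm_hamVec hδ) hηU t
  rw [Function.comp_apply, hDx, ← ContinuousLinearMap.comp_assoc, h3] at h1
  rw [hDx, h1] at h2
  have h4 := congrArg (fun A : E →L[ℝ] ℝ ↦ A Y) h2
  simpa [hBY Y hY] using h4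

/-- The source of `χ_t(η)` is `η`. -/
lemma cotSrc_flow {η : CotangentBundle E G} (hη : η ∈ 𝒢.dualAlgebroidNonzero) (t : ℝ) :
    𝒢.cotSrc (χ t η) = η := by
  obtain ⟨x, hx, hξ⟩ := (𝒢.mem_dualAlgebroid_iff η).1 hη.1
  have hsx : 𝒢.src (χ t η).1 = x := by
    rw [src_flow hp₀ hχ (𝒢.notMem_kerCotRng hη), hx, 𝒢.src_unit]
  have hξ' : ∀ v, η.form (𝒢.dunit x v) = 0 := fun v ↦ congrArg (fun A : F →L[ℝ] ℝ ↦ A v) hξ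
  refine CotangentBundle.ext_form ?_ (ContinuousLinearMap.ext fun w ↦ ?_)
  · change 𝒢.unit (𝒢.src (χ t η).1) = η.1
    rw [hsx, hx]
  · change -(χ t η).form (𝒢.dmul (χ t η).1 (𝒢.unit (𝒢.src (χ t η).1))
      (0, 𝒢.dinv (𝒢.src (χ t η).1) (𝒢.algebroidProj (𝒢.src (χ t η).1) w))) = η.form w
    rw [hsx]
    set w' := 𝒢.algebroidProj x w with hw'
    have h0 := 𝒢.dsrc_algebroidProj x w
    -- The inversion sends a vector of `ker ds` to minus its component in `ker dr` along the units.
    -- The sign cancels that of `s_Γ`, and the component along the units is killed by `η`.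
    have h1 : 𝒢.dinv x w' = -(w' - 𝒢.dunit x (𝒢.drng (𝒢.unit x) w')) := by
      rw [𝒢.dinv_apply, hw', h0, map_zero, add_zero, neg_sub]
    have h2 : ((0 : E), 𝒢.dinv x w') =
        -((0 : E), w' - 𝒢.dunit x (𝒢.drng (𝒢.unit x) w')) := by
      rw [h1, Prod.neg_mk, neg_zero]
    rw [h2, map_neg, map_neg, neg_neg, flow_form_dmul hp₀ hχ hx hη t
      (by rw [map_sub, 𝒢.drng_dunit_apply, sub_self]), map_sub, hξ', sub_zero, hw',
      𝒢.algebroidProj_apply, map_sub, hξ', sub_zero]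

end FlowProduct

end LieGroupoid

/-! ### The product formula for the flow and for the relations `Λ_t`. -/

namespace LieGroupoid

section FlowProduct

set_option synthInstance.maxHeartbeats 200000

variable {E F G M : Type*}
  [NormedAddCommGroup E] [NormedSpace ℝ E] [FiniteDimensional ℝ E]
  [NormedAddCommGroup F] [NormedSpace ℝ F] [FiniteDimensional ℝ F]
  [TopologicalSpace G] [ChartedSpace E G] [IsManifold 𝓘(ℝ, E) ∞ G]
  [TopologicalSpace M] [ChartedSpace F M] [IsManifold 𝓘(ℝ, F) ∞ M]
  {𝒢 : LieGroupoid E F G M}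

omit [FiniteDimensional ℝ E] [FiniteDimensional ℝ F]
  [IsManifold 𝓘(ℝ, E) ∞ G] [IsManifold 𝓘(ℝ, F) ∞ M] in
lemma rng_eq_src_of_cotSrc_eq {δ₁ δ₂ : CotangentBundle E G} (h : 𝒢.cotSrc δ₁ = 𝒢.cotRng δ₂) :
    𝒢.rng δ₂.1 = 𝒢.src δ₁.1 := by
  have h1 : 𝒢.unit (𝒢.src δ₁.1) = 𝒢.unit (𝒢.rng δ₂.1) :=
    congrArg (fun δ : CotangentBundle E G ↦ δ.1) h
  rw [← 𝒢.rng_unit (𝒢.rng δ₂.1), ← h1, 𝒢.rng_unit]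

/-- A product is determined by its values on the range of `dm`, and `dm` is onto: translation by a
bisection through `γ₂` has bijective differential `t ↦ dm(t, dσ(ds(t)))`. -/
lemma IsCotMul.unique {δ₁ δ₂ δ δ' : CotangentBundle E G} (h : 𝒢.IsCotMul δ₁ δ₂ δ)
    (h' : 𝒢.IsCotMul δ₁ δ₂ δ') : δ = δ' := by
  obtain ⟨hs, hm, hf⟩ := h
  obtain ⟨-, hm', hf'⟩ := h'
  have hx := rng_eq_src_of_cotSrc_eq hs
  obtain ⟨σ, κ, V, hB, hV, hσ⟩ := 𝒢.exists_isLocalBisection δ₂.1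
  have hV' : 𝒢.src δ₁.1 ∈ V := hx ▸ hV
  refine CotangentBundle.ext_form (hm.trans hm'.symm) (ContinuousLinearMap.ext fun w ↦ ?_)
  set t := md 𝓘(ℝ, E) 𝓘(ℝ, E) (𝒢.translInv σ κ) (𝒢.transl σ δ₁.1) w with ht
  have h1 : md 𝓘(ℝ, E) 𝓘(ℝ, E) (𝒢.transl σ) δ₁.1 t = w :=
    congrArg (fun A : E →L[ℝ] E ↦ A w) (hB.md_transl_comp_md_translInv hV')
  have hσd := (hB.contMDiffAt_section _ hV').hasMD (by simp)
  have hr : ∀ᶠ x in 𝓝 (𝒢.src δ₁.1), 𝒢.rng (σ x) = x := by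
    filter_upwards [hB.isOpen.mem_nhds hV'] with y hy using hB.rng_section y hy
  have h2 : md 𝓘(ℝ, E) 𝓘(ℝ, E) (𝒢.transl σ) δ₁.1 = _ := (𝒢.hasMD_mul_section hσd hr).md_eq
  have hσ' : σ (𝒢.src δ₁.1) = δ₂.1 := by rw [← hx, hσ]
  set S := md 𝓘(ℝ, F) 𝓘(ℝ, E) σ (𝒢.src δ₁.1) with hS
  have h3 : (𝒢.drng δ₂.1).comp S = .id ℝ F :=
    ((𝒢.hasMD_rng δ₂.1).comp_of_eq hσd hσ').unique ((hasMD_id _).congr hr)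
  have h4 : 𝒢.dsrc δ₁.1 t = 𝒢.drng δ₂.1 (S (𝒢.dsrc δ₁.1 t)) :=
    (congrArg (fun A : F →L[ℝ] F ↦ A (𝒢.dsrc δ₁.1 t)) h3).symm
  rw [h2, hσ'] at h1
  rw [← h1]
  exact (hf t _ h4).trans (hf' t _ h4).symm

omit [FiniteDimensional ℝ E] [FiniteDimensional ℝ F]
  [IsManifold 𝓘(ℝ, E) ∞ G] [IsManifold 𝓘(ℝ, F) ∞ M] in
lemma drng_md_transl {σ : M → G} {κ : M → M} {V : Set M} (hB : 𝒢.IsLocalBisection σ κ V) {γ : G}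
    (hγ : 𝒢.src γ ∈ V) (w : E) :
    𝒢.drng (𝒢.transl σ γ) (md 𝓘(ℝ, E) 𝓘(ℝ, E) (𝒢.transl σ) γ w) = 𝒢.drng γ w := by
  have h := ((𝒢.hasMD_rng _).comp (hB.hasMD_transl hγ)).unique ((𝒢.hasMD_rng γ).congr
    ((hB.eventually_src_mem hγ).mono fun g hg ↦ hB.rng_transl hg))
  exact congrArg (fun A : E →L[ℝ] F ↦ A w) h

/-- Left multiplication commutes with right translation, on the tangent spaces of the
`r`-fibers. -/
lemma md_transl_dmul {σ : M → G} {κ : M → M} {V : Set M} (hB : 𝒢.IsLocalBisection σ κ V) {γ : G}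
    (hγ : 𝒢.src γ ∈ V) {Y : E} (hY : 𝒢.drng (𝒢.unit (𝒢.src γ)) Y = 0) :
    𝒢.dmul γ (σ (𝒢.src γ)) (0, md 𝓘(ℝ, E) 𝓘(ℝ, E) (𝒢.transl σ) (𝒢.unit (𝒢.src γ)) Y) =
        md 𝓘(ℝ, E) 𝓘(ℝ, E) (𝒢.transl σ) γ (𝒢.dmul γ (𝒢.unit (𝒢.src γ)) (0, Y)) ∧
      𝒢.dsrc γ (𝒢.dmul γ (𝒢.unit (𝒢.src γ)) (0, Y)) = 𝒢.dsrc (𝒢.unit (𝒢.src γ)) Y := by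
  set x := 𝒢.src γ with hx
  obtain ⟨A, hA⟩ := 𝒢.exists_dsrc_comp_eq_id γ
  obtain ⟨τ', -, hsτ, hτγ, hτd⟩ := exists_section (𝒢.contMDiff_src γ) hA
  set τ : M → G := fun y ↦ τ' (γ, y) with hτ
  have hτx : τ x = γ := hτγ.self_of_nhds
  have hs : ∀ᶠ y in 𝓝 x, 𝒢.src (τ y) = y :=
    ((continuousAt_const (y := γ)).prodMk continuousAt_id).eventually hsτ
  have hrx : 𝒢.rng (𝒢.unit x) = x := 𝒢.rng_unit x
  have hux : 𝒢.src (𝒢.unit x) ∈ V := by rwa [𝒢.src_unit]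
  -- Left multiplication by `γ` is defined only on an `r`-fiber; `g ↦ τ(r(g)) g` extends it to a
  -- neighborhood of `υ(x)`, and its derivative on `ker dr` is `dm(0, ·)`.
  have hτr : HasMD 𝓘(ℝ, E) 𝓘(ℝ, E) (fun g ↦ τ (𝒢.rng g)) (𝒢.unit x) (A.comp (𝒢.drng (𝒢.unit x))) :=
    HasMD.comp_of_eq (g := τ) hτd (𝒢.hasMD_rng _) hrx
  have hev : ∀ᶠ g in 𝓝 (𝒢.unit x), 𝒢.src (τ (𝒢.rng g)) = 𝒢.rng g ∧ 𝒢.src g ∈ V := by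
    have hc : Tendsto 𝒢.rng (𝓝 (𝒢.unit x)) (𝓝 x) := by
      have := (𝒢.hasMD_rng (𝒢.unit x)).continuousAt
      rwa [ContinuousAt, hrx] at this
    exact (hc.eventually hs).and (hB.eventually_src_mem hux)
  have h1 := 𝒢.hasMD_mul hτr (hasMD_id (𝒢.unit x)) (hev.mono fun g hg ↦ hg.1)
  have h2 := 𝒢.hasMD_mul hτr (hB.hasMD_transl hux) (hev.mono fun g hg ↦
    hg.1.trans (hB.rng_transl hg.2).symm)
  have hm : 𝒢.mul (τ (𝒢.rng (𝒢.unit x))) (id (𝒢.unit x)) = γ := by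
    rw [hrx, hτx, id, hx, 𝒢.mul_unit]
  have h3 := ((hB.hasMD_transl hγ).comp_of_eq h1 hm).unique (h2.congr (hev.mono fun g hg ↦
    𝒢.transl_mul hg.1 (hB.rng_section _ hg.2)))
  have h4 := ((𝒢.hasMD_src γ).comp_of_eq h1 hm).unique ((𝒢.hasMD_src _).congr
    (hev.mono fun g hg ↦ 𝒢.src_mul _ _ hg.1))
  have ht : 𝒢.transl σ (𝒢.unit x) = σ x := by
    have := 𝒢.unit_mul (σ x)
    rw [hB.rng_section _ hγ] at this
    rwa [transl, 𝒢.src_unit]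
  rw [hrx, hτx] at h3 h4
  rw [ht] at h3
  have h5 := congrArg (fun B : E →L[ℝ] E ↦ B Y) h3
  have h6 := congrArg (fun B : E →L[ℝ] F ↦ B Y) h4
  simp only [ContinuousLinearMap.comp_apply, ContinuousLinearMap.prod_apply, hY, map_zero] at h5 h6
  exact ⟨h5.symm, h6⟩

variable [T2Space G] {p₀ : CotangentBundle E G → ℝ} (hp₀ : 𝒢.IsHomogeneousSymbol p₀)
  {χ : ℝ → CotangentBundle E G → CotangentBundle E G}
  (hχ : IsHamFlow (p₀ ∘ 𝒢.cotRng) 𝒢.kerCotRngᶜ χ)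

include hp₀ hχ

/-- The flow is right-invariant: `χ_t(δ)` is the product of `χ_t(r_Γ(δ))` and `δ`. -/
lemma isCotMul_flow {δ : CotangentBundle E G} (hδ : δ ∈ 𝒢.kerCotRngᶜ) (t : ℝ) :
    𝒢.IsCotMul (χ t (𝒢.cotRng δ)) δ (χ t δ) := by
  have hη := 𝒢.cotRng_mem_nonzero hδ
  refine ⟨cotSrc_flow hp₀ hχ hη t, flow_proj hp₀ hχ hδ t, fun t₁ t₂ ht ↦ ?_⟩
  obtain ⟨σ, κ, V, f, hB, hV, hσ, hf, hΨ, h⟩ := exists_flow_eq_cotTransl hp₀ hχ hδ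
  obtain ⟨hs, hflow⟩ := h t
  set η := 𝒢.cotRng δ with hηdef
  set x := 𝒢.rng δ.1 with hx
  have hη1 : η.1 = 𝒢.unit x := rfl
  set γ := (χ t η).1 with hγ
  have hsu : 𝒢.src (𝒢.unit x) = x := 𝒢.src_unit x
  have hsV : 𝒢.src γ ∈ V := by rwa [hs]
  have huV : 𝒢.src (𝒢.unit x) ∈ V := by rwa [hsu]
  set ψ : F →L[ℝ] ℝ := md 𝓘(ℝ, F) 𝓘(ℝ, ℝ) f x with hψ
  have hfd : HasMD 𝓘(ℝ, F) 𝓘(ℝ, ℝ) f x ψ := (hf x hV).hasMD (by simp)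
  have hσd : HasMD 𝓘(ℝ, F) 𝓘(ℝ, E) σ x (md 𝓘(ℝ, F) 𝓘(ℝ, E) σ x) :=
    (hB.contMDiffAt_section x hV).hasMD (by simp)
  have hr : ∀ᶠ y in 𝓝 x, 𝒢.rng (σ y) = y := by
    filter_upwards [hB.isOpen.mem_nhds hV] with y hy using hB.rng_section y hy
  set S := md 𝓘(ℝ, F) 𝓘(ℝ, E) σ x with hS
  -- the covectors at the two translated points
  have hform : ∀ w, (χ t δ).form (md 𝓘(ℝ, E) 𝓘(ℝ, E) (𝒢.transl σ) γ w) =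
      (χ t η).form w + ψ (𝒢.dsrc γ w) := by
    intro w
    have h1 := congrArg (fun A : E →L[ℝ] ℝ ↦ A w) (hB.cotTransl_form_comp (f := f) hsV)
    have h2 : md 𝓘(ℝ, E) 𝓘(ℝ, ℝ) (fun g ↦ f (𝒢.src g)) γ = ψ.comp (𝒢.dsrc γ) :=
      (hfd.comp_of_eq (𝒢.hasMD_src γ) hs).md_eq
    rw [← hγ, h2, ← hflow] at h1
    exact h1
  have hform' : ∀ w, δ.form (md 𝓘(ℝ, E) 𝓘(ℝ, E) (𝒢.transl σ) (𝒢.unit x) w) =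
      η.form w + ψ (𝒢.dsrc (𝒢.unit x) w) := by
    intro w
    have h1 := congrArg (fun A : E →L[ℝ] ℝ ↦ A w) (hB.cotTransl_form_comp (f := f) (δ := η) huV)
    have h2 : md 𝓘(ℝ, E) 𝓘(ℝ, ℝ) (fun g ↦ f (𝒢.src g)) (𝒢.unit x) =
      ψ.comp (𝒢.dsrc (𝒢.unit x)) := (hfd.comp_of_eq (𝒢.hasMD_src (𝒢.unit x)) hsu).md_eq
    rw [hη1, h2, hΨ] at h1
    exact h1
  -- The bisection is the translate of the unit section, and `η` annihilates the tangent space of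
  -- the units; only the shift `df` remains.
  have hSform : ∀ v, δ.form (S v) = ψ v := by
    intro v
    have h1 := ((hB.hasMD_transl huV).comp (𝒢.hasMD_unit x)).unique (hσd.congr (by
      filter_upwards [hr] with y hy
      have h2 := 𝒢.unit_mul (σ y)
      rw [hy] at h2
      change 𝒢.mul (𝒢.unit y) (σ (𝒢.src (𝒢.unit y))) = σ y
      rw [𝒢.src_unit, h2]))
    have h2 : md 𝓘(ℝ, E) 𝓘(ℝ, E) (𝒢.transl σ) (𝒢.unit x) (𝒢.dunit x v) = S v :=
      congrArg (fun A : F →L[ℝ] E ↦ A v) h1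
    have h3 : η.form (𝒢.dunit x v) = 0 := by
      obtain ⟨y, hy, hηy⟩ := (𝒢.mem_dualAlgebroid_iff η).1 hη.1
      have : y = x := by rw [← 𝒢.src_unit y, ← hy, hη1, hsu]
      rw [this] at hηy
      exact congrArg (fun A : F →L[ℝ] ℝ ↦ A v) hηy
    rw [← h2, hform', h3, 𝒢.dsrc_dunit_apply, zero_add]
  have hdS : ∀ v, 𝒢.drng δ.1 (S v) = v := fun v ↦ congrArg (fun A : F →L[ℝ] F ↦ A v)
    (((𝒢.hasMD_rng δ.1).comp_of_eq hσd hσ).unique ((hasMD_id _).congr hr))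
  have htr : 𝒢.transl σ (𝒢.unit x) = δ.1 := by
    change 𝒢.mul (𝒢.unit x) (σ (𝒢.src (𝒢.unit x))) = δ.1
    rw [hsu, hσ, 𝒢.unit_mul]
  -- the first component of the tangent vector
  have hfirst : (χ t δ).form (𝒢.dmul γ δ.1 (t₁, S (𝒢.dsrc γ t₁))) =
      (χ t η).form t₁ + δ.form (S (𝒢.dsrc γ t₁)) := by
    have h1 : md 𝓘(ℝ, E) 𝓘(ℝ, E) (𝒢.transl σ) γ = _ :=
      (𝒢.hasMD_mul_section (γ₁ := γ) (by rw [hs]; exact hσd) (by rw [hs]; exact hr)).md_eq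
    have h2 := hform t₁
    rw [h1, hs, hσ] at h2
    rw [hSform]
    exact h2
  -- the component along the `r`-fiber
  set k := t₂ - S (𝒢.dsrc γ t₁) with hk
  have hk0 : 𝒢.drng δ.1 k = 0 := by
    have ht' : 𝒢.dsrc γ t₁ = 𝒢.drng δ.1 t₂ := ht
    rw [hk, map_sub, hdS, ht', sub_self]
  set k' := md 𝓘(ℝ, E) 𝓘(ℝ, E) (𝒢.translInv σ κ) (𝒢.transl σ (𝒢.unit x)) k with hk'
  have hkk' : md 𝓘(ℝ, E) 𝓘(ℝ, E) (𝒢.transl σ) (𝒢.unit x) k' = k :=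
    congrArg (fun A : E →L[ℝ] E ↦ A k) (hB.md_transl_comp_md_translInv huV)
  have hk'0 : 𝒢.drng (𝒢.unit x) k' = 0 := by
    rw [← drng_md_transl hB huV, hkk', htr, hk0]
  have hsecond : (χ t δ).form (𝒢.dmul γ δ.1 (0, k)) = δ.form k := by
    have h1 := md_transl_dmul hB hsV (Y := k') (by rwa [hs])
    rw [hs, hkk', hσ] at h1
    rw [h1.1, hform, h1.2, flow_form_dmul hp₀ hχ hη1 hη t hk'0, ← hform', hkk']
  have hsum : (t₁, t₂) = (t₁, S (𝒢.dsrc γ t₁)) + ((0 : E), k) := by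
    rw [Prod.mk_add_mk, add_zero, hk, add_sub_cancel]
  change (χ t δ).form (𝒢.dmul γ δ.1 (t₁, t₂)) = (χ t η).form t₁ + δ.form t₂
  rw [hsum, map_add, map_add, hfirst, hsecond, add_assoc, ← map_add, hk, add_sub_cancel]

/-- Composability reads `η₁ = r_Γ(χ_{t₂}(η₂))` because `s_Γ ∘ χ_{t₁}` is the identity on `A*G ∖ 0`.
The product is then identified by `isCotMul_flow` and the uniqueness of products. -/
theorem cotMulSet_flow (t₁ t₂ : ℝ) :
    𝒢.cotMulSet (χ t₁ '' 𝒢.dualAlgebroidNonzero) (χ t₂ '' 𝒢.dualAlgebroidNonzero) =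
      χ (t₁ + t₂) '' 𝒢.dualAlgebroidNonzero := by
  have hadd : ∀ η ∈ 𝒢.dualAlgebroidNonzero, χ (t₁ + t₂) η = χ t₁ (χ t₂ η) := fun η hη ↦
    hχ.add 𝒢.isOpen_compl_kerCotRng hp₀.contMDiffOn_comp (𝒢.notMem_kerCotRng hη) t₁ t₂
  refine Subset.antisymm ?_ ?_
  · rintro δ ⟨_, ⟨η₁, hη₁, rfl⟩, _, ⟨η₂, hη₂, rfl⟩, h⟩
    refine ⟨η₂, hη₂, ?_⟩
    have h1 : η₁ = 𝒢.cotRng (χ t₂ η₂) := by rw [← h.1, cotSrc_flow hp₀ hχ hη₁]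
    rw [hadd η₂ hη₂]
    rw [h1] at h
    exact (isCotMul_flow hp₀ hχ (hχ.mem (𝒢.notMem_kerCotRng hη₂) t₂) t₁).unique h
  · rintro _ ⟨η, hη, rfl⟩
    have hU := hχ.mem (𝒢.notMem_kerCotRng hη) t₂
    refine ⟨_, ⟨_, 𝒢.cotRng_mem_nonzero hU, rfl⟩, _, ⟨η, hη, rfl⟩, ?_⟩
    rw [hadd η hη]
    exact isCotMul_flow hp₀ hχ hU t₁

end FlowProduct

end LieGroupoid

/-! ### The image of a smooth retraction is a submanifold -/

section Retraction

/-- A smooth map `R` with `R ∘ R = R` near a fixed point: in a suitable chart, its fixed points form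
the linear subspace `range (DR)`. -/
lemma exists_openPartialHomeomorph_fixedPoints {V : Type*} [NormedAddCommGroup V] [NormedSpace ℝ V]
    [CompleteSpace V] {R : V → V} {O : Set V} {z₀ : V} (hO : IsOpen O) (hz₀ : z₀ ∈ O)
    (hR : ContDiffOn ℝ ∞ R O) (hR₀ : R z₀ = z₀) (hRR : ∀ z ∈ O, R (R z) = R z) :
    ∃ g : OpenPartialHomeomorph V V, z₀ ∈ g.source ∧ g.source ⊆ O ∧ ContDiffOn ℝ ∞ g g.source ∧
      ContDiffOn ℝ ∞ g.symm g.target ∧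
      ∀ z ∈ g.source, R z = z ↔ g z ∈ LinearMap.range (fderiv ℝ R z₀ : V →ₗ[ℝ] V) := by
  set P := fderiv ℝ R z₀ with hP
  have hRat : ∀ z ∈ O, ContDiffAt ℝ ∞ R z := fun z hz ↦ hR.contDiffAt (hO.mem_nhds hz)
  have hRd : HasFDerivAt R P z₀ := ((hRat _ hz₀).differentiableAt (by simp)).hasFDerivAt
  have hPP : P.comp P = P := by
    have h1 : HasFDerivAt R P (R z₀) := by rwa [hR₀]
    refine (h1.comp z₀ hRd).unique (hRd.congr_of_eventuallyEq ?_)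
    filter_upwards [hO.mem_nhds hz₀] with z hz using hRR z hz
  have hPP' : ∀ v, P (P v) = P v := fun v ↦ congrArg (fun A : V →L[ℝ] V ↦ A v) hPP
  -- With `P = DR(z₀)` idempotent, `DΦ(z₀) = P² + (1 - P)² = 1`, so `Φ` is a chart near `z₀`. At a
  -- fixed point the second summand vanishes and the value lies in the range of `P`.
  set Φ : V → V := fun z ↦ P (R z - z₀) + ((z - R z) - P (z - R z)) with hΦ
  have hΦs : ∀ z ∈ O, ContDiffAt ℝ ∞ Φ z := by
    intro z hz
    have h1 := hRat z hz
    have h2 : ContDiffAt ℝ ∞ (fun z ↦ z - R z) z := contDiffAt_id.sub h1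
    exact (P.contDiff.contDiffAt.comp z (h1.sub contDiffAt_const)).add
      (h2.sub (P.contDiff.contDiffAt.comp z h2))
  have hΦd : HasFDerivAt Φ ((ContinuousLinearEquiv.refl ℝ V : V ≃L[ℝ] V) : V →L[ℝ] V) z₀ := by
    have h2 : HasFDerivAt (fun z ↦ z - R z) (ContinuousLinearMap.id ℝ V - P) z₀ :=
      (hasFDerivAt_id z₀).sub hRd
    have h3 := (P.hasFDerivAt.comp z₀ (hRd.sub_const z₀)).add
      (h2.sub (P.hasFDerivAt.comp z₀ h2))
    refine h3.congr_fderiv (ContinuousLinearMap.ext fun v ↦ ?_)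
    simp [hPP']
  set g₀ := (hΦs z₀ hz₀).toOpenPartialHomeomorph Φ hΦd (by simp) with hg₀
  have hg₀z : z₀ ∈ g₀.source := (hΦs z₀ hz₀).mem_toOpenPartialHomeomorph_source hΦd (by simp)
  -- Invertibility of the derivative at all points of the domain is needed for the inverse of the
  -- chart to be smooth on its whole target.
  have hinv : ∀ᶠ z in 𝓝 z₀, fderiv ℝ Φ z ∈ range ((↑) : (V ≃L[ℝ] V) → V →L[ℝ] V) := by
    have hc : ContinuousAt (fderiv ℝ Φ) z₀ :=
      ((hΦs z₀ hz₀).fderiv_right (m := 0) (by simp)).continuousAt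
    refine hc.eventually (ContinuousLinearEquiv.isOpen.mem_nhds ?_)
    rw [hΦd.fderiv]
    exact mem_range_self _
  have hRc : ∀ᶠ z in 𝓝 z₀, R z ∈ g₀.source := by
    refine (hRat z₀ hz₀).continuousAt.eventually ?_
    rw [hR₀]
    exact g₀.open_source.mem_nhds hg₀z
  obtain ⟨O', hO', hO'o, hz₀O'⟩ := eventually_nhds_iff.1
    ((hO.eventually_mem hz₀).and (hinv.and hRc))
  set g := g₀.restrOpen O' hO'o with hg
  have hgs : g.source = g₀.source ∩ O' := g₀.restrOpen_source O' hO'o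
  have hsub : g.source ⊆ O := fun z hz ↦ (hO' z (by rw [hgs] at hz; exact hz.2)).1
  refine ⟨g, by rw [hgs]; exact ⟨hg₀z, hz₀O'⟩, hsub,
    fun z hz ↦ (hΦs z (hsub hz)).contDiffWithinAt, fun w hw ↦ ?_, fun z hz ↦ ⟨fun h ↦ ?_, ?_⟩⟩
  · have hz := g.map_target hw
    obtain ⟨A, hA⟩ := (hO' _ (by rw [hgs] at hz; exact hz.2)).2.1
    refine (g.contDiffAt_symm (f₀' := A) hw ?_ (hΦs _ (hsub hz))).contDiffWithinAt
    rw [hA]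
    exact ((hΦs _ (hsub hz)).differentiableAt (by simp)).hasFDerivAt
  · refine ⟨R z - z₀, ?_⟩
    change P (R z - z₀) = P (R z - z₀) + ((z - R z) - P (z - R z))
    rw [h, sub_self, map_zero, sub_zero, add_zero]
  · rintro ⟨b, hb⟩
    have hb' : P b = P (R z - z₀) + ((z - R z) - P (z - R z)) := hb
    have h1 : (z - R z) - P (z - R z) = 0 := by
      have h2 : P (b - (R z - z₀)) = (z - R z) - P (z - R z) := by
        rw [map_sub, hb', add_sub_cancel_left]
      have h3 : ∀ w, P (w - P w) = 0 := fun w ↦ by rw [map_sub, hPP', sub_self]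
      rw [← h2, ← hPP', h2, h3]
    rw [hgs] at hz
    obtain ⟨hzO, -, hRz⟩ := hO' z hz.2
    -- If `Φ z` is in the range of `P`, its component `(1 - P)(z - R z)` is zero; then `Φ (R z) = Φ
    -- z`, and injectivity of `Φ` gives `R z = z`.
    refine g₀.injOn hRz hz.1 ?_
    change P (R (R z) - z₀) + ((R z - R (R z)) - P (R z - R (R z))) =
      P (R z - z₀) + ((z - R z) - P (z - R z))
    rw [hRR z hzO, h1, sub_self, map_zero, sub_zero]

variable {V H X : Type*} [NormedAddCommGroup V] [NormedSpace ℝ V] [CompleteSpace V]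
  [TopologicalSpace H] {I : ModelWithCorners ℝ V H} [I.Boundaryless]
  [TopologicalSpace X] [ChartedSpace H X] [IsManifold I ∞ X]

/-- Within `O`, the set `S` is the fixed-point set of `ρ`. Straightened by the chart of the
preceding lemma, it becomes the range of `dρ`, whose rank is the dimension. -/
theorem isEmbeddedSubmanifold_of_retraction {S O : Set X} {ρ : X → X} (hO : IsOpen O) (hS : S ⊆ O)
    (hρ : ContMDiffOn I I ∞ ρ O) (hmem : ∀ y ∈ O, ρ y ∈ S) (hfix : ∀ y ∈ S, ρ y = y) {k : ℕ}
    (hk : ∀ x ∈ S, Module.finrank ℝ (LinearMap.range (md I I ρ x : V →ₗ[ℝ] V)) = k) :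
    IsEmbeddedSubmanifold I k S := by
  intro x hx
  set φ := extChartAt I x with hφ
  have hφt : IsOpen φ.target := isOpen_extChartAt_target x
  have hφs : IsOpen φ.source := isOpen_extChartAt_source x
  set R : V → V := fun z ↦ φ (ρ (φ.symm z)) with hR
  have hO₁ : IsOpen (O ∩ ρ ⁻¹' φ.source) := hρ.continuousOn.isOpen_inter_preimage hO hφs
  set O' : Set V := φ.target ∩ φ.symm ⁻¹' (O ∩ ρ ⁻¹' φ.source) with hO'
  have hO'o : IsOpen O' := (continuousOn_extChartAt_symm x).isOpen_inter_preimage hφt hO₁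
  have hxs : x ∈ φ.source := mem_extChartAt_source x
  have hsymm : φ.symm (φ x) = x := φ.left_inv hxs
  have hz₀ : φ x ∈ O' := by
    refine ⟨φ.map_source hxs, ?_⟩
    rw [mem_preimage, hsymm]
    exact ⟨hS hx, by rw [mem_preimage, hfix x hx]; exact hxs⟩
  have hRs : ContDiffOn ℝ ∞ R O' := by
    rw [← contMDiffOn_iff_contDiffOn]
    have h1 : ContMDiffOn 𝓘(ℝ, V) I ∞ φ.symm O' := (contMDiffOn_extChartAt_symm x).mono
      inter_subset_left
    have h2 : ContMDiffOn I 𝓘(ℝ, V) ∞ φ φ.source := by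
      rw [hφ, extChartAt_source]
      exact contMDiffOn_extChartAt
    exact h2.comp (hρ.comp h1 fun z hz ↦ hz.2.1) fun z hz ↦ hz.2.2
  have hR₀ : R (φ x) = φ x := by rw [hR]; simp only [hsymm, hfix x hx]
  have hRR : ∀ z ∈ O', R (R z) = R z := by
    intro z hz
    change φ (ρ (φ.symm (φ (ρ (φ.symm z))))) = φ (ρ (φ.symm z))
    rw [φ.left_inv hz.2.2, hfix _ (hmem _ hz.2.1)]
  obtain ⟨g, hgz, hgO, hgs, hgt, hgfix⟩ :=
    exists_openPartialHomeomorph_fixedPoints hO'o hz₀ hRs hR₀ hRR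
  have hder : fderiv ℝ R (φ x) = md I I ρ x := by
    rw [md_eq_fderiv_writtenInExtChartAt
      ((hρ.contMDiffAt (hO.mem_nhds (hS hx))).mdifferentiableAt (by simp))]
    unfold writtenInExtChartAt
    rw [hfix x hx]
    rfl
  set i := I.toHomeomorph.toOpenPartialHomeomorph with hi
  -- The straightening is inserted between the chart and `I`, which is a homeomorphism as there is
  -- no boundary.
  set e : OpenPartialHomeomorph X H :=
    (((chartAt H x).trans i).trans g).trans i.symm with he
  have hes : ∀ y, y ∈ e.source ↔ y ∈ φ.source ∧ φ y ∈ g.source := by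
    intro y
    rw [hφ, extChartAt_source]
    simp [he, hi, extChartAt]
  have hee : ∀ y, e.extend I y = g (φ y) := fun y ↦
    I.right_inv (by rw [I.range_eq_univ]; exact mem_univ _)
  have het : ∀ w ∈ e.target, I w ∈ g.target ∧ g.symm (I w) ∈ φ.target := by
    intro w hw
    have h1 := e.map_target hw
    have h2 := e.right_inv hw
    have h3 := (hes _).1 h1
    have h4 : I w = g (φ (e.symm w)) := by rw [← hee, e.extend_coe, Function.comp_apply, h2]
    refine ⟨h4 ▸ g.map_source h3.2, ?_⟩
    rw [h4, g.left_inv h3.2]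
    exact φ.map_source h3.1
  refine ⟨e, e.mem_maximalAtlas_of_contMDiffOn ?_ ?_, (hes x).2 ⟨hxs, hgz⟩, _, hk x hx,
    fun y hy ↦ ?_⟩
  · have h1 : ContMDiffOn I 𝓘(ℝ, V) ∞ φ φ.source := by
      rw [hφ, extChartAt_source]
      exact contMDiffOn_extChartAt
    have h2 : ContMDiffOn I 𝓘(ℝ, V) ∞ (fun y ↦ g (φ y)) e.source :=
      (contMDiffOn_iff_contDiffOn.2 hgs).comp (h1.mono fun y hy ↦ ((hes y).1 hy).1)
        fun y hy ↦ ((hes y).1 hy).2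
    exact I.contMDiffOn_symm.comp h2 fun y _ ↦ by rw [I.range_eq_univ]; exact mem_univ _
  · have h1 : ContMDiffOn I 𝓘(ℝ, V) ∞ (fun w ↦ g.symm (I w)) e.target :=
      (contMDiffOn_iff_contDiffOn.2 hgt).comp I.contMDiff.contMDiffOn fun w hw ↦ (het w hw).1
    exact (contMDiffOn_extChartAt_symm x).comp h1 fun w hw ↦ (het w hw).2
  · obtain ⟨hys, hyg⟩ := (hes y).1 hy
    have hyO := (hgO hyg).2
    rw [mem_preimage, φ.left_inv hys] at hyO
    rw [hee, ← hder]
    refine Iff.trans ?_ (hgfix _ hyg)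
    change y ∈ S ↔ φ (ρ (φ.symm (φ y))) = φ y
    rw [φ.left_inv hys]
    refine ⟨fun h ↦ by rw [hfix y h], fun h ↦ ?_⟩
    have h1 := φ.injOn hyO.2 hys h
    rw [← h1]
    exact hmem y hyO.1

end Retraction

/-! ### The Lagrangian submanifolds `Λ_t` -/

/-- The rank of a projection `P` of `E × E'` that induces the projection `D ∘ S` on `E`, and whose
vertical fixed vectors form the kernel of `ann`. -/
lemma finrank_range_of_vertical {K E E' F F' : Type*} [Field K] [AddCommGroup E] [Module K E]
    [AddCommGroup E'] [Module K E'] [AddCommGroup F] [Module K F] [AddCommGroup F'] [Module K F']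
    [FiniteDimensional K E] [FiniteDimensional K E']
    {P : E × E' →ₗ[K] E × E'} {D : F →ₗ[K] E} {S : E →ₗ[K] F} {ann : E' →ₗ[K] F'}
    (hPP : ∀ w, P (P w) = P w) (hfst : ∀ w, (P w).1 = D (S w.1)) (hSD : ∀ v, S (D v) = v)
    (hann : ∀ ζ, ζ ∈ LinearMap.ker ann ↔ P (0, ζ) = (0, ζ)) (hsurj : LinearMap.range ann = ⊤)
    (hE : Module.finrank K E' = Module.finrank K E)
    (hF : Module.finrank K F' = Module.finrank K F) :
    Module.finrank K (LinearMap.range P) = Module.finrank K E := by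
  -- Rank-nullity for the first projection on the range of `P`: its image is the range of `D`, of
  -- dimension `dim F`, and its kernel is that of `ann`, of dimension `dim E - dim F`.
  set f : LinearMap.range P →ₗ[K] E := (LinearMap.fst K E E').domRestrict _ with hf
  have hker : Module.finrank K (LinearMap.ker f) = Module.finrank K (LinearMap.ker ann) := by
    let T : LinearMap.ker ann →ₗ[K] LinearMap.ker f :=
      { toFun := fun ζ ↦ ⟨⟨(0, ζ.1), (0, ζ.1), (hann ζ.1).1 ζ.2⟩, rfl⟩
        map_add' := fun ζ ζ' ↦ Subtype.ext (Subtype.ext (Prod.ext (add_zero (0 : E)).symm rfl))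
        map_smul' := fun a ζ ↦ Subtype.ext (Subtype.ext (Prod.ext (smul_zero a).symm rfl)) }
    refine (LinearEquiv.ofBijective T ⟨fun ζ ζ' h ↦ ?_, ?_⟩).finrank_eq.symm
    · exact Subtype.ext (congrArg (fun z : LinearMap.ker f ↦ (z.1.1 : E × E').2) h)
    · rintro ⟨⟨⟨v, ζ⟩, w, hw⟩, hv⟩
      have hv0 : v = 0 := hv
      subst hv0
      refine ⟨⟨ζ, (hann ζ).2 ?_⟩, rfl⟩
      rw [← hw, hPP]
  have hrange : LinearMap.range f = LinearMap.range D := by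
    ext v
    refine ⟨?_, ?_⟩
    · rintro ⟨⟨_, w, rfl⟩, rfl⟩
      exact ⟨S w.1, (hfst w).symm⟩
    · rintro ⟨u, rfl⟩
      exact ⟨⟨P (D u, 0), _, rfl⟩, (hfst _).trans (congrArg D (hSD u))⟩
  have h1 := f.finrank_range_add_finrank_ker
  have h2 := ann.finrank_range_add_finrank_ker
  rw [hsurj, finrank_top, hE, hF] at h2
  rw [hrange, LinearMap.finrank_range_of_inj (Function.LeftInverse.injective hSD), hker, h2] at h1
  exact h1.symm

namespace LieGroupoid

section Lagrangian

set_option synthInstance.maxHeartbeats 200000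

variable {E F G M : Type*}
  [NormedAddCommGroup E] [NormedSpace ℝ E] [FiniteDimensional ℝ E]
  [NormedAddCommGroup F] [NormedSpace ℝ F] [FiniteDimensional ℝ F]
  [TopologicalSpace G] [ChartedSpace E G] [IsManifold 𝓘(ℝ, E) ∞ G]
  [TopologicalSpace M] [ChartedSpace F M] [IsManifold 𝓘(ℝ, F) ∞ M]
  {𝒢 : LieGroupoid E F G M}

lemma hasMD_cotSrc (δ : CotangentBundle E G) :
    HasMD (cotangentModel E) (cotangentModel E) 𝒢.cotSrc δ
      (md (cotangentModel E) (cotangentModel E) 𝒢.cotSrc δ) :=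
  𝒢.contMDiff_cotSrc.contMDiffAt.hasMD (by simp)

omit [FiniteDimensional ℝ E] [FiniteDimensional ℝ F] [IsManifold 𝓘(ℝ, F) ∞ M] in
lemma hasMD_cotSrc_proj (δ : CotangentBundle E G) :
    HasMD (cotangentModel E) 𝓘(ℝ, E) (fun z ↦ (𝒢.cotSrc z).1) δ
      ((𝒢.dunit (𝒢.src δ.1)).comp ((𝒢.dsrc δ.1).comp (.fst ℝ E (E →L[ℝ] ℝ)))) :=
  (𝒢.hasMD_unit _).comp ((𝒢.hasMD_src δ.1).comp (hasMD_cotangent_proj δ))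

lemma md_cotSrc_fst (δ : CotangentBundle E G) (w : E × (E →L[ℝ] ℝ)) :
    (md (cotangentModel E) (cotangentModel E) 𝒢.cotSrc δ w).1 =
      𝒢.dunit (𝒢.src δ.1) (𝒢.dsrc δ.1 w.1) :=
  congrArg (fun A : E × (E →L[ℝ] ℝ) →L[ℝ] E ↦ A w)
    (((hasMD_cotangent_proj _).comp (hasMD_cotSrc δ)).unique (hasMD_cotSrc_proj δ))

/-- The canonical one-form vanishes on `A*G`. -/
lemma canForm_comp_md_cotSrc (δ : CotangentBundle E G) :
    (canForm (𝒢.cotSrc δ)).comp (md (cotangentModel E) (cotangentModel E) 𝒢.cotSrc δ) = 0 := by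
  rw [canForm_comp (hasMD_cotSrc δ) (hasMD_cotSrc_proj δ), ← ContinuousLinearMap.comp_assoc]
  obtain ⟨x, hx, h⟩ := (𝒢.mem_dualAlgebroid_iff _).1 (𝒢.cotSrc_mem δ)
  have hx' : x = 𝒢.src δ.1 := by
    rw [← 𝒢.src_unit x, ← hx]
    exact 𝒢.src_unit _
  rw [hx'] at h
  rw [h, ContinuousLinearMap.zero_comp]

omit [FiniteDimensional ℝ E] [FiniteDimensional ℝ F]
  [IsManifold 𝓘(ℝ, E) ∞ G] [IsManifold 𝓘(ℝ, F) ∞ M] in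
lemma cotSrc_cotSrc (δ : CotangentBundle E G) : 𝒢.cotSrc (𝒢.cotSrc δ) = 𝒢.cotSrc δ :=
  𝒢.cotSrc_of_mem (𝒢.cotSrc_mem δ)

lemma md_cotSrc_idempotent {η : CotangentBundle E G} (hη : η ∈ 𝒢.dualAlgebroid)
    (w : E × (E →L[ℝ] ℝ)) :
    md (cotangentModel E) (cotangentModel E) 𝒢.cotSrc η
        (md (cotangentModel E) (cotangentModel E) 𝒢.cotSrc η w) =
      md (cotangentModel E) (cotangentModel E) 𝒢.cotSrc η w := by
  have h := ((hasMD_cotSrc η).comp_of_eq (hasMD_cotSrc η) (𝒢.cotSrc_of_mem hη)).unique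
    ((hasMD_cotSrc η).congr (Eventually.of_forall cotSrc_cotSrc))
  exact congrArg (fun A : E × (E →L[ℝ] ℝ) →L[ℝ] E × (E →L[ℝ] ℝ) ↦ A w) h

/-- On the vertical vectors, the differential of `s_Γ` is `s_Γ` itself. -/
lemma md_cotSrc_vertical {η : CotangentBundle E G} {x : M} (hx : η.1 = 𝒢.unit x)
    (hη : η ∈ 𝒢.dualAlgebroid) (ζ : E →L[ℝ] ℝ) :
    md (cotangentModel E) (cotangentModel E) 𝒢.cotSrc η (0, ζ) =
      (0, (𝒢.cotSrc (cotMk (𝒢.unit x) ζ)).form) := by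
  obtain ⟨T, hT⟩ : ∃ T : (E →L[ℝ] ℝ) →L[ℝ] (E →L[ℝ] ℝ), ∀ ξ,
      𝒢.cotSrc (cotMk (𝒢.unit x) ξ) = cotMk (𝒢.unit x) (T ξ) := by
    refine ⟨-((ContinuousLinearMap.compL ℝ E E ℝ).flip ((𝒢.dLeftMul (𝒢.unit x)).comp
      ((𝒢.dinv (𝒢.src (𝒢.unit x))).comp (𝒢.algebroidProj (𝒢.src (𝒢.unit x)))))), fun ξ ↦ ?_⟩
    refine CotangentBundle.ext_form ?_ rfl
    change 𝒢.unit (𝒢.src (𝒢.unit x)) = 𝒢.unit x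
    rw [𝒢.src_unit]
  have hη' : cotMk (𝒢.unit x) η.form = η := CotangentBundle.ext_form hx.symm rfl
  have h0 : T η.form = η.form := by
    have h := hT η.form
    rw [hη', 𝒢.cotSrc_of_mem hη] at h
    exact (congrArg (fun δ : CotangentBundle E G ↦ δ.form) h).symm
  have h1 := (hasMD_cotSrc (𝒢 := 𝒢) η).comp_of_eq (hasMD_cotMk (𝒢.unit x) η.form) hη'
  have h2 := (hasMD_cotMk (𝒢.unit x) η.form).comp_of_eq
    (hasMD_iff_hasFDerivAt.2 (T.hasFDerivAt (x := η.form))) h0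
  have h3 := h1.unique (h2.congr (Eventually.of_forall hT))
  have h4 := congrArg (fun A : (E →L[ℝ] ℝ) →L[ℝ] E × (E →L[ℝ] ℝ) ↦ A ζ) h3
  rw [hT]
  exact h4

/-- The range of the projection `ds_Γ` is the tangent space of `A*G`, a bundle over `M` with fibers
of dimension `dim E - dim F`: the total dimension is half of that of `T*G`. -/
lemma finrank_range_md_cotSrc {η : CotangentBundle E G} (hη : η ∈ 𝒢.dualAlgebroid) :
    Module.finrank ℝ (LinearMap.range (md (cotangentModel E) (cotangentModel E) 𝒢.cotSrc η :
      E × (E →L[ℝ] ℝ) →ₗ[ℝ] E × (E →L[ℝ] ℝ))) = Module.finrank ℝ E := by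
  obtain ⟨x, hx, -⟩ := (𝒢.mem_dualAlgebroid_iff η).1 hη
  set P : E × (E →L[ℝ] ℝ) →ₗ[ℝ] E × (E →L[ℝ] ℝ) :=
    (md (cotangentModel E) (cotangentModel E) 𝒢.cotSrc η :
      E × (E →L[ℝ] ℝ) →ₗ[ℝ] E × (E →L[ℝ] ℝ)) with hP
  have hPP : ∀ w, P (P w) = P w := md_cotSrc_idempotent hη
  have hsx : 𝒢.src η.1 = x := by rw [hx, 𝒢.src_unit]
  have hfst : ∀ w, (P w).1 = 𝒢.dunit x (𝒢.dsrc (𝒢.unit x) w.1) := by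
    intro w
    have := md_cotSrc_fst (𝒢 := 𝒢) η w
    rwa [hsx, hx] at this
  have hvert : ∀ ζ : E →L[ℝ] ℝ, P (0, ζ) = (0, (𝒢.cotSrc (cotMk (𝒢.unit x) ζ)).form) :=
    md_cotSrc_vertical hx hη
  -- the annihilator of the tangent space of the units
  let ann : (E →L[ℝ] ℝ) →ₗ[ℝ] (F →L[ℝ] ℝ) :=
    ((ContinuousLinearMap.compL ℝ F E ℝ).flip (𝒢.dunit x)).toLinearMap
  have hann : ∀ ζ, ann ζ = ζ.comp (𝒢.dunit x) := fun ζ ↦ rfl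
  have hsurj : LinearMap.range ann = ⊤ := by
    refine LinearMap.range_eq_top.2 fun β ↦ ⟨β.comp (𝒢.dsrc (𝒢.unit x)), ?_⟩
    rw [hann, ContinuousLinearMap.comp_assoc, 𝒢.dsrc_dunit, ContinuousLinearMap.comp_id]
  have hmem : ∀ ζ, ζ ∈ LinearMap.ker ann ↔ P (0, ζ) = (0, ζ) := by
    intro ζ
    rw [LinearMap.mem_ker, hann, hvert]
    refine ⟨fun h ↦ ?_, fun h ↦ ?_⟩
    · rw [𝒢.cotSrc_of_mem ((𝒢.mem_dualAlgebroid_iff (cotMk (𝒢.unit x) ζ)).2 ⟨x, rfl, h⟩)]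
      rfl
    · obtain ⟨y, hy, h'⟩ := (𝒢.mem_dualAlgebroid_iff _).1 (𝒢.cotSrc_mem (cotMk (𝒢.unit x) ζ))
      have hyx : y = x := by
        rw [← 𝒢.src_unit y, ← hy]
        change 𝒢.src (𝒢.unit (𝒢.src (𝒢.unit x))) = x
        rw [𝒢.src_unit, 𝒢.src_unit]
      have h2 : (𝒢.cotSrc (cotMk (𝒢.unit x) ζ)).form = ζ := (Prod.ext_iff.1 h).2
      rwa [hyx, h2] at h'
  exact finrank_range_of_vertical (D := (𝒢.dunit x : F →ₗ[ℝ] E))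
    (S := (𝒢.dsrc (𝒢.unit x) : E →ₗ[ℝ] F)) (ann := ann) hPP hfst (𝒢.dsrc_dunit_apply x) hmem
    hsurj finrank_dual finrank_dual

variable [T2Space G] {p₀ : CotangentBundle E G → ℝ} (hp₀ : 𝒢.IsHomogeneousSymbol p₀)
  {χ : ℝ → CotangentBundle E G → CotangentBundle E G}
  (hχ : IsHamFlow (p₀ ∘ 𝒢.cotRng) 𝒢.kerCotRngᶜ χ)

include hp₀ hχ

lemma contMDiffOn_flow_cotSrc (t : ℝ) :
    ContMDiffOn (cotangentModel E) (cotangentModel E) ∞ (fun δ ↦ χ t (𝒢.cotSrc δ))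
      𝒢.kerCotSrcᶜ := fun δ hδ ↦
  (ContMDiffAt.comp δ (hχ.contMDiffAt_apply 𝒢.isOpen_compl_kerCotRng hp₀.contMDiffOn_comp
    (𝒢.notMem_kerCotRng (𝒢.cotSrc_mem_nonzero hδ)) t)
      𝒢.contMDiff_cotSrc.contMDiffAt).contMDiffWithinAt

/-- Since `s_Γ ∘ χ_t ∘ s_Γ = s_Γ`, the differentials of `s_Γ` at `η` and at `χ_t(η)` have the same
range; the differential of `χ_t` is injective and preserves its dimension. -/
lemma finrank_range_md_flow_cotSrc {η : CotangentBundle E G} (hη : η ∈ 𝒢.dualAlgebroidNonzero)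
    (t : ℝ) :
    Module.finrank ℝ (LinearMap.range (md (cotangentModel E) (cotangentModel E)
      (fun δ ↦ χ t (𝒢.cotSrc δ)) (χ t η) : E × (E →L[ℝ] ℝ) →ₗ[ℝ] E × (E →L[ℝ] ℝ))) =
      Module.finrank ℝ E := by
  have hU := 𝒢.isOpen_compl_kerCotRng
  have hp := hp₀.contMDiffOn_comp
  have hηU := 𝒢.notMem_kerCotRng hη
  have hs : 𝒢.cotSrc (χ t η) = η := cotSrc_flow hp₀ hχ hη t
  have hsη : 𝒢.cotSrc η = η := 𝒢.cotSrc_of_mem hη.1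
  have hA := (hχ.contMDiffAt_apply hU hp hηU t).hasMD (by simp)
  have hA' := (hχ.contMDiffAt_apply hU hp (hχ.mem hηU t) (-t)).hasMD (by simp)
  set A := md (cotangentModel E) (cotangentModel E) (χ t) η
  set A' := md (cotangentModel E) (cotangentModel E) (χ (-t)) (χ t η)
  have hAA : ∀ w, A' (A w) = w := fun w ↦
    congrArg (fun B : E × (E →L[ℝ] ℝ) →L[ℝ] E × (E →L[ℝ] ℝ) ↦ B w)
      ((hA'.comp hA).unique ((hasMD_id η).congr (by
        filter_upwards [hU.mem_nhds hηU] with z hz using hχ.neg_apply hU hp hz t)))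
  set P := md (cotangentModel E) (cotangentModel E) 𝒢.cotSrc η with hP
  set Q := md (cotangentModel E) (cotangentModel E) 𝒢.cotSrc (χ t η) with hQ
  have hρ : HasMD (cotangentModel E) (cotangentModel E) (fun δ ↦ χ t (𝒢.cotSrc δ)) (χ t η)
      (A.comp Q) := hA.comp_of_eq (hasMD_cotSrc (χ t η)) hs
  -- `s_Γ ∘ s_Γ = s_Γ` and `s_Γ ∘ χ_t ∘ s_Γ = s_Γ`
  have hPQ : ∀ w, P (Q w) = Q w := fun w ↦
    congrArg (fun B : E × (E →L[ℝ] ℝ) →L[ℝ] E × (E →L[ℝ] ℝ) ↦ B w)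
      (((hasMD_cotSrc η).comp_of_eq (hasMD_cotSrc (χ t η)) hs).unique
        ((hasMD_cotSrc (χ t η)).congr (Eventually.of_forall cotSrc_cotSrc)))
  have hev : ∀ᶠ z in 𝓝 η, z ∈ 𝒢.kerCotSrcᶜ :=
    𝒢.isOpen_compl_kerCotSrc.mem_nhds (𝒢.notMem_kerCotSrc hη)
  have hQAP : ∀ w, Q (A (P w)) = P w := fun w ↦
    congrArg (fun B : E × (E →L[ℝ] ℝ) →L[ℝ] E × (E →L[ℝ] ℝ) ↦ B w)
      (((hasMD_cotSrc (χ t η)).comp_of_eq (hA.comp_of_eq (hasMD_cotSrc η) hsη)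
        (by rw [Function.comp_apply, hsη])).unique ((hasMD_cotSrc η).congr (hev.mono fun z hz ↦
          cotSrc_flow hp₀ hχ (𝒢.cotSrc_mem_nonzero hz) t)))
  have hrange : LinearMap.range (A.comp Q : E × (E →L[ℝ] ℝ) →ₗ[ℝ] E × (E →L[ℝ] ℝ)) =
      (LinearMap.range (P : E × (E →L[ℝ] ℝ) →ₗ[ℝ] E × (E →L[ℝ] ℝ))).map
        (A : E × (E →L[ℝ] ℝ) →ₗ[ℝ] E × (E →L[ℝ] ℝ)) := by
    ext v
    refine ⟨?_, ?_⟩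
    · rintro ⟨w, rfl⟩
      exact ⟨Q w, ⟨Q w, hPQ w⟩, rfl⟩
    · rintro ⟨_, ⟨w, rfl⟩, rfl⟩
      exact ⟨A (P w), congrArg A (hQAP w)⟩
  have hinj : Function.Injective (A : E × (E →L[ℝ] ℝ) →ₗ[ℝ] E × (E →L[ℝ] ℝ)) :=
    Function.LeftInverse.injective (g := A') hAA
  rw [hρ.md_eq, hrange, LinearEquiv.finrank_eq (Submodule.equivMapOfInjective _ hinj _).symm]
  exact finrank_range_md_cotSrc hη.1

lemma flow_cotSrc_eq {δ : CotangentBundle E G} {t : ℝ} (hδ : δ ∈ χ t '' 𝒢.dualAlgebroidNonzero) :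
    χ t (𝒢.cotSrc δ) = δ := by
  obtain ⟨η, hη, rfl⟩ := hδ
  rw [cotSrc_flow hp₀ hχ hη]

lemma image_flow_subset (t : ℝ) : χ t '' 𝒢.dualAlgebroidNonzero ⊆ 𝒢.kerCotSrcᶜ := by
  rintro _ ⟨η, hη, rfl⟩
  rw [mem_compl_iff, mem_kerCotSrc_iff, cotSrc_flow hp₀ hχ hη]
  exact hη.2

/-- All properties come from the retraction `ρ = χ_t ∘ s_Γ` onto `Λ_t` and from homogeneity: `ρ^* α
= s_Γ^* α = 0`, hence `ρ^* ω = 0`. -/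
theorem isHomogeneousLagrangian_flow (t : ℝ) :
    IsHomogeneousLagrangian (χ t '' 𝒢.dualAlgebroidNonzero) where
  ne_zero := by
    rintro _ ⟨η, hη, rfl⟩
    exact 𝒢.form_ne_zero_of_mem (hχ.mem (𝒢.notMem_kerCotRng hη) t)
  dilation_mem := by
    rintro a ha _ ⟨η, hη, rfl⟩
    exact ⟨dilation a η, dilation_mem_dualAlgebroidNonzero ha.ne' hη,
      flow_dilation hp₀ hχ ha (𝒢.notMem_kerCotRng hη) t⟩
  submanifold := by
    have : CompleteSpace (E × (E →L[ℝ] ℝ)) := FiniteDimensional.complete ℝ _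
    refine isEmbeddedSubmanifold_of_retraction 𝒢.isOpen_compl_kerCotSrc
      (image_flow_subset hp₀ hχ t) (contMDiffOn_flow_cotSrc hp₀ hχ t)
      (fun δ hδ ↦ ⟨_, 𝒢.cotSrc_mem_nonzero hδ, rfl⟩) (fun δ hδ ↦ flow_cotSrc_eq hp₀ hχ hδ) ?_
    rintro _ ⟨η, hη, rfl⟩
    exact finrank_range_md_flow_cotSrc hp₀ hχ hη t
  isotropic := by
    intro δ hδ u hu v hv
    have hδs := image_flow_subset hp₀ hχ t hδ
    have hρ := (contMDiffOn_flow_cotSrc hp₀ hχ t).contMDiffAt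
      (𝒢.isOpen_compl_kerCotSrc.mem_nhds hδs)
    set ρ : CotangentBundle E G → CotangentBundle E G := fun δ ↦ χ t (𝒢.cotSrc δ) with hρdef
    have hρδ : ρ δ = δ := flow_cotSrc_eq hp₀ hχ hδ
    -- Curves in `Λ_t` are fixed by `ρ`, hence so are their velocities; on them `ω` and `ρ^* ω`
    -- agree.
    have hfix : ∀ w : E × (E →L[ℝ] ℝ),
        w ∈ tangentVectors (cotangentModel E) (χ t '' 𝒢.dualAlgebroidNonzero) δ →
        md (cotangentModel E) (cotangentModel E) ρ δ w = w := by
      rintro w ⟨c, hc0, hcS, hc⟩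
      subst hc0
      have hc' : HasMD 𝓘(ℝ, ℝ) (cotangentModel E) c 0 ((1 : ℝ →L[ℝ] ℝ).smulRight w) := hc
      have h1 := (hρ.hasMD (by simp)).comp hc'
      have h2 := h1.unique (hc'.congr (hcS.mono fun τ hτ ↦ flow_cotSrc_eq hp₀ hχ hτ))
      simpa using congrArg (fun A : ℝ →L[ℝ] E × (E →L[ℝ] ℝ) ↦ A 1) h2
    have hzero : ∀ᶠ z in 𝓝 δ, (0 : E × (E →L[ℝ] ℝ) →L[ℝ] ℝ) =
        (canForm (ρ z)).comp (md (cotangentModel E) (cotangentModel E) ρ z) := by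
      filter_upwards [𝒢.isOpen_compl_kerCotSrc.mem_nhds hδs] with z hz
      have hzU := 𝒢.notMem_kerCotRng (𝒢.cotSrc_mem_nonzero hz)
      have h1 := ((hχ.contMDiffAt_apply 𝒢.isOpen_compl_kerCotRng hp₀.contMDiffOn_comp hzU
        t).hasMD (by simp)).comp (hasMD_cotSrc z)
      have h2 : md (cotangentModel E) (cotangentModel E) ρ z = _ := h1.md_eq
      rw [h2, ← ContinuousLinearMap.comp_assoc, hχ.canForm_comp_md 𝒢.isOpen_compl_kerCotRng
        hp₀.contMDiffOn_comp (fun δ hδ ↦ hp₀.canForm_hamVec hδ) hzU, canForm_comp_md_cotSrc]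
    have h1 := symp_md_md (hρ.of_le (show ((2 : ℕ∞) : WithTop ℕ∞) ≤ ∞ from mod_cast le_top))
      (η := fun _ ↦ 0) hzero u v
    have h2 : extD (cotangentModel E) (fun _ : CotangentBundle E G ↦
        (0 : E × (E →L[ℝ] ℝ) →L[ℝ] ℝ)) δ u v = 0 := by
      rw [← extD_md (I := cotangentModel E) (x := δ) (φ := fun _ ↦ (0 : ℝ)) contMDiffAt_const u v]
      exact congrFun (congrFun (extD_congr (Eventually.of_forall fun z ↦
        (hasMD_const (I := cotangentModel E) (J := 𝓘(ℝ, ℝ)) (0 : ℝ) z).md_eq.symm)) u) v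
    rw [hfix u hu, hfix v hv, h2, neg_zero] at h1
    exact (symplecticForm_eq_symp δ u v).trans h1

/-- `r_Γ(χ_{-t}(r_Γ(χ_t(η)))) = η`. -/
lemma cotRng_flow_neg_cotRng_flow {η : CotangentBundle E G} (hη : η ∈ 𝒢.dualAlgebroidNonzero)
    (t : ℝ) : 𝒢.cotRng (χ (-t) (𝒢.cotRng (χ t η))) = η := by
  have hηU := 𝒢.notMem_kerCotRng hη
  rw [← cotRng_flow hp₀ hχ (hχ.mem hηU t),
    hχ.neg_apply 𝒢.isOpen_compl_kerCotRng hp₀.contMDiffOn_comp hηU, 𝒢.cotRng_of_mem hη.1]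

omit hp₀ hχ [FiniteDimensional ℝ E] [FiniteDimensional ℝ F]
  [IsManifold 𝓘(ℝ, F) ∞ M] [T2Space G] in
lemma isOpen_dualAlgebroidNonzero_inter : ∃ O : Set (CotangentBundle E G),
    IsOpen O ∧ 𝒢.dualAlgebroidNonzero = O ∩ 𝒢.dualAlgebroid :=
  ⟨_, isOpen_form_ne_zero, ext fun _ ↦ and_comm⟩

lemma isDiffeoOntoImage_cotSrc (t : ℝ) :
    𝒢.IsDiffeoOntoImage 𝒢.cotSrc (χ t '' 𝒢.dualAlgebroidNonzero) := by
  have himage : 𝒢.cotSrc '' (χ t '' 𝒢.dualAlgebroidNonzero) = 𝒢.dualAlgebroidNonzero := by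
    rw [image_image]
    refine Subset.antisymm ?_ fun η hη ↦ ⟨η, hη, cotSrc_flow hp₀ hχ hη t⟩
    rintro _ ⟨η, hη, rfl⟩
    change 𝒢.cotSrc (χ t η) ∈ _
    rwa [cotSrc_flow hp₀ hχ hη]
  refine ⟨𝒢.contMDiff_cotSrc.contMDiffOn,
    ⟨χ t, fun η hη ↦ ?_, fun δ hδ ↦ flow_cotSrc_eq hp₀ hχ hδ⟩, ?_⟩
  · rw [himage] at hη
    exact (hχ.contMDiffAt_apply 𝒢.isOpen_compl_kerCotRng hp₀.contMDiffOn_comp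
      (𝒢.notMem_kerCotRng hη) t).contMDiffWithinAt
  · rw [himage]
    exact isOpen_dualAlgebroidNonzero_inter

/-- From `r_Γ ∘ χ_t ∘ r_Γ = r_Γ ∘ χ_t`, the maps `r_Γ ∘ χ_t` and `r_Γ ∘ χ_{-t}` are mutually inverse
on `A*G ∖ 0`. So the image is all of `A*G ∖ 0`, and the inverse of `r_Γ` on `Λ_t` is `χ_t ∘ r_Γ ∘
χ_{-t}`. -/
lemma isDiffeoOntoImage_cotRng (t : ℝ) :
    𝒢.IsDiffeoOntoImage 𝒢.cotRng (χ t '' 𝒢.dualAlgebroidNonzero) := by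
  have hU := 𝒢.isOpen_compl_kerCotRng
  have hp := hp₀.contMDiffOn_comp
  have himage : 𝒢.cotRng '' (χ t '' 𝒢.dualAlgebroidNonzero) = 𝒢.dualAlgebroidNonzero := by
    rw [image_image]
    refine Subset.antisymm ?_ fun ζ hζ ↦ ?_
    · rintro _ ⟨η, hη, rfl⟩
      exact 𝒢.cotRng_mem_nonzero (hχ.mem (𝒢.notMem_kerCotRng hη) t)
    · refine ⟨𝒢.cotRng (χ (-t) ζ),
        𝒢.cotRng_mem_nonzero (hχ.mem (𝒢.notMem_kerCotRng hζ) (-t)), ?_⟩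
      have h := cotRng_flow_neg_cotRng_flow hp₀ hχ hζ (-t)
      rwa [neg_neg] at h
  refine ⟨𝒢.contMDiff_cotRng.contMDiffOn,
    ⟨fun ζ ↦ χ t (𝒢.cotRng (χ (-t) ζ)), fun ζ hζ ↦ ?_, ?_⟩, ?_⟩
  · rw [himage] at hζ
    have hζU := hχ.mem (𝒢.notMem_kerCotRng hζ) (-t)
    have h1 := 𝒢.contMDiff_cotRng.contMDiffAt.comp ζ
      (hχ.contMDiffAt_apply hU hp (𝒢.notMem_kerCotRng hζ) (-t))
    exact (ContMDiffAt.comp ζ (hχ.contMDiffAt_apply hU hp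
      (𝒢.notMem_kerCotRng (𝒢.cotRng_mem_nonzero hζU)) t) h1).contMDiffWithinAt
  · rintro _ ⟨η, hη, rfl⟩
    exact congrArg (χ t) (cotRng_flow_neg_cotRng_flow hp₀ hχ hη t)
  · rw [himage]
    exact isOpen_dualAlgebroidNonzero_inter

theorem isInvertibleGRelation_flow (t : ℝ) :
    𝒢.IsInvertibleGRelation (χ t '' 𝒢.dualAlgebroidNonzero) where
  isGRelation :=
    { lagrangian := isHomogeneousLagrangian_flow hp₀ hχ t
      notMem_kerCotRng := by
        rintro _ ⟨η, hη, rfl⟩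
        exact hχ.mem (𝒢.notMem_kerCotRng hη) t
      notMem_kerCotSrc := fun δ hδ ↦ image_flow_subset hp₀ hχ t hδ }
  diffeo_cotSrc := isDiffeoOntoImage_cotSrc hp₀ hχ t
  diffeo_cotRng := isDiffeoOntoImage_cotRng hp₀ hχ t

end Lagrangian

end LieGroupoid

end

theorem mainTheorem7
    {E F G M : Type*}
    [NormedAddCommGroup E] [NormedSpace ℝ E] [FiniteDimensional ℝ E]
    [NormedAddCommGroup F] [NormedSpace ℝ F] [FiniteDimensional ℝ F]
    [TopologicalSpace G] [T2Space G] [ChartedSpace E G] [IsManifold 𝓘(ℝ, E) ∞ G]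
    [TopologicalSpace M] [T2Space M] [CompactSpace M] [ChartedSpace F M]
    [IsManifold 𝓘(ℝ, F) ∞ M]
    (𝒢 : LieGroupoid E F G M)
    (p₀ : CotangentBundle E G → ℝ) (hp₀ : 𝒢.IsHomogeneousSymbol p₀) :
    (∃ χ, IsHamiltonianFlow (p₀ ∘ 𝒢.cotRng) 𝒢.kerCotRngᶜ χ) ∧
    ∀ χ, IsHamiltonianFlow (p₀ ∘ 𝒢.cotRng) 𝒢.kerCotRngᶜ χ →
      (∀ t : ℝ, 𝒢.IsInvertibleGRelation (χ t '' 𝒢.dualAlgebroidNonzero)) ∧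
      ∀ t₁ t₂ : ℝ,
        𝒢.cotMulSet (χ t₁ '' 𝒢.dualAlgebroidNonzero) (χ t₂ '' 𝒢.dualAlgebroidNonzero) =
          χ (t₁ + t₂) '' 𝒢.dualAlgebroidNonzero := by
  refine ⟨?_, fun χ hχ ↦ ?_⟩
  · obtain ⟨χ, hχ⟩ := hp₀.exists_isHamFlow
    exact ⟨χ, isHamiltonianFlow_iff.2 hχ⟩
  · have hχ' := isHamiltonianFlow_iff.1 hχ
    exact ⟨fun t ↦ LieGroupoid.isInvertibleGRelation_flow hp₀ hχ' t,
      fun t₁ t₂ ↦ LieGroupoid.cotMulSet_flow hp₀ hχ' t₁ t₂⟩
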